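/- Let $\Sigma\subset\mathbb R^3$ be the unit sphere with surface measure, let $B\ge 0$ be the self-adjoint (positive) Laplace–Beltrami operator on $L^2(\Sigma)$, let $H^2(\Sigma)=\mathcal D(B)$ and $H^4(\Sigma)=\mathcal D(B^2)$ with norm $\|f\|_{H^4}=\|(1+B)^2f\|_{L^2(\Sigma)}$, and let $\|\cdot\|$ denote the norm of $L^2(\Sigma)$. Let $\tfrac12<\gamma<1$. Say that a real function $V(\tau,\theta)$ satisfies Conditions A1 with constant $A$ if $V\in C^2([1,\infty)\times\Sigma)$ and, for all $\tau\ge1$, $$\|V(\tau,\cdot)\|_{L^\infty(\Sigma)}<A\tau^{-\gamma},\qquad \Big\|\frac{\partial V}{\partial\tau}(\tau,\cdot)\Big\|_{L^\infty(\Sigma)}<A\tau^{-1-\gamma},\qquad \Big\|\frac{\partial^2V}{\partial\tau^2}(\tau,\cdot)\Big\|_{L^\infty(\Sigma)}<A\tau^{-1-2\gamma}.$$ For $k>0$ and $f\in L^2(\Sigma)$ let $W(k,\tau)f=U(k,1,\tau)f$, where $U(k,\tau_0,\tau)$ is the propagator of the evolution equation $$ik\,y_\tau=\frac{By}{\tau^2}+V(\tau,\cdot)\,y,$$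 defined by its Duhamel expansion: $U(k,\tau_0,\tau)f=\sum_{n\ge0}D_n(\tau)$ with $D_0(\tau)=U_0(k,\tau_0,\tau)f$ and $D_{n+1}(\tau)=\frac1{ik}\int_{\tau_0}^{\tau}U_0(k,s,\tau)V(s,\cdot)D_n(s)\,ds$, where $U_0(k,\tau_0,\tau)=\exp\Big[\frac1{ik}\frac{\tau-\tau_0}{\tau\tau_0}B\Big]$. Let $I=[a,b]\subset(0,\infty)$ be a compact interval. For every $f\in H^4(\Sigma)$, all $k\in I$ and all $\tau\ge 1$, the derivatives below (one-sided in $\tau$ at $\tau=1$) exist in the norm of $L^2(\Sigma)$, the two mixed derivatives $\partial_k\partial_\tau W(k,\tau)f$ and $\partial_\tau\partial_k W(k,\tau)f$ exist and coincide, and $$\|W_\tau(k,\tau)f\|<C_1\tau^{-\gamma},\qquad \|W_k(k,\tau)f\|<C_1\tau^{1-\gamma},$$ $$\|W_{\tau\tau}(k,\tau)f\|<C_2\tau^{-2\gamma},\qquad \|W_{\tau k}(k,\tau)f\|<C_2\tau^{1-2\gamma},\qquad \|W_{kk}(k,\tau)f\|<C_2\tau^{2-2\gamma}.$$ Here $C_1$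 depends only on $I$, $\gamma$, $A$ and an upper bound for $\|f\|_{H^4(\Sigma)}$, and $C_2$ depends only on these and on an upper bound for the norm of $V(1,\cdot)$ in $C^2(\Sigma)$. -/

import Mathlib

open MeasureTheory Set Metric
open scoped ContDiff InnerProductSpace

noncomputable section

namespace SphereEvolution

/-- Euclidean three-space. -/
abbrev E3 : Type := EuclideanSpace ℝ (Fin 3)

/-- The unit sphere `Σ` of `ℝ³`. -/
abbrev S2 : Type := sphere (0 : E3) 1

/-- The surface measure of the sphere (total mass `4π`). -/
abbrev surf : Measure S2 := (volume : Measure E3).toSphere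

/-- The Hilbert space `L²(Σ)`. -/
abbrev L2S : Type := Lp ℂ 2 surf

/-- The direction `x / |x|` of a vector (with an arbitrary value at the origin). -/
def dir (x : E3) : S2 :=
  if hx : x = 0 then ⟨EuclideanSpace.single 0 1, by simp⟩
  else ⟨‖x‖⁻¹ • x, by
    have : ‖x‖ ≠ 0 := norm_ne_zero_iff.mpr hx
    simp [norm_smul, this]⟩

/-- The extension of a function on the sphere to `ℝ³ \ {0}`, homogeneous of degree zero. -/
def radialExt {F : Type*} (φ : S2 → F) : E3 → F := fun x => φ (dir x)

/-- Smooth functions on the sphere: the radial extension is smooth off the origin. -/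
def SmoothOnSphere (φ : S2 → ℂ) : Prop := ContDiffOn ℝ ∞ (radialExt φ) {0}ᶜ

/-- The positive Laplace-Beltrami operator on functions of class `C²`.  Since
`Δ = ∂_r² + (2/r) ∂_r - B / r²`, one has `Bφ = -Δ (radialExt φ)` on the unit sphere. -/
def sphLap (φ : S2 → ℂ) : S2 → ℂ := fun θ => -(Laplacian.laplacian (radialExt φ) (θ : E3))

/-- `f` is in the domain of the self-adjoint Laplace-Beltrami operator `B` on `L²(Σ)` and
`B f = g`, that is, `B f = g` in the sense of distributions on the sphere.  (The operator with
domain `C^∞(Σ)` is essentially self-adjoint, so its adjoint is its self-adjoint closure.) -/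
def IsB (f g : L2S) : Prop :=
  ∀ φ : S2 → ℂ, SmoothOnSphere φ → ∫ θ, φ θ * g θ ∂surf = ∫ θ, sphLap φ θ * f θ ∂surf

open Classical in
/-- The Laplace-Beltrami operator on its domain (and zero off its domain). -/
def lapB (f : L2S) : L2S := if h : ∃ g, IsB f g then h.choose else 0

/-- The Sobolev space `H²(Σ)`, the domain of `B`. -/
def MemH2 (f : L2S) : Prop := ∃ g, IsB f g

/-- The Sobolev space `H⁴(Σ)`, the domain of `B²`. -/
def MemH4 (f : L2S) : Prop := ∃ g, IsB f g ∧ MemH2 g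

/-- The norm `‖(1 + B)² f‖` of `H⁴(Σ)`. -/
def normH4 (f : L2S) : ℝ := ‖f + (2 : ℂ) • lapB f + lapB (lapB f)‖

theorem dir_coe (θ : S2) : dir (θ : E3) = θ := by
  have h1 : ‖(θ : E3)‖ = 1 := by simp
  have h0 : (θ : E3) ≠ 0 := by
    intro h
    rw [h, norm_zero] at h1
    exact zero_ne_one h1
  ext1
  simp [dir, h0]

theorem coe_ne_zero (θ : S2) : (θ : E3) ∈ ({0}ᶜ : Set E3) := by
  intro h
  have h1 : ‖(θ : E3)‖ = 1 := by simp
  rw [mem_singleton_iff] at h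
  rw [h, norm_zero] at h1
  exact zero_ne_one h1

theorem SmoothOnSphere.continuous {φ : S2 → ℂ} (h : SmoothOnSphere φ) : Continuous φ := by
  have h1 : Continuous fun θ : S2 => radialExt φ (θ : E3) :=
    h.continuousOn.comp_continuous continuous_subtype_val coe_ne_zero
  simpa [radialExt, dir_coe] using h1

theorem SmoothOnSphere.continuous_sphLap {φ : S2 → ℂ} (h : SmoothOnSphere φ) :
    Continuous (sphLap φ) := by
  have ho : IsOpen ({0}ᶜ : Set E3) := isOpen_compl_singleton
  have h2 : ContinuousOn (iteratedFDeriv ℝ 2 (radialExt φ)) {0}ᶜ :=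
    (h.continuousOn_iteratedFDerivWithin (m := 2) (WithTop.coe_le_coe.mpr (le_top : ((2 : ℕ) : ℕ∞) ≤ ⊤))
      ho.uniqueDiffOn).congr fun x hx => (iteratedFDerivWithin_of_isOpen 2 ho hx).symm
  have h3 : Continuous fun θ : S2 => iteratedFDeriv ℝ 2 (radialExt φ) (θ : E3) :=
    h2.comp_continuous continuous_subtype_val coe_ne_zero
  unfold sphLap
  rw [InnerProductSpace.laplacian_eq_iteratedFDeriv_stdOrthonormalBasis]
  fun_prop

theorem integrable_mul {u : S2 → ℂ} (hu : Continuous u) (f : L2S) :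
    Integrable (fun θ => u θ * f θ) surf := by
  have hf : Integrable (f : S2 → ℂ) surf := (Lp.memLp f).integrable (by norm_num)
  obtain ⟨C, hC⟩ := (isCompact_univ (X := S2)).exists_bound_of_continuousOn hu.continuousOn
  exact hf.bdd_mul hu.aestronglyMeasurable (ae_of_all _ fun θ => hC θ (mem_univ θ))

theorem IsB.add {f g f' g' : L2S} (h : IsB f g) (h' : IsB f' g') : IsB (f + f') (g + g') := by
  intro φ hφ
  have e1 : ∫ θ, φ θ * (g + g') θ ∂surf = ∫ θ, (φ θ * g θ + φ θ * g' θ) ∂surf := by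
    refine integral_congr_ae ?_
    filter_upwards [Lp.coeFn_add g g'] with θ hθ
    rw [hθ, Pi.add_apply, mul_add]
  have e2 : ∫ θ, sphLap φ θ * (f + f') θ ∂surf =
      ∫ θ, (sphLap φ θ * f θ + sphLap φ θ * f' θ) ∂surf := by
    refine integral_congr_ae ?_
    filter_upwards [Lp.coeFn_add f f'] with θ hθ
    rw [hθ, Pi.add_apply, mul_add]
  rw [e1, e2, integral_add (integrable_mul hφ.continuous _) (integrable_mul hφ.continuous _),
    integral_add (integrable_mul hφ.continuous_sphLap _) (integrable_mul hφ.continuous_sphLap _),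
    h φ hφ, h' φ hφ]

theorem IsB.smul {f g : L2S} (c : ℂ) (h : IsB f g) : IsB (c • f) (c • g) := by
  intro φ hφ
  have e1 : ∫ θ, φ θ * (c • g) θ ∂surf = ∫ θ, c * (φ θ * g θ) ∂surf := by
    refine integral_congr_ae ?_
    filter_upwards [Lp.coeFn_smul c g] with θ hθ
    rw [hθ, Pi.smul_apply, smul_eq_mul]
    ring
  have e2 : ∫ θ, sphLap φ θ * (c • f) θ ∂surf = ∫ θ, c * (sphLap φ θ * f θ) ∂surf := by
    refine integral_congr_ae ?_
    filter_upwards [Lp.coeFn_smul c f] with θ hθ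
    rw [hθ, Pi.smul_apply, smul_eq_mul]
    ring
  rw [e1, e2, integral_const_mul, integral_const_mul, h φ hφ]

/-- The eigenspace of `B` for the number `l`. -/
def eigenB (l : ℝ) : Submodule ℂ L2S where
  carrier := {f | IsB f ((l : ℂ) • f)}
  add_mem' := by
    intro f f' h h'
    change IsB (f + f') ((l : ℂ) • (f + f'))
    rw [smul_add]
    exact IsB.add h h'
  zero_mem' := by
    have h : IsB 0 0 := by
      intro φ _
      have hz := Lp.coeFn_zero ℂ 2 surf
      have e1 : ∫ θ, φ θ * (0 : L2S) θ ∂surf = 0 := by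
        rw [← integral_zero S2 ℂ (μ := surf)]
        refine integral_congr_ae ?_
        filter_upwards [hz] with θ hθ
        rw [hθ]; simp
      have e2 : ∫ θ, sphLap φ θ * (0 : L2S) θ ∂surf = 0 := by
        rw [← integral_zero S2 ℂ (μ := surf)]
        refine integral_congr_ae ?_
        filter_upwards [hz] with θ hθ
        rw [hθ]; simp
      rw [e1, e2]
    change IsB 0 ((l : ℂ) • (0 : L2S))
    rw [smul_zero]
    exact h
  smul_mem' := by
    intro c f h
    change IsB (c • f) ((l : ℂ) • c • f)
    rw [smul_comm]
    exact IsB.smul c h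

/-- `exp (z B) f`, by the spectral theorem for `B`, which has pure point spectrum: the sum over
all real `l` of `exp (z l)` times the orthogonal projection of `f` to the eigenspace of `l`
(which is already closed; all but countably many terms vanish). -/
def expB (z : ℂ) (f : L2S) : L2S :=
  ∑' l : ℝ, Complex.exp (z * l) • (eigenB l).topologicalClosure.starProjection f

/-- The free evolution `U₀(k, τ₀, τ) = exp [ (1/(ik)) ((τ - τ₀)/(τ τ₀)) B ]`. -/
def freeU (k τ₀ τ : ℝ) (f : L2S) : L2S :=
  expB (1 / (Complex.I * k) * ((τ - τ₀) / (τ * τ₀))) f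

open Classical in
/-- Multiplication of an element of `L²(Σ)` by a real function (zero if the product is not in
`L²(Σ)`, which does not happen for a continuous function). -/
def mulL2 (v : S2 → ℝ) (f : L2S) : L2S :=
  if h : MemLp (fun θ => (v θ : ℂ) * f θ) 2 surf then h.toLp else 0

/-- The terms of the Duhamel expansion:
`D₀(τ) = U₀(k, τ₀, τ) f` and `D_{n+1}(τ) = (1/(ik)) ∫_{τ₀}^τ U₀(k, s, τ) V(s) D_n(s) ds`. -/
def duhamel (V : ℝ → S2 → ℝ) (k τ₀ : ℝ) (f : L2S) : ℕ → ℝ → L2S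
  | 0, τ => freeU k τ₀ τ f
  | n + 1, τ => (1 / (Complex.I * k)) •
      ∫ s in τ₀..τ, freeU k s τ (mulL2 (V s) (duhamel V k τ₀ f n s))

/-- The propagator `U(k, τ₀, τ)` of `i k y_τ = τ⁻² B y + V y`, given by the Duhamel expansion. -/
def propU (V : ℝ → S2 → ℝ) (k τ₀ τ : ℝ) (f : L2S) : L2S := ∑' n, duhamel V k τ₀ f n τ

/-- `W(k, τ) f = U(k, 1, τ) f`. -/
def W (V : ℝ → S2 → ℝ) (f : L2S) (k τ : ℝ) : L2S := propU V k 1 τ f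

/-- The derivative with respect to `τ ∈ [1, ∞)`, in `L²(Σ)` (one-sided at `τ = 1`). -/
def dtau (F : ℝ → ℝ → L2S) (k τ : ℝ) : L2S := derivWithin (fun t => F k t) (Ici 1) τ

/-- The derivative with respect to `k`, in `L²(Σ)`. -/
def dk (F : ℝ → ℝ → L2S) (k τ : ℝ) : L2S := deriv (fun κ => F κ τ) k

/-- `F` is differentiable in `τ` at the point `(k, τ)`, in the norm of `L²(Σ)`. -/
def DiffTau (F : ℝ → ℝ → L2S) (k τ : ℝ) : Prop :=
  DifferentiableWithinAt ℝ (fun t => F k t) (Ici 1) τ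

/-- `F` is differentiable in `k` at the point `(k, τ)`, in the norm of `L²(Σ)`. -/
def DiffK (F : ℝ → ℝ → L2S) (k τ : ℝ) : Prop :=
  DifferentiableAt ℝ (fun κ => F κ τ) k

/-- The conditions on the potential: `V ∈ C²([1,∞) × Σ)`, with the bounds
`|V| < A τ^{-γ}`, `|V_τ| < A τ^{-1-γ}`, `|V_ττ| < A τ^{-1-2γ}`, where `1/2 < γ < 1`. -/
structure CondA1 (γ A : ℝ) (V : ℝ → S2 → ℝ) : Prop where
  half_lt : 1 / 2 < γ
  lt_one : γ < 1
  contDiff : ContDiffOn ℝ 2 (fun p : ℝ × E3 => radialExt (V p.1) p.2) (Ici 1 ×ˢ {0}ᶜ)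
  bound : ∀ τ : ℝ, 1 ≤ τ → ∀ θ : S2, |V τ θ| < A * τ ^ (-γ)
  bound_deriv : ∀ τ : ℝ, 1 ≤ τ → ∀ θ : S2,
    |derivWithin (fun t => V t θ) (Ici 1) τ| < A * τ ^ (-1 - γ)
  bound_deriv2 : ∀ τ : ℝ, 1 ≤ τ → ∀ θ : S2,
    |iteratedDerivWithin 2 (fun t => V t θ) (Ici 1) τ| < A * τ ^ (-1 - 2 * γ)

/-- The `C²(Σ)` norm of `v` is at most `M`: the derivatives of order at most two of the radial
extension of `v` are bounded by `M` on the sphere. -/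
def C2Bound (M : ℝ) (v : S2 → ℝ) : Prop :=
  ∀ j : ℕ, j ≤ 2 → ∀ θ : S2, ‖iteratedFDeriv ℝ j (radialExt v) (θ : E3)‖ ≤ M

end SphereEvolution

end

open SphereEvolution

/-!
The substitution `t = 1 - 1 / τ` turns the evolution equation into `i k y_t = B y + q(t) y` on
`[0, 1)`, with `q(t) = τ² V(τ, ·)`, and the Duhamel expansion becomes, in the time `σ = t / k`, the
Volterra series of the bounded perturbation `-i q(k σ)` of the unitary group `exp(-i σ B)`
(`duhamel_eq_iterate`, `W_eq_solution`).  Two questions remain: regularity in `(t, k)` and growth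
as `t → 1`.

*Regularity.*  For a group of contractions and a `C¹` family of potentials, the sum of the Volterra
series is jointly `C¹` in time and parameter when the initial value is in the domain of the
generator (`hasFDerivAt_duhamelSum`).  The derivatives solve the linearised equation, which is of
the same kind on `E × E`.  Iterating gives `C²` if, moreover, the initial time derivative is in the
domain (`contDiff_two_duhamelSum`), here `B f + V(1, ·) f` up to a factor.  For `f` in `H⁴` the
first summand is in the domain of `B`, and so is the second because multiplication by a `C²`
function is bounded in the graph norm (`IsB.mulL2`).  Symmetry of second derivatives then makes the
mixed derivatives coincide.

*Growth.*  Since `B` and `q` are symmetric, the norm of a solution of `i k u' = B u + q u + g`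
grows only through the source `g` (`norm_le_of_energy`).  The source is `q_t y` for `y_t` and
`-i y_t` for `y_k`, and with `|q_t| ≲ τ^(3 - γ)` integration over `t` gives `‖y_t‖ ≲ τ^(2 - γ)` and
`‖y_k‖ ≲ τ^(1 - γ)`.  The second derivatives are treated in the same way.  As `y` has no third
derivatives, the estimate is applied to difference quotients of `y_t` and `y_k`
(`norm_le_of_energy_limit`).  Since `∂_τ = τ⁻² ∂_t`, these are the asserted powers of `τ`.

*The operator `B`.*  It is given weakly, by pairing with smooth functions, while the free evolution
is given by the projections to its eigenspaces.  The two agree (`isB_iff`) because smooth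
eigenfunctions are total in `L²` (`isSpectralFamily_eigB`).  Indeed powers of linear forms are
combinations of smooth eigenfunctions (`ridge_mem_span`), their exponential series give the
exponentials of linear forms, and the span of these is an algebra to which the Stone-Weierstrass
theorem applies.  Orthogonality and the Dirichlet form come from Green's formula on the sphere
(`integral_mul_sphLap`), which follows from the divergence theorem in a spherical shell.
-/

namespace SphereEvolution

open Filter Topology

/-! ### Volterra series for a group of contractions -/

section Volterra

variable {E : Type*} [NormedAddCommGroup E] [NormedSpace ℝ E]

/-- A strongly continuous one-parameter group of contractions (hence of isometries). -/
structure IsContractionGroup (G : ℝ → E →L[ℝ] E) : Prop where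
  zero : G 0 = 1
  add : ∀ s t, G (s + t) = G s * G t
  norm_le : ∀ t x, ‖G t x‖ ≤ ‖x‖
  continuous_apply : ∀ x, Continuous fun t => G t x

/-- The Volterra operator `u ↦ ∫₀^σ G(σ - r) p(r) u(r) dr`. -/
noncomputable def volterra (G p : ℝ → E →L[ℝ] E) (u : ℝ → E) (σ : ℝ) : E :=
  ∫ r in (0 : ℝ)..σ, G (σ - r) (p r (u r))

/-- The Duhamel series with potential `p` and initial value `f`. -/
noncomputable def duhamelSum (G p : ℝ → E →L[ℝ] E) (f : E) (σ : ℝ) : E :=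
  ∑' n, (volterra G p)^[n] (fun r => G r f) σ

variable {G : ℝ → E →L[ℝ] E}

namespace IsContractionGroup

theorem continuous_uncurry (hG : IsContractionGroup G) :
    Continuous fun x : ℝ × E => G x.1 x.2 := by
  rw [continuous_iff_continuousAt]
  rintro ⟨t, x⟩
  rw [ContinuousAt, tendsto_iff_norm_sub_tendsto_zero]
  have h1 : Tendsto (fun z : ℝ × E => ‖z.2 - x‖ + ‖G z.1 x - G t x‖) (𝓝 (t, x)) (𝓝 0) := by
    have : Continuous fun z : ℝ × E => ‖z.2 - x‖ + ‖G z.1 x - G t x‖ := by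
      have h := (hG.continuous_apply x).comp (continuous_fst (X := ℝ) (Y := E))
      exact (continuous_snd.sub continuous_const).norm.add (h.sub continuous_const).norm
    simpa using this.tendsto (t, x)
  refine squeeze_zero (fun _ => norm_nonneg _) (fun z => ?_) h1
  calc ‖G z.1 z.2 - G t x‖ = ‖G z.1 (z.2 - x) + (G z.1 x - G t x)‖ := by
        rw [map_sub]; abel_nf
    _ ≤ _ := (norm_add_le _ _).trans (by gcongr; exact hG.norm_le _ _)

theorem continuous_comp (hG : IsContractionGroup G) {X : Type*} [TopologicalSpace X]
    {s : X → ℝ} {u : X → E} (hs : Continuous s) (hu : Continuous u) :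
    Continuous fun x => G (s x) (u x) :=
  hG.continuous_uncurry.comp (hs.prodMk hu)

theorem prodMap (hG : IsContractionGroup G) :
    IsContractionGroup (fun t => (G t).prodMap (G t)) where
  zero := by ext x <;> simp [hG.zero]
  add s t := by ext x <;> simp [hG.add]
  norm_le t x := max_le_max (hG.norm_le _ _) (hG.norm_le _ _)
  continuous_apply x := (hG.continuous_apply x.1).prodMk (hG.continuous_apply x.2)

end IsContractionGroup

theorem norm_integral_le_pow {g : ℝ → E} {C σ : ℝ} {n : ℕ}
    (h : ∀ r, |r| ≤ |σ| → ‖g r‖ ≤ C * |r| ^ n) :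
    ‖∫ r in (0 : ℝ)..σ, g r‖ ≤ C * (|σ| ^ (n + 1) / (n + 1)) := by
  rw [intervalIntegral.norm_integral_eq_norm_integral_uIoc]
  have e := integral_pow_abs_sub_uIoc (a := 0) (b := σ) n
  simp only [sub_zero] at e
  rw [← e, ← integral_const_mul]
  refine norm_integral_le_of_norm_le ?_ ?_
  · have : Continuous fun r : ℝ => C * |r| ^ n := by fun_prop
    exact (this.intervalIntegrable 0 σ).def'
  · refine (ae_restrict_iff' measurableSet_uIoc).2 (ae_of_all _ fun r hr => h r ?_)
    simpa using abs_sub_left_of_mem_uIcc (uIoc_subset_uIcc hr)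

/-- The factorial gain that makes the Duhamel series converge for every bounded potential. -/
theorem norm_iterate_volterra_le (hG : IsContractionGroup G) {p : ℝ → E →L[ℝ] E} {e : ℝ → E}
    {M T ε : ℝ} (hM : ∀ r, |r| ≤ T → ‖p r‖ ≤ M) (he : ∀ r, |r| ≤ T → ‖e r‖ ≤ ε) (n : ℕ) :
    ∀ σ, |σ| ≤ T → ‖(volterra G p)^[n] e σ‖ ≤ ε * ((M * |σ|) ^ n / n.factorial) := by
  induction n with
  | zero => intro σ hσ; simpa using he σ hσ
  | succ n ih =>
    intro σ hσ
    rw [Function.iterate_succ_apply']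
    have hb : ∀ r, |r| ≤ |σ| → ‖G (σ - r) (p r ((volterra G p)^[n] e r))‖ ≤
        (M * (ε * (M ^ n / n.factorial))) * |r| ^ n := by
      intro r hr
      have hM0 : 0 ≤ M := (norm_nonneg _).trans (hM r (hr.trans hσ))
      calc _ ≤ ‖p r ((volterra G p)^[n] e r)‖ := hG.norm_le _ _
        _ ≤ M * (ε * ((M * |r|) ^ n / n.factorial)) :=
          (ContinuousLinearMap.le_opNorm _ _).trans
            (mul_le_mul (hM r (hr.trans hσ)) (ih r (hr.trans hσ)) (norm_nonneg _) hM0)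
        _ = _ := by rw [mul_pow]; ring
    refine (norm_integral_le_pow hb).trans (le_of_eq ?_)
    rw [Nat.factorial_succ]
    push_cast
    field_simp
    ring

/-- Joint continuity in time and in a parameter on which potential and source depend. -/
theorem continuous_iterate_volterra (hG : IsContractionGroup G) {P : ℝ × ℝ → E →L[ℝ] E}
    (hP : Continuous P) {e : ℝ × ℝ → E} (he : Continuous e) (n : ℕ) :
    Continuous fun x : ℝ × ℝ =>
      (volterra G fun r => P (r, x.2))^[n] (fun r => e (r, x.2)) x.1 := by
  induction n with
  | zero => simpa using he
  | succ n ih =>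
    simp only [Function.iterate_succ_apply', volterra]
    refine intervalIntegral.continuous_parametric_intervalIntegral_of_continuous
      (f := fun (x : ℝ × ℝ) r => G (x.1 - r) (P (r, x.2)
        ((volterra G fun r => P (r, x.2))^[n] (fun r => e (r, x.2)) r))) ?_ continuous_fst
    have h2 := ih.comp (continuous_snd.prodMk (continuous_snd.comp continuous_fst) :
      Continuous fun z : (ℝ × ℝ) × ℝ => (z.2, z.1.2))
    have h3 := hP.comp (continuous_snd.prodMk (continuous_snd.comp continuous_fst) :
      Continuous fun z : (ℝ × ℝ) × ℝ => (z.2, z.1.2))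
    exact hG.continuous_comp (by fun_prop) (h3.clm_apply h2)

theorem continuous_iterate_volterra_slice (hG : IsContractionGroup G) {p : ℝ → E →L[ℝ] E}
    (hp : Continuous p) {e : ℝ → E} (he : Continuous e) (n : ℕ) :
    Continuous ((volterra G p)^[n] e) :=
  (continuous_iterate_volterra hG (P := fun x => p x.1) (e := fun x => e x.1)
    (hp.comp continuous_fst) (he.comp continuous_fst) n).comp
    (continuous_id.prodMk continuous_const : Continuous fun σ : ℝ => (σ, (0 : ℝ)))

theorem volterra_integrand_continuous (hG : IsContractionGroup G) {p : ℝ → E →L[ℝ] E}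
    (hp : Continuous p) {u : ℝ → E} (hu : Continuous u) (σ : ℝ) :
    Continuous fun r => G (σ - r) (p r (u r)) :=
  hG.continuous_comp (by fun_prop) (hp.clm_apply hu)

theorem volterra_sub (hG : IsContractionGroup G) {p : ℝ → E →L[ℝ] E}
    (hp : Continuous p) {u v : ℝ → E} (hu : Continuous u) (hv : Continuous v) :
    volterra G p (u - v) = volterra G p u - volterra G p v := by
  ext σ
  simp only [volterra, Pi.sub_apply, map_sub]
  exact intervalIntegral.integral_sub
    ((volterra_integrand_continuous hG hp hu σ).intervalIntegrable _ _)
    ((volterra_integrand_continuous hG hp hv σ).intervalIntegrable _ _)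

theorem exists_bound_of_continuous {F : Type*} [SeminormedAddGroup F] {u : ℝ → F}
    (hu : Continuous u) (T : ℝ) : ∃ C, 0 ≤ C ∧ ∀ r, |r| ≤ T → ‖u r‖ ≤ C := by
  obtain ⟨C, hC⟩ := (isCompact_Icc (a := -T) (b := T)).exists_bound_of_continuousOn hu.continuousOn
  exact ⟨max C 0, le_max_right _ _, fun r hr => (hC r (abs_le.1 hr)).trans (le_max_left _ _)⟩

/-- Gronwall's inequality for the Volterra equation: if `u` solves the homogeneous equation up to
an error of size `ε`, then `u` is of size at most `ε exp (M T)`.  Indeed `u = e + K u`, with `K`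
the Volterra operator, gives `u = ∑_{j<n} Kʲ e + Kⁿ u` for every `n`. -/
theorem norm_le_of_volterra (hG : IsContractionGroup G) {p : ℝ → E →L[ℝ] E}
    (hp : Continuous p) {u : ℝ → E} (hu : Continuous u) {M T ε : ℝ}
    (hM : ∀ r, |r| ≤ T → ‖p r‖ ≤ M)
    (h : ∀ r, |r| ≤ T → ‖u r - volterra G p u r‖ ≤ ε) :
    ∀ σ, |σ| ≤ T → ‖u σ‖ ≤ ε * Real.exp (M * T) := by
  intro σ hσ
  have hT : 0 ≤ T := (abs_nonneg _).trans hσ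
  have hM0 : 0 ≤ M := (norm_nonneg _).trans (hM 0 (by simpa using hT))
  have hε : 0 ≤ ε := (norm_nonneg _).trans (h 0 (by simpa using hT))
  have hKc : ∀ {w : ℝ → E}, Continuous w → Continuous (volterra G p w) := fun hw =>
    continuous_iterate_volterra_slice hG hp hw 1
  set e : ℝ → E := u - volterra G p u with he
  have hdec : ∀ n : ℕ, u σ = (∑ j ∈ Finset.range n, (volterra G p)^[j] e σ) +
      (volterra G p)^[n] u σ := by
    intro n
    induction n with
    | zero => simp
    | succ n ih =>
      have : ∀ m : ℕ, (volterra G p)^[m] e = (volterra G p)^[m] u - (volterra G p)^[m + 1] u := by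
        intro m
        induction m with
        | zero => simp [he]
        | succ m ihm =>
          rw [Function.iterate_succ_apply', ihm, volterra_sub hG hp
            (continuous_iterate_volterra_slice hG hp hu m)
            (continuous_iterate_volterra_slice hG hp hu _)]
          simp only [Function.iterate_succ_apply']
      rw [Finset.sum_range_succ, this n, Pi.sub_apply]
      rw [ih]
      abel
  obtain ⟨C, hC0, hC⟩ := exists_bound_of_continuous hu T
  have hle : ∀ n : ℕ, ‖u σ‖ ≤ ε * Real.exp (M * T) + C * ((M * |σ|) ^ n / n.factorial) := by
    intro n
    rw [hdec n]
    refine (norm_add_le _ _).trans (add_le_add ?_ (norm_iterate_volterra_le hG hM hC n σ hσ))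
    refine (norm_sum_le _ _).trans ?_
    calc _ ≤ ∑ j ∈ Finset.range n, ε * ((M * |σ|) ^ j / j.factorial) :=
          Finset.sum_le_sum fun j _ => norm_iterate_volterra_le hG hM h j σ hσ
      _ = ε * ∑ j ∈ Finset.range n, ((M * |σ|) ^ j / j.factorial) := by rw [Finset.mul_sum]
      _ ≤ ε * Real.exp (M * |σ|) := by
          gcongr; exact Real.sum_le_exp_of_nonneg (by positivity) n
      _ ≤ _ := by gcongr
  have hlim : Tendsto (fun n : ℕ => ε * Real.exp (M * T) + C * ((M * |σ|) ^ n / n.factorial)) atTop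
      (𝓝 (ε * Real.exp (M * T) + C * 0)) :=
    ((FloorSemiring.tendsto_pow_div_factorial_atTop (M * |σ|)).const_mul C).const_add _
  simpa using ge_of_tendsto' hlim hle

/-- Uniqueness of continuous solutions of the Volterra equation. -/
theorem eq_of_volterra (hG : IsContractionGroup G) {p : ℝ → E →L[ℝ] E}
    (hp : Continuous p) {u v g : ℝ → E} (hu : Continuous u) (hv : Continuous v)
    (h : ∀ σ, u σ = g σ + volterra G p u σ) (h' : ∀ σ, v σ = g σ + volterra G p v σ) : u = v := by
  ext σ
  obtain ⟨M, -, hM⟩ := exists_bound_of_continuous hp |σ|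
  have := norm_le_of_volterra hG hp (hu.sub hv) (ε := 0) hM (fun r _ => by
    have e := congrFun (volterra_sub hG hp hu hv) r
    change ‖(u - v) r - volterra G p (u - v) r‖ ≤ 0
    rw [e, Pi.sub_apply, Pi.sub_apply, h r, h' r]
    simp) σ le_rfl
  rw [zero_mul, norm_le_zero_iff] at this
  exact sub_eq_zero.1 this

section Complete

variable [CompleteSpace E]

theorem summable_iterate_volterra (hG : IsContractionGroup G) {p : ℝ → E →L[ℝ] E}
    (hp : Continuous p) (f : E) (σ : ℝ) :
    Summable fun n => (volterra G p)^[n] (fun r => G r f) σ := by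
  obtain ⟨M, hM0, hM⟩ := exists_bound_of_continuous hp |σ|
  refine Summable.of_norm_bounded (g := fun n : ℕ => ‖f‖ * ((M * |σ|) ^ n / n.factorial))
    ((Real.summable_pow_div_factorial _).mul_left _) fun n =>
    norm_iterate_volterra_le hG hM (fun r _ => hG.norm_le r f) n σ le_rfl

/-- The Duhamel series depends continuously on time and on a parameter. -/
theorem continuous_duhamelSum (hG : IsContractionGroup G) {P : ℝ × ℝ → E →L[ℝ] E}
    (hP : Continuous P) {f : ℝ → E} (hf : Continuous f) :
    Continuous fun x : ℝ × ℝ => duhamelSum G (fun r => P (r, x.2)) (f x.2) x.1 := by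
  rw [continuous_iff_continuousAt]
  intro x
  set R := ‖x‖ + 1
  obtain ⟨M, hM⟩ := (isCompact_closedBall (0 : ℝ × ℝ) R).exists_bound_of_continuousOn
    hP.continuousOn
  obtain ⟨C, hC⟩ := (isCompact_closedBall (0 : ℝ) R).exists_bound_of_continuousOn
    hf.continuousOn
  have hR : 0 ≤ R := by positivity
  have hM0 : 0 ≤ M := (norm_nonneg _).trans (hM 0 (by simpa using hR))
  have hC0 : 0 ≤ C := (norm_nonneg _).trans (hC 0 (by simpa using hR))
  have hcont : ContinuousOn
      (fun x : ℝ × ℝ => duhamelSum G (fun r => P (r, x.2)) (f x.2) x.1) (closedBall 0 R) := by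
    unfold duhamelSum
    refine continuousOn_tsum (u := fun n : ℕ => C * ((M * R) ^ n / n.factorial))
      (fun n => (continuous_iterate_volterra hG hP (e := fun x => G x.1 (f x.2))
        (hG.continuous_comp continuous_fst (hf.comp continuous_snd)) n).continuousOn)
      ((Real.summable_pow_div_factorial _).mul_left _) ?_
    intro n z hz
    rw [mem_closedBall_zero_iff] at hz
    have h1 : |z.1| ≤ R := (norm_fst_le z).trans hz
    have h2 : |z.2| ≤ R := (norm_snd_le z).trans hz
    refine (norm_iterate_volterra_le hG (M := M) (T := R) (ε := C) ?_ ?_ n _ h1).trans ?_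
    · intro r hr
      refine hM _ ?_
      rw [mem_closedBall_zero_iff]
      exact max_le hr h2
    · intro r hr
      exact (hG.norm_le _ _).trans (hC _ (by simpa using h2))
    · gcongr
  exact hcont.continuousAt (mem_of_superset (ball_mem_nhds x one_pos) fun z hz => by
    rw [mem_closedBall_zero_iff]
    rw [mem_ball_iff_norm] at hz
    linarith [norm_le_norm_add_norm_sub' z x])

theorem continuous_duhamelSum_slice (hG : IsContractionGroup G) {p : ℝ → E →L[ℝ] E}
    (hp : Continuous p) (f : E) : Continuous (duhamelSum G p f) :=
  (continuous_duhamelSum hG (P := fun x => p x.1) (hp.comp continuous_fst)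
    (f := fun _ => f) continuous_const).comp
    (continuous_id.prodMk continuous_const : Continuous fun σ : ℝ => (σ, (0 : ℝ)))

/-- The sum of the Duhamel series solves the Volterra equation. -/
theorem duhamelSum_eq (hG : IsContractionGroup G) {p : ℝ → E →L[ℝ] E}
    (hp : Continuous p) (f : E) (σ : ℝ) :
    duhamelSum G p f σ = G σ f + volterra G p (duhamelSum G p f) σ := by
  have hs := summable_iterate_volterra hG hp f
  obtain ⟨M, hM0, hM⟩ := exists_bound_of_continuous hp |σ|
  have hcont := fun n => continuous_iterate_volterra_slice hG hp (hG.continuous_apply f) n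
  have key : HasSum (fun n => (volterra G p)^[n + 1] (fun r => G r f) σ)
      (volterra G p (duhamelSum G p f) σ) := by
    simp only [Function.iterate_succ_apply']
    refine intervalIntegral.hasSum_integral_of_dominated_convergence
      (bound := fun (n : ℕ) _ => M * (‖f‖ * ((M * |σ|) ^ n / n.factorial))) ?_ ?_ ?_ ?_ ?_
    · exact fun n => (volterra_integrand_continuous hG hp (hcont n) σ).aestronglyMeasurable
    · intro n
      refine ae_of_all _ fun r hr => ?_
      have hr' : |r| ≤ |σ| := by simpa using abs_sub_left_of_mem_uIcc (uIoc_subset_uIcc hr)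
      refine (hG.norm_le _ _).trans ((ContinuousLinearMap.le_opNorm _ _).trans ?_)
      refine mul_le_mul (hM r hr') ?_ (norm_nonneg _) hM0
      refine (norm_iterate_volterra_le hG hM (fun r _ => hG.norm_le r f) n r hr').trans ?_
      gcongr
    · exact ae_of_all _ fun _ _ => ((Real.summable_pow_div_factorial _).mul_left _).mul_left _
    · exact continuous_const.intervalIntegrable _ _
    · refine ae_of_all _ fun r _ => ?_
      exact ((G (σ - r)).comp (p r)).hasSum (hs r).hasSum
  rw [← key.tsum_eq]
  unfold duhamelSum
  rw [(hs σ).tsum_eq_zero_add]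
  simp

end Complete

end Volterra

/-! ### Differentiability of the Volterra series in the parameters -/

section Differentiability

variable {E : Type*} [NormedAddCommGroup E] [NormedSpace ℝ E] {G : ℝ → E →L[ℝ] E}

/-- The potential `(y, z) ↦ (p y, p' y + p z)` on `E × E`.  A solution `y` of the Volterra equation
with potential `p`, paired with its derivative `z` in a parameter, solves the equation with this
potential when `p'` is the derivative of `p`, so regularity results for `y` apply to `z` as well.
-/
def tangentPotential (p p' : ℝ → E →L[ℝ] E) (r : ℝ) : E × E →L[ℝ] E × E :=
  ((p r).comp (ContinuousLinearMap.fst ℝ E E)).prod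
    ((p' r).comp (ContinuousLinearMap.fst ℝ E E) + (p r).comp (ContinuousLinearMap.snd ℝ E E))

/-- Solutions shifted in time solve the equation with the shifted potential. -/
theorem sub_volterra_shift (hG : IsContractionGroup G) [CompleteSpace E] {p : ℝ → E →L[ℝ] E}
    (hp : Continuous p) (f : E) (h r : ℝ) :
    duhamelSum G p f (r + h) - volterra G (fun s => p (s + h)) (fun s => duhamelSum G p f (s + h)) r
      = G r (duhamelSum G p f h) := by
  have hy := continuous_duhamelSum_slice hG hp f
  have hyeq := duhamelSum_eq hG hp f
  generalize duhamelSum G p f = y at hy hyeq ⊢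
  have hI : ∀ a b c, IntervalIntegrable (fun s => G (c - s) (p s (y s))) volume a b := fun a b c =>
    (volterra_integrand_continuous hG hp hy c).intervalIntegrable _ _
  have e1 : volterra G (fun s => p (s + h)) (fun s => y (s + h)) r =
      ∫ s in h..r + h, G (r + h - s) (p s (y s)) := by
    have := intervalIntegral.integral_comp_add_right (a := 0) (b := r)
      (fun s => G (r + h - s) (p s (y s))) h
    rw [zero_add] at this
    rw [← this]
    unfold volterra
    congr 1
    ext s
    congr 2
    ring
  have e2 : volterra G p y (r + h) = G r (volterra G p y h) +
      ∫ s in h..r + h, G (r + h - s) (p s (y s)) := by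
    unfold volterra
    rw [← intervalIntegral.integral_add_adjacent_intervals (hI 0 h _) (hI h (r + h) _),
      ← ContinuousLinearMap.intervalIntegral_comp_comm _ (hI 0 h h)]
    congr 2
    ext s
    rw [show r + h - s = r + (h - s) by ring, hG.add]
    rfl
  rw [e1, hyeq (r + h), e2, hyeq h, map_add, hG.add]
  simp only [mul_apply_eq_comp]
  abel

theorem continuous_tangentPotential {X : Type*} [TopologicalSpace X] {p p' : X → ℝ → E →L[ℝ] E}
    {s : X → ℝ} (hp : Continuous fun x => p x (s x)) (hp' : Continuous fun x => p' x (s x)) :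
    Continuous fun x => tangentPotential (p x) (p' x) (s x) := by
  have h1 : Continuous fun x => (p x (s x)).comp (ContinuousLinearMap.fst ℝ E E) :=
    hp.clm_comp continuous_const
  have h2 : Continuous fun x => (p' x (s x)).comp (ContinuousLinearMap.fst ℝ E E) +
      (p x (s x)).comp (ContinuousLinearMap.snd ℝ E E) :=
    (hp'.clm_comp continuous_const).add (hp.clm_comp continuous_const)
  exact (ContinuousLinearMap.prodₗᵢ ℝ (𝕜 := ℝ) (E := E × E) (F := E) (G := E)).continuous.comp
    (h1.prodMk h2)

theorem contDiff_tangentPotential {p p' : ℝ × ℝ → E →L[ℝ] E} {n : ℕ∞}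
    (hp : ContDiff ℝ n p) (hp' : ContDiff ℝ n p') :
    ContDiff ℝ n fun x : ℝ × ℝ =>
      tangentPotential (fun r => p (r, x.2)) (fun r => p' (r, x.2)) x.1 := by
  have h1 : ContDiff ℝ n fun x : ℝ × ℝ => (p x).comp (ContinuousLinearMap.fst ℝ E E) :=
    hp.clm_comp contDiff_const
  have h2 : ContDiff ℝ n fun x : ℝ × ℝ => (p' x).comp (ContinuousLinearMap.fst ℝ E E) +
      (p x).comp (ContinuousLinearMap.snd ℝ E E) :=
    (hp'.clm_comp contDiff_const).add (hp.clm_comp contDiff_const)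
  exact (ContinuousLinearMap.prodₗᵢ ℝ (𝕜 := ℝ) (E := E × E) (F := E)
    (G := E)).toContinuousLinearEquiv
    |>.contDiff.comp (h1.prodMk h2)

/-- The second component of the solution of the system of `tangentPotential`. -/
noncomputable def tangentSum (G p p' : ℝ → E →L[ℝ] E) (f g : E) (σ : ℝ) : E :=
  (duhamelSum (fun t => (G t).prodMap (G t)) (tangentPotential p p') (f, g) σ).2

variable [CompleteSpace E]

theorem continuous_tangentSum (hG : IsContractionGroup G) {P P' : ℝ × ℝ → E →L[ℝ] E}
    (hP : Continuous P) (hP' : Continuous P') (f : E) {g : ℝ → E} (hg : Continuous g) :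
    Continuous fun x : ℝ × ℝ =>
      tangentSum G (fun r => P (r, x.2)) (fun r => P' (r, x.2)) f (g x.2) x.1 :=
  continuous_snd.comp (continuous_duhamelSum hG.prodMap
    (P := fun x => tangentPotential (fun r => P (r, x.2)) (fun r => P' (r, x.2)) x.1)
    (continuous_tangentPotential (p := fun (x : ℝ × ℝ) r => P (r, x.2))
      (p' := fun (x : ℝ × ℝ) r => P' (r, x.2)) (s := Prod.fst) (by simpa using hP)
      (by simpa using hP')) (f := fun k => (f, g k)) (by fun_prop))

/-- The linearised Volterra equation: `z` solves the equation with potential `p` and source `p' y`.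
-/
theorem tangentSum_eq (hG : IsContractionGroup G) {p p' : ℝ → E →L[ℝ] E}
    (hp : Continuous p) (hp' : Continuous p') (f g : E) (σ : ℝ) :
    Continuous (tangentSum G p p' f g) ∧ tangentSum G p p' f g σ = G σ g +
      ∫ r in (0 : ℝ)..σ, G (σ - r)
        (p' r (duhamelSum G p f r) + p r (tangentSum G p p' f g r)) := by
  set S := duhamelSum (fun t => (G t).prodMap (G t)) (tangentPotential p p') (f, g) with hS
  have hT : Continuous (tangentPotential p p') :=
    continuous_tangentPotential (X := ℝ) (p := fun _ => p) (p' := fun _ => p') (s := id) hp hp'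
  have hSc : Continuous S := continuous_duhamelSum_slice hG.prodMap hT (f, g)
  have hSeq := duhamelSum_eq hG.prodMap hT (f, g)
  rw [← hS] at hSeq
  have hint : ∀ σ, IntervalIntegrable (fun r => ((G (σ - r)).prodMap (G (σ - r)))
      (tangentPotential p p' r (S r))) volume 0 σ := fun σ =>
    (volterra_integrand_continuous hG.prodMap hT hSc σ).intervalIntegrable _ _
  have h1 : (fun σ => (S σ).1) = duhamelSum G p f := by
    refine eq_of_volterra hG hp (g := fun σ => G σ f) (by fun_prop)
      (continuous_duhamelSum_slice hG hp f) (fun σ => ?_) (duhamelSum_eq hG hp f)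
    have e := ContinuousLinearMap.intervalIntegral_comp_comm (ContinuousLinearMap.fst ℝ E E)
      (hint σ)
    rw [hSeq σ]
    exact congrArg (G σ f + ·) e.symm
  refine ⟨continuous_snd.comp hSc, ?_⟩
  have e := ContinuousLinearMap.intervalIntegral_comp_comm (ContinuousLinearMap.snd ℝ E E)
    (hint σ)
  have e2 : tangentSum G p p' f g σ = G σ g +
      ∫ r in (0 : ℝ)..σ, G (σ - r) (p' r (S r).1 + p r (S r).2) := by
    change (S σ).2 = _
    rw [hSeq σ]
    exact congrArg (G σ g + ·) e.symm
  rw [e2, ← h1]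
  rfl

theorem eventually_forall_norm_sub_le {F : Type*} [SeminormedAddCommGroup F] {u : ℝ × ℝ → F}
    (hu : Continuous u) {K : Set (ℝ × ℝ)} (hK : IsCompact K) {ε : ℝ} (hε : 0 < ε) :
    ∀ᶠ θ in 𝓝 (0 : ℝ × ℝ), ∀ x ∈ K, ‖u (x + θ) - u x‖ ≤ ε := by
  refine hK.eventually_forall_of_forall_eventually fun x _ => ?_
  have : Continuous fun z : (ℝ × ℝ) × (ℝ × ℝ) => ‖u (z.2 + z.1) - u z.2‖ := by fun_prop
  have h := (this.tendsto (0, x)).eventually_lt_const (u := ε) (by simpa using hε)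
  exact h.mono fun z hz => le_of_lt hz

/-- A function of class `C¹` is differentiable uniformly on compact sets. -/
theorem eventually_forall_norm_sub_fderiv_le {F : Type*} [NormedAddCommGroup F] [NormedSpace ℝ F]
    {u : ℝ × ℝ → F} (hu : ContDiff ℝ 1 u) {K : Set (ℝ × ℝ)} (hK : IsCompact K) {ε : ℝ}
    (hε : 0 < ε) :
    ∀ᶠ θ in 𝓝 (0 : ℝ × ℝ), ∀ x ∈ K, ‖u (x + θ) - u x - fderiv ℝ u x θ‖ ≤ ε * ‖θ‖ := by
  obtain ⟨δ, hδ, h⟩ := Metric.eventually_nhds_iff_ball.1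
    (eventually_forall_norm_sub_le (hu.continuous_fderiv one_ne_zero) hK hε)
  filter_upwards [ball_mem_nhds 0 hδ] with θ hθ x hx
  have := Convex.norm_image_sub_le_of_norm_hasFDerivWithin_le' (𝕜 := ℝ) (f := u)
    (f' := fderiv ℝ u) (φ := fderiv ℝ u x) (s := ball x δ) (C := ε) (x := x) (y := x + θ)
    (fun z _ => (hu.differentiable one_ne_zero z).hasFDerivAt.hasFDerivWithinAt)
    (fun z hz => by
      have := h (z - x) (by simpa [mem_ball, dist_eq_norm] using hz) x hx
      simpa using this) (convex_ball _ _) (mem_ball_self hδ)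
    (by simpa [mem_ball_iff_norm] using hθ)
  simpa using this

theorem duhamelSum_zero (hG : IsContractionGroup G) {p : ℝ → E →L[ℝ] E}
    (hp : Continuous p) (f : E) : duhamelSum G p f 0 = f := by
  rw [duhamelSum_eq hG hp]
  simp [volterra, hG.zero]

/-- Expansion of a solution at time zero, jointly in time and the parameter. -/
theorem eventually_duhamelSum_initial (hG : IsContractionGroup G) {P : ℝ × ℝ → E →L[ℝ] E}
    (hP : Continuous P) {f f' : E} (hf : HasDerivAt (fun t => G t f) f' 0) (k : ℝ) {ε : ℝ}
    (hε : 0 < ε) :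
    ∀ᶠ θ in 𝓝 (0 : ℝ × ℝ), ‖duhamelSum G (fun r => P (r, k + θ.2)) f θ.1 - f
      - θ.1 • (f' + P (0, k) f)‖ ≤ ε * ‖θ‖ := by
  have hε2 := half_pos hε
  have hy := continuous_duhamelSum hG hP (f := fun _ => f) continuous_const
  -- the integrand of the Duhamel formula, jointly continuous in all variables
  have hΦ : Continuous fun z : (ℝ × ℝ) × ℝ => G (z.1.1 - z.2) (P (z.2, k + z.1.2)
      (duhamelSum G (fun r => P (r, k + z.1.2)) f z.2)) := by
    have h1 : Continuous fun z : (ℝ × ℝ) × ℝ => (z.2, k + z.1.2) := by fun_prop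
    exact hG.continuous_comp (by fun_prop) ((hP.comp h1).clm_apply (hy.comp h1))
  have hΦ0 : ∀ᶠ z in 𝓝 ((0, 0) : (ℝ × ℝ) × ℝ), ‖G (z.1.1 - z.2) (P (z.2, k + z.1.2)
      (duhamelSum G (fun r => P (r, k + z.1.2)) f z.2)) - P (0, k) f‖ < ε / 2 := by
    have h := (hΦ.sub (continuous_const (y := P (0, k) f))).norm.tendsto (0, 0)
    refine h.eventually_lt_const ?_
    have hk : Continuous fun r => P (r, k) := hP.comp (by fun_prop)
    simpa [hG.zero, duhamelSum_zero hG hk] using hε2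
  obtain ⟨δ, hδ, hΦ1⟩ := Metric.eventually_nhds_iff_ball.1 hΦ0
  have hf0 := (hasDerivAt_iff_isLittleO_nhds_zero.1 hf).bound hε2
  have hf1 : ∀ᶠ θ in 𝓝 (0 : ℝ × ℝ), ‖G θ.1 f - f - θ.1 • f'‖ ≤ ε / 2 * ‖θ.1‖ := by
    have : Tendsto (fun θ : ℝ × ℝ => θ.1) (𝓝 0) (𝓝 0) := continuous_fst.tendsto' _ _ rfl
    filter_upwards [this.eventually hf0] with θ hθ
    simpa [hG.zero] using hθ
  filter_upwards [hf1, ball_mem_nhds 0 hδ] with θ h1 h2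
  rw [mem_ball_zero_iff] at h2
  have hk : Continuous fun r => P (r, k + θ.2) := hP.comp (by fun_prop)
  have hint := volterra_integrand_continuous hG hk (continuous_duhamelSum_slice hG hk f) θ.1
  have e : duhamelSum G (fun r => P (r, k + θ.2)) f θ.1 - f - θ.1 • (f' + P (0, k) f) =
      (G θ.1 f - f - θ.1 • f') + ∫ s in (0 : ℝ)..θ.1, (G (θ.1 - s) (P (s, k + θ.2)
      (duhamelSum G (fun r => P (r, k + θ.2)) f s)) - P (0, k) f) := by
    rw [intervalIntegral.integral_sub (hint.intervalIntegrable _ _)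
      (continuous_const.intervalIntegrable _ _), intervalIntegral.integral_const, sub_zero,
      duhamelSum_eq hG hk, smul_add, volterra]
    abel
  have h3 : ‖∫ s in (0 : ℝ)..θ.1, (G (θ.1 - s) (P (s, k + θ.2)
      (duhamelSum G (fun r => P (r, k + θ.2)) f s)) - P (0, k) f)‖ ≤ ε / 2 * |θ.1 - 0| := by
    refine intervalIntegral.norm_integral_le_of_norm_le_const fun s hs => ?_
    have hs' : |s| ≤ |θ.1| := by simpa using abs_sub_left_of_mem_uIcc (uIoc_subset_uIcc hs)
    refine (hΦ1 (θ, s) ?_).le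
    rw [mem_ball, dist_eq_norm]
    have : |s| < δ := hs'.trans_lt ((norm_fst_le θ).trans_lt h2)
    simpa [Prod.norm_def] using ⟨by simpa [Prod.norm_def] using h2, this⟩
  rw [e]
  rw [sub_zero] at h3
  have h4 : |θ.1| ≤ ‖θ‖ := norm_fst_le θ
  rw [Real.norm_eq_abs] at h1
  calc _ ≤ ε / 2 * |θ.1| + ε / 2 * |θ.1| := (norm_add_le _ _).trans (add_le_add h1 h3)
    _ = ε * |θ.1| := by ring
    _ ≤ _ := by gcongr

/-- The solution of the Volterra equation with initial value `f` in the domain of the generator is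
differentiable in time and in a parameter on which the potential depends differentiably.  The
derivatives solve the differentiated equations: a shift of time amounts to a shift of the potential
and of the initial value, so time is treated as one more parameter. -/
theorem hasFDerivAt_duhamelSum (hG : IsContractionGroup G) {P : ℝ × ℝ → E →L[ℝ] E}
    (hP : ContDiff ℝ 1 P) {f f' : E} (hf : HasDerivAt (fun t => G t f) f' 0) (x : ℝ × ℝ) :
    HasFDerivAt (fun x : ℝ × ℝ => duhamelSum G (fun r => P (r, x.2)) f x.1)
      ((ContinuousLinearMap.fst ℝ ℝ ℝ).smulRight
        (tangentSum G (fun r => P (r, x.2)) (fun r => fderiv ℝ P (r, x.2) (1, 0)) f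
          (f' + P (0, x.2) f) x.1) +
      (ContinuousLinearMap.snd ℝ ℝ ℝ).smulRight
        (tangentSum G (fun r => P (r, x.2)) (fun r => fderiv ℝ P (r, x.2) (0, 1)) f 0 x.1)) x := by
  obtain ⟨σ, k⟩ := x
  have hPc := hP.continuous
  have hP'c := hP.continuous_fderiv one_ne_zero
  have hpk : Continuous fun r => P (r, k) := hPc.comp (by fun_prop)
  have hd1 : Continuous fun r => fderiv ℝ P (r, k) (1, 0) :=
    (hP'c.comp (by fun_prop : Continuous fun r : ℝ => (r, k))).clm_apply continuous_const
  have hd2 : Continuous fun r => fderiv ℝ P (r, k) (0, 1) :=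
    (hP'c.comp (by fun_prop : Continuous fun r : ℝ => (r, k))).clm_apply continuous_const
  have hy := continuous_duhamelSum hG hPc (f := fun _ => f) continuous_const
  set y : ℝ × ℝ → E := fun x => duhamelSum G (fun r => P (r, x.2)) f x.1 with hydef
  set Y := tangentSum G (fun r => P (r, k)) (fun r => fderiv ℝ P (r, k) (1, 0)) f
          (f' + P (0, k) f) with hYdef
  set Z := tangentSum G (fun r => P (r, k)) (fun r => fderiv ℝ P (r, k) (0, 1)) f 0 with hZdef
  have hY := tangentSum_eq hG hpk hd1 f (f' + P (0, k) f)
  have hZ := tangentSum_eq hG hpk hd2 f 0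
  change ∀ σ, Continuous Y ∧ Y σ = G σ (f' + P (0, k) f) + ∫ r in (0 : ℝ)..σ, G (σ - r)
    (fderiv ℝ P (r, k) (1, 0) (y (r, k)) + P (r, k) (Y r)) at hY
  change ∀ σ, Continuous Z ∧ Z σ = G σ 0 + ∫ r in (0 : ℝ)..σ, G (σ - r)
    (fderiv ℝ P (r, k) (0, 1) (y (r, k)) + P (r, k) (Z r)) at hZ
  have hYc := (hY 0).1
  have hZc := (hZ 0).1
  set T := |σ| with hT
  have hT0 : 0 ≤ T := abs_nonneg σ
  have hK : IsCompact ((fun r : ℝ => (r, k)) '' Icc (-T) T) :=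
    isCompact_Icc.image (by fun_prop)
  obtain ⟨M, hM0, hM⟩ := exists_bound_of_continuous hpk T
  obtain ⟨D, hD0, hD⟩ := exists_bound_of_continuous
    (hP'c.comp (by fun_prop : Continuous fun r : ℝ => (r, k))) T
  obtain ⟨C, hC0, hC⟩ := exists_bound_of_continuous
    (hy.comp (by fun_prop : Continuous fun r : ℝ => (r, k))) T
  -- the source of the equation for the error is at most `ε L ‖θ‖`
  set L := 1 + T * (C + 1 + D) with hL
  have hLpos : 0 < L := by positivity
  rw [hasFDerivAt_iff_isLittleO_nhds_zero, Asymptotics.isLittleO_iff]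
  intro c hc
  set ε := min 1 (c / (L * Real.exp (M * T))) with hε
  have hε0 : 0 < ε := by positivity
  filter_upwards [eventually_duhamelSum_initial hG hPc hf k hε0,
    eventually_forall_norm_sub_fderiv_le hP hK hε0,
    eventually_forall_norm_sub_le hy hK hε0] with θ h1 h2 h3
  have h2' : ∀ r, |r| ≤ T → ‖P (r + θ.1, k + θ.2) - P (r, k) - fderiv ℝ P (r, k) θ‖ ≤ ε * ‖θ‖ :=
    fun r hr => h2 (r, k) ⟨r, abs_le.1 hr, rfl⟩
  have h3' : ∀ r, |r| ≤ T → ‖y (r + θ.1, k + θ.2) - y (r, k)‖ ≤ ε :=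
    fun r hr => h3 (r, k) ⟨r, abs_le.1 hr, rfl⟩
  set u : ℝ → E := fun r => y (r + θ.1, k + θ.2) with hu
  have huc : Continuous u := hy.comp (by fun_prop)
  have hy0c : Continuous fun r => y (r, k) := hy.comp (by fun_prop)
  set e : ℝ → E := fun r => u r - y (r, k) - (θ.1 • Y r + θ.2 • Z r) with he
  have hec : Continuous e := by fun_prop
  have hpθ : Continuous fun r => P (r, k + θ.2) := hPc.comp (by fun_prop)
  have hpθ' : Continuous fun r => P (r + θ.1, k + θ.2) := hPc.comp (by fun_prop)
  have hdθ : ∀ r, fderiv ℝ P (r, k) θ =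
      θ.1 • fderiv ℝ P (r, k) (1, 0) + θ.2 • fderiv ℝ P (r, k) (0, 1) := by
    intro r
    rw [← map_smul, ← map_smul, ← map_add]
    congr 1
    ext <;> simp
  -- the error `e` of the linear approximation satisfies the Volterra equation with a small source;
  -- the first term below is the error of the shifted initial value
  have hsrc : ∀ r, e r - volterra G (fun r => P (r, k)) e r =
      G r (y (θ.1, k + θ.2) - f - θ.1 • (f' + P (0, k) f)) +
      ∫ s in (0 : ℝ)..r, G (r - s) ((P (s + θ.1, k + θ.2) - P (s, k)) (u s) -
        fderiv ℝ P (s, k) θ (y (s, k))) := by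
    intro r
    have hsh := sub_volterra_shift hG hpθ f θ.1 r
    have hy0 := duhamelSum_eq hG hpk f r
    have i1 := (volterra_integrand_continuous hG hpθ' huc r).intervalIntegrable (μ := volume) 0 r
    have i2 := (volterra_integrand_continuous hG hpk hy0c r).intervalIntegrable (μ := volume) 0 r
    have i3 : IntervalIntegrable (fun s => G (r - s)
        (fderiv ℝ P (s, k) (1, 0) (y (s, k)) + P (s, k) (Y s))) volume 0 r :=
      (hG.continuous_comp (by fun_prop)
        ((hd1.clm_apply hy0c).add (hpk.clm_apply hYc))).intervalIntegrable _ _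
    have i4 : IntervalIntegrable (fun s => G (r - s)
        (fderiv ℝ P (s, k) (0, 1) (y (s, k)) + P (s, k) (Z s))) volume 0 r :=
      (hG.continuous_comp (by fun_prop)
        ((hd2.clm_apply hy0c).add (hpk.clm_apply hZc))).intervalIntegrable _ _
    have j3 : IntervalIntegrable (fun s => θ.1 • G (r - s)
        (fderiv ℝ P (s, k) (1, 0) (y (s, k)) + P (s, k) (Y s))) volume 0 r := i3.smul _
    have j4 : IntervalIntegrable (fun s => θ.2 • G (r - s)
        (fderiv ℝ P (s, k) (0, 1) (y (s, k)) + P (s, k) (Z s))) volume 0 r := i4.smul _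
    have i5 := (volterra_integrand_continuous hG hpk hec r).intervalIntegrable (μ := volume) 0 r
    have eint : (∫ s in (0 : ℝ)..r, G (r - s) ((P (s + θ.1, k + θ.2) - P (s, k)) (u s) -
        fderiv ℝ P (s, k) θ (y (s, k)))) =
        volterra G (fun s => P (s + θ.1, k + θ.2)) u r -
        volterra G (fun s => P (s, k)) (fun s => y (s, k)) r -
        (θ.1 • ∫ s in (0 : ℝ)..r, G (r - s)
        (fderiv ℝ P (s, k) (1, 0) (y (s, k)) + P (s, k) (Y s))) -
        (θ.2 • ∫ s in (0 : ℝ)..r, G (r - s)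
        (fderiv ℝ P (s, k) (0, 1) (y (s, k)) + P (s, k) (Z s))) -
        volterra G (fun r => P (r, k)) e r := by
      unfold volterra
      rw [← intervalIntegral.integral_smul, ← intervalIntegral.integral_smul,
        ← intervalIntegral.integral_sub i1 i2,
        ← intervalIntegral.integral_sub (i1.sub i2) j3,
        ← intervalIntegral.integral_sub ((i1.sub i2).sub j3) j4,
        ← intervalIntegral.integral_sub (((i1.sub i2).sub j3).sub j4) i5]
      congr 1
      ext s
      rw [hdθ]
      simp only [he, map_sub, map_add, map_smul, sub_apply,
        add_apply, smul_apply, smul_add]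
      abel
    have hu' : u r = G r (y (θ.1, k + θ.2)) +
        volterra G (fun s => P (s + θ.1, k + θ.2)) u r := eq_add_of_sub_eq hsh
    have hy0' : y (r, k) = G r f + volterra G (fun s => P (s, k)) (fun s => y (s, k)) r := hy0
    rw [eint]
    simp only [he]
    rw [hu', hy0', (hY r).2, (hZ r).2]
    simp only [map_sub, map_smul, map_add, smul_add, map_zero, zero_add]
    abel
  have hbound : ∀ r, |r| ≤ T → ‖e r - volterra G (fun r => P (r, k)) e r‖ ≤ ε * L * ‖θ‖ := by
    intro r hr
    rw [hsrc r]
    have hi : ‖∫ s in (0 : ℝ)..r, G (r - s) ((P (s + θ.1, k + θ.2) - P (s, k)) (u s) -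
        fderiv ℝ P (s, k) θ (y (s, k)))‖ ≤ (ε * ‖θ‖ * (C + 1 + D)) * |r - 0| := by
      refine intervalIntegral.norm_integral_le_of_norm_le_const fun s hs => ?_
      have hs' : |s| ≤ T :=
        (by simpa using abs_sub_left_of_mem_uIcc (uIoc_subset_uIcc hs) : |s| ≤ |r|).trans hr
      refine (hG.norm_le _ _).trans ?_
      have e3 : (P (s + θ.1, k + θ.2) - P (s, k)) (u s) - fderiv ℝ P (s, k) θ (y (s, k)) =
          (P (s + θ.1, k + θ.2) - P (s, k) - fderiv ℝ P (s, k) θ) (u s) +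
          fderiv ℝ P (s, k) θ (u s - y (s, k)) := by
        simp only [sub_apply, map_sub]
        abel
      have hus : ‖u s‖ ≤ C + 1 := by
        have := norm_le_norm_add_norm_sub' (u s) (y (s, k))
        have h5 := hC s hs'
        have h6 := h3' s hs'
        have h7 : ε ≤ 1 := min_le_left _ _
        simp only [Function.comp_apply] at h5
        linarith
      rw [e3]
      refine (norm_add_le _ _).trans ?_
      have a1 := (ContinuousLinearMap.le_opNorm
        (P (s + θ.1, k + θ.2) - P (s, k) - fderiv ℝ P (s, k) θ) (u s)).trans
        (mul_le_mul (h2' s hs') hus (norm_nonneg _) (by positivity))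
      have a2 := (ContinuousLinearMap.le_opNorm (fderiv ℝ P (s, k) θ) (u s - y (s, k))).trans
        (mul_le_mul (((fderiv ℝ P (s, k)).le_opNorm θ).trans
          (mul_le_mul_of_nonneg_right (hD s hs') (norm_nonneg _))) (h3' s hs') (norm_nonneg _)
          (by positivity))
      nlinarith
    rw [sub_zero] at hi
    refine (norm_add_le _ _).trans ((add_le_add ((hG.norm_le _ _).trans h1) hi).trans ?_)
    have : ε * ‖θ‖ * (C + 1 + D) * |r| ≤ ε * ‖θ‖ * (C + 1 + D) * T := by gcongr
    rw [hL]
    nlinarith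
  have hfin := norm_le_of_volterra hG hpk hec hM hbound σ le_rfl
  have hexp := Real.exp_pos (M * T)
  have hεc : ε * L * Real.exp (M * T) ≤ c := by
    have : ε ≤ c / (L * Real.exp (M * T)) := min_le_right _ _
    rw [le_div_iff₀ (by positivity)] at this
    linarith
  calc _ = ‖e σ‖ := by simp [he, hu]; rfl
    _ ≤ ε * L * ‖θ‖ * Real.exp (M * T) := hfin
    _ = ε * L * Real.exp (M * T) * ‖θ‖ := by ring
    _ ≤ c * ‖θ‖ := by gcongr

theorem contDiff_one_duhamelSum (hG : IsContractionGroup G) {P : ℝ × ℝ → E →L[ℝ] E}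
    (hP : ContDiff ℝ 1 P) {f f' : E} (hf : HasDerivAt (fun t => G t f) f' 0) :
    ContDiff ℝ 1 (fun x : ℝ × ℝ => duhamelSum G (fun r => P (r, x.2)) f x.1) := by
  refine contDiff_one_iff_hasFDerivAt.2 ⟨_, ?_, hasFDerivAt_duhamelSum hG hP hf⟩
  have hP'c := hP.continuous_fderiv one_ne_zero
  have h1 := continuous_tangentSum hG hP.continuous
    (hP'c.clm_apply (continuous_const (y := ((1, 0) : ℝ × ℝ)))) f
    (g := fun k => f' + P (0, k) f)
    (continuous_const.add ((hP.continuous.comp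
      (by fun_prop : Continuous fun k : ℝ => ((0 : ℝ), k))).clm_apply continuous_const))
  have h2 := continuous_tangentSum hG hP.continuous
    (hP'c.clm_apply (continuous_const (y := ((0, 1) : ℝ × ℝ)))) f
    (g := fun _ => 0) continuous_const
  exact ((ContinuousLinearMap.smulRightL ℝ (ℝ × ℝ) E _).continuous.comp h1).add
    ((ContinuousLinearMap.smulRightL ℝ (ℝ × ℝ) E _).continuous.comp h2)

/-- Solutions are of class `C²` in time and the parameter, if the initial value and the initial
time derivative are in the domain of the generator: the first derivatives are solutions of tangent
systems, whose initial values are again in the domain.  The potential at time zero must not depend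
on the parameter, so that the initial time derivative does not either. -/
theorem contDiff_two_duhamelSum (hG : IsContractionGroup G) {P : ℝ × ℝ → E →L[ℝ] E}
    (hP : ContDiff ℝ 2 P) {f f' f'' : E} {p₀ : E →L[ℝ] E} (hp₀ : ∀ k, P (0, k) = p₀)
    (hf : HasDerivAt (fun t => G t f) f' 0)
    (hf' : HasDerivAt (fun t => G t (f' + p₀ f)) f'' 0) :
    ContDiff ℝ 2 (fun x : ℝ × ℝ => duhamelSum G (fun r => P (r, x.2)) f x.1) := by
  have hP1 : ContDiff ℝ 1 P := hP.of_le one_le_two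
  have hP' : ContDiff ℝ 1 (fderiv ℝ P) := hP.fderiv_right (by norm_num)
  have h := contDiff_succ_iff_hasFDerivAt (𝕜 := ℝ) (n := 1)
    (f := fun x : ℝ × ℝ => duhamelSum G (fun r => P (r, x.2)) f x.1)
  have e2 : ((1 : ℕ) : WithTop ℕ∞) + 1 = 2 := by norm_num
  rw [e2] at h
  refine h.2 ⟨_, ?_, hasFDerivAt_duhamelSum hG hP1 hf⟩
  have hsys : ∀ {v : ℝ × ℝ} {g g' : E}, HasDerivAt (fun t => G t g) g' 0 →
      ContDiff ℝ 1 fun x : ℝ × ℝ =>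
        tangentSum G (fun r => P (r, x.2)) (fun r => fderiv ℝ P (r, x.2) v) f g x.1 := by
    intro v g g' hg
    have hd : HasDerivAt (fun t => ((G t).prodMap (G t)) (f, g)) (f', g') 0 := hf.prodMk hg
    have := contDiff_one_duhamelSum hG.prodMap (P := fun x : ℝ × ℝ =>
      tangentPotential (fun r => P (r, x.2)) (fun r => fderiv ℝ P (r, x.2) v) x.1)
      (contDiff_tangentPotential (n := 1) hP1 (p' := fun x => fderiv ℝ P x v)
        (hP'.clm_apply contDiff_const)) hd
    exact contDiff_snd.comp this
  have h1 := hsys (v := (1, 0)) hf'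
  have h2 := hsys (v := (0, 1)) (g := 0) (g' := 0) (by simpa using hasDerivAt_const (0 : ℝ) (0 : E))
  simp only [hp₀]
  exact ((ContinuousLinearMap.smulRightL ℝ (ℝ × ℝ) E _).contDiff.comp h1).add
    ((ContinuousLinearMap.smulRightL ℝ (ℝ × ℝ) E _).contDiff.comp h2)

end Differentiability

/-! ### Self-adjoint operators with pure point spectrum and their unitary groups -/

section Spectral

variable {H : Type*} [NormedAddCommGroup H] [InnerProductSpace ℂ H]

/-- The spectral resolution of a self-adjoint operator with pure point spectrum: `K l` is the
eigenspace of `l`, and these are mutually orthogonal closed subspaces with dense span. -/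
structure IsSpectralFamily (K : ℝ → Submodule ℂ H) : Prop where
  isClosed : ∀ l, IsClosed (K l : Set H)
  orthogonal : OrthogonalFamily ℂ (fun l => K l) fun l => (K l).subtypeₗᵢ
  total : ⊤ ≤ (⨆ l, K l).topologicalClosure

namespace IsSpectralFamily

theorem norm_exp (t l : ℝ) : ‖Complex.exp (-Complex.I * t * l)‖ = 1 := by
  rw [show -Complex.I * t * l = ((-(t * l) : ℝ) : ℂ) * Complex.I by push_cast; ring]
  exact Complex.norm_exp_ofReal_mul_I _

variable {K : ℝ → Submodule ℂ H}

theorem hasSum_norm_sq (hK : IsSpectralFamily K) {v : ℝ → H} (hv : ∀ l, v l ∈ K l) {x : H}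
    (hx : HasSum v x) : HasSum (fun l => ‖v l‖ ^ 2) (‖x‖ ^ 2) := by
  have h : Tendsto (fun s : Finset ℝ => ‖∑ l ∈ s, v l‖ ^ 2) atTop (𝓝 (‖x‖ ^ 2)) :=
    (Filter.Tendsto.norm hx).pow 2
  refine h.congr fun s => ?_
  exact hK.orthogonal.norm_sum (fun l => ⟨v l, hv l⟩) s

variable [∀ l, (K l).HasOrthogonalProjection]

theorem starProjection_of_hasSum (hK : IsSpectralFamily K) {v : ℝ → H} (hv : ∀ l, v l ∈ K l) {x : H}
    (hx : HasSum v x) (l : ℝ) : (K l).starProjection x = v l := by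
  have h := (K l).starProjection.hasSum hx
  refine h.unique ?_
  have h2 := hasSum_single (f := fun j => (K l).starProjection (v j)) l fun j hj => by
    rw [Submodule.starProjection_apply_eq_zero_iff, Submodule.mem_orthogonal]
    intro u hu
    exact hK.orthogonal hj.symm ⟨u, hu⟩ ⟨v j, hv j⟩
  simpa [Submodule.starProjection_eq_self_iff.2 (hv l)] using h2

section RealScalars

variable [NormedSpace ℝ H] [IsScalarTower ℝ ℂ H]

theorem ofReal_smul (c : ℝ) (x : H) : (c : ℂ) • x = c • x := algebraMap_smul ℂ c x

theorem hasDerivAt_exp_smul (l t : ℝ) (x : H) :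
    HasDerivAt (fun s : ℝ => Complex.exp (-Complex.I * s * l) • x)
      (Complex.exp (-Complex.I * t * l) • (-Complex.I * l) • x) t := by
  have h1 : HasDerivAt (fun s : ℝ => (s : ℂ)) 1 t := Complex.ofRealCLM.hasDerivAt
  have h2 : HasDerivAt (fun s : ℝ => -Complex.I * (s : ℂ) * (l : ℂ)) (-Complex.I * l) t := by
    simpa using (h1.const_mul (-Complex.I)).mul_const (l : ℂ)
  have h3 := h2.cexp.smul_const x
  rwa [mul_smul] at h3

end RealScalars

variable [CompleteSpace H]

theorem hasSum_starProjection (hK : IsSpectralFamily K) (x : H) :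
    HasSum (fun l => (K l).starProjection x) x := by
  have : ∀ l, CompleteSpace (K l) := fun l => (hK.isClosed l).completeSpace_coe
  have hS := IsHilbertSum.mkInternal K hK.orthogonal hK.total
  have h := hS.hasSum_linearIsometryEquiv_symm (hS.linearIsometryEquiv x)
  rw [LinearIsometryEquiv.symm_apply_apply] at h
  have e : (fun l => (K l).starProjection x) =
      fun l => (K l).subtypeₗᵢ (hS.linearIsometryEquiv x l) := by
    ext l
    exact hK.starProjection_of_hasSum (fun l => (hS.linearIsometryEquiv x l).2) h l
  rwa [e]

theorem ext (hK : IsSpectralFamily K) {x y : H}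
    (h : ∀ l, (K l).starProjection x = (K l).starProjection y) : x = y := by
  have hx := hK.hasSum_starProjection x
  simp only [h] at hx
  exact hx.unique (hK.hasSum_starProjection y)

/-- The spectral series of `∑ c_l P_l x` converges for unimodular coefficients `c_l`. -/
theorem hasSum_smul_starProjection (hK : IsSpectralFamily K) {c : ℝ → ℂ} (hc : ∀ l, ‖c l‖ = 1)
    (x : H) : HasSum (fun l => c l • (K l).starProjection x)
      (∑' l, c l • (K l).starProjection x) := by
  have hm : ∀ l, c l • (K l).starProjection x ∈ K l := fun l =>
    (K l).smul_mem _ (Submodule.starProjection_apply_mem _ _)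
  have h : Summable fun l => (K l).subtypeₗᵢ ⟨_, hm l⟩ := by
    rw [hK.orthogonal.summable_iff_norm_sq_summable]
    have := (hK.hasSum_norm_sq (fun l => Submodule.starProjection_apply_mem _ _)
      (hK.hasSum_starProjection x)).summable
    refine this.congr fun l => ?_
    simp [norm_smul, hc]
  exact h.hasSum

variable [NormedSpace ℝ H] [IsScalarTower ℝ ℂ H]

/-- The unitary group `exp(-i t B)` of the self-adjoint operator with the given spectral
resolution. -/
noncomputable def unitaryGroup (hK : IsSpectralFamily K) (t : ℝ) : H →L[ℝ] H :=
  LinearMap.mkContinuous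
    { toFun := fun x => ∑' l : ℝ, Complex.exp (-Complex.I * t * l) • (K l).starProjection x
      map_add' := fun x y => by
        have hx := hK.hasSum_smul_starProjection (norm_exp t) x
        have hy := hK.hasSum_smul_starProjection (norm_exp t) y
        have h := hx.add hy
        simp only [← smul_add, ← map_add] at h
        exact h.tsum_eq
      map_smul' := fun c x => by
        have hx := hK.hasSum_smul_starProjection (norm_exp t) x
        have h := hx.const_smul c
        have e : ∀ l : ℝ, c • Complex.exp (-Complex.I * t * l) • (K l).starProjection x =
            Complex.exp (-Complex.I * t * l) • (K l).starProjection (c • x) := fun l => by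
          rw [← ofReal_smul, ← ofReal_smul, map_smul, smul_comm]
        simp only [e] at h
        exact h.tsum_eq }
    1 fun x => by
      have hx := hK.hasSum_smul_starProjection (norm_exp t) x
      have h1 := hK.hasSum_norm_sq (fun l => (K l).smul_mem _
        (Submodule.starProjection_apply_mem _ _)) hx
      have h2 := hK.hasSum_norm_sq (fun l => Submodule.starProjection_apply_mem _ _)
        (hK.hasSum_starProjection x)
      simp only [norm_smul, norm_exp, one_mul] at h1
      have := h1.unique h2
      rw [one_mul]
      exact le_of_sq_le_sq this.le (norm_nonneg _)

theorem unitaryGroup_apply (hK : IsSpectralFamily K) (t : ℝ) (x : H) :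
    hK.unitaryGroup t x =
      ∑' l : ℝ, Complex.exp (-Complex.I * t * l) • (K l).starProjection x := rfl

theorem starProjection_unitaryGroup (hK : IsSpectralFamily K) (t l : ℝ) (x : H) :
    (K l).starProjection (hK.unitaryGroup t x) =
      Complex.exp (-Complex.I * t * l) • (K l).starProjection x :=
  hK.starProjection_of_hasSum (v := fun l : ℝ => Complex.exp (-Complex.I * t * l) •
    (K l).starProjection x) (fun l => (K l).smul_mem _ (Submodule.starProjection_apply_mem _ _))
    (hK.hasSum_smul_starProjection (norm_exp t) x) l

theorem unitaryGroup_smul (hK : IsSpectralFamily K) (t : ℝ) (c : ℂ) (x : H) :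
    hK.unitaryGroup t (c • x) = c • hK.unitaryGroup t x :=
  hK.ext fun l => by
    rw [starProjection_unitaryGroup, map_smul, map_smul, starProjection_unitaryGroup, smul_comm]

theorem isContractionGroup (hK : IsSpectralFamily K) : IsContractionGroup hK.unitaryGroup where
  zero := by
    ext x
    refine hK.ext fun l => ?_
    simp [starProjection_unitaryGroup]
  add s t := by
    ext x
    refine hK.ext fun l => ?_
    rw [mul_apply_eq_comp, starProjection_unitaryGroup, starProjection_unitaryGroup,
      starProjection_unitaryGroup, smul_smul, ← Complex.exp_add]
    congr 2
    push_cast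
    ring
  norm_le t x := by
    simpa using (hK.unitaryGroup t).le_of_opNorm_le
      (LinearMap.mkContinuous_norm_le _ zero_le_one _) x
  continuous_apply := by
    -- the vectors with continuous orbit form a closed subspace containing all the eigenspaces
    have hle : ∀ t x, ‖hK.unitaryGroup t x‖ ≤ ‖x‖ := fun t x => by
      simpa using
        (hK.unitaryGroup t).le_of_opNorm_le
          (LinearMap.mkContinuous_norm_le _ zero_le_one _) x
    let S : Submodule ℂ H :=
      { carrier := {x | Continuous fun t => hK.unitaryGroup t x}
        add_mem' := fun {x y} hx hy => by
          simp only [mem_ofPred_eq, map_add] at *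
          exact hx.add hy
        zero_mem' := by simp only [mem_ofPred_eq, map_zero]; exact continuous_const
        smul_mem' := fun c x hx => by
          simp only [mem_ofPred_eq, unitaryGroup_smul] at *
          exact hx.const_smul c }
    have hSc : IsClosed (S : Set H) := by
      refine isClosed_of_closure_subset fun x hx => ?_
      rw [mem_closure_iff_seq_limit] at hx
      obtain ⟨u, hu, hux⟩ := hx
      have : TendstoUniformly (fun n t => hK.unitaryGroup t (u n))
          (fun t => hK.unitaryGroup t x) atTop := by
        rw [Metric.tendstoUniformly_iff]
        intro ε hε
        filter_upwards [(Metric.tendsto_nhds.1 hux) ε hε] with n hn t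
        rw [dist_eq_norm, ← map_sub]
        refine (hle _ _).trans_lt ?_
        rwa [← dist_eq_norm, dist_comm]
      exact this.continuous (Frequently.of_forall hu)
    have hKS : ∀ l, K l ≤ S := by
      intro l x hx
      have e : ∀ t, hK.unitaryGroup t x = Complex.exp (-Complex.I * t * l) • x := by
        intro t
        refine hK.ext fun j => ?_
        rw [starProjection_unitaryGroup, map_smul]
        rcases eq_or_ne j l with rfl | hj
        · rfl
        · have : (K j).starProjection x = 0 := by
            rw [Submodule.starProjection_apply_eq_zero_iff, Submodule.mem_orthogonal]
            exact fun u hu => hK.orthogonal hj ⟨u, hu⟩ ⟨x, hx⟩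
          rw [this, smul_zero, smul_zero]
      change Continuous fun t => hK.unitaryGroup t x
      simp only [e]
      fun_prop
    intro x
    exact ((hK.total.trans (Submodule.topologicalClosure_minimal _ (iSup_le hKS) hSc)) :
      ⊤ ≤ S) (Submodule.mem_top (x := x))

/-- The generator of the group is `-i B`. -/
theorem hasDerivAt_unitaryGroup (hK : IsSpectralFamily K) {f g : H}
    (h : ∀ l, (K l).starProjection g = (l : ℂ) • (K l).starProjection f) :
    HasDerivAt (fun t => hK.unitaryGroup t f) (-Complex.I • g) 0 := by
  have hc := hK.isContractionGroup.continuous_apply (-Complex.I • g)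
  have key : ∀ t, hK.unitaryGroup t f =
      f + ∫ s in (0 : ℝ)..t, hK.unitaryGroup s (-Complex.I • g) := by
    intro t
    refine hK.ext fun l => ?_
    rw [map_add, ← ContinuousLinearMap.intervalIntegral_comp_comm _ (hc.intervalIntegrable _ _),
      starProjection_unitaryGroup]
    have e : ∀ s, (K l).starProjection (hK.unitaryGroup s (-Complex.I • g)) =
        Complex.exp (-Complex.I * s * l) • (-Complex.I * l) • (K l).starProjection f := by
      intro s
      rw [starProjection_unitaryGroup, map_smul, h l, smul_smul (-Complex.I)]
    simp only [e]
    rw [intervalIntegral.integral_eq_sub_of_hasDerivAt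
      (fun s _ => hasDerivAt_exp_smul l s ((K l).starProjection f))
      (Continuous.intervalIntegrable (by fun_prop) _ _)]
    simp
  have h1 : HasDerivAt (fun t => ∫ s in (0 : ℝ)..t, hK.unitaryGroup s (-Complex.I • g))
      (hK.unitaryGroup 0 (-Complex.I • g)) 0 :=
    intervalIntegral.integral_hasDerivAt_right (hc.intervalIntegrable _ _)
      (hc.stronglyMeasurableAtFilter _ _) hc.continuousAt
  rw [hK.isContractionGroup.zero] at h1
  have h2 := h1.const_add f
  exact h2.congr_of_eventuallyEq (Eventually.of_forall key)

/-- Conversely, a vector along whose orbit the group is differentiable at zero is in the domain of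
`B`: the derivative may be read off on each eigenspace. -/
theorem starProjection_of_hasDerivAt_unitaryGroup (hK : IsSpectralFamily K) {f f' : H}
    (h : HasDerivAt (fun t => hK.unitaryGroup t f) f' 0) (l : ℝ) :
    (K l).starProjection (Complex.I • f') = (l : ℂ) • (K l).starProjection f := by
  have h1 := (((K l).starProjection.restrictScalars ℝ).hasFDerivAt.comp_hasDerivAt (0 : ℝ) h)
  have h2 := hasDerivAt_exp_smul l 0 ((K l).starProjection f)
  have e : ((K l).starProjection.restrictScalars ℝ) ∘ (fun t => hK.unitaryGroup t f) =
      fun s : ℝ => Complex.exp (-Complex.I * s * l) • (K l).starProjection f := by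
    ext s
    exact hK.starProjection_unitaryGroup s l f
  rw [e] at h1
  have h3 := h1.unique h2
  rw [map_smul]
  change (K l).starProjection f' = _ at h3
  rw [h3]
  simp only [Complex.ofReal_zero, mul_zero, zero_mul, Complex.exp_zero, smul_smul]
  congr 1
  linear_combination -(l : ℂ) * Complex.I_mul_I

end IsSpectralFamily

end Spectral

/-! ### Calculus on the sphere and Green's formula -/

section SphereCalculus

/-- Complex functions of class `C²` on the sphere. -/
def C2OnSphere (φ : S2 → ℂ) : Prop := ContDiffOn ℝ 2 (radialExt φ) {0}ᶜ

theorem SmoothOnSphere.c2 {φ : S2 → ℂ} (h : SmoothOnSphere φ) : C2OnSphere φ :=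
  h.of_le (WithTop.coe_le_coe.mpr (le_top : ((2 : ℕ) : ℕ∞) ≤ ⊤))

/-- The standard basis of three-space. -/
noncomputable abbrev stdB : OrthonormalBasis (Fin 3) ℝ E3 := EuclideanSpace.basisFun (Fin 3) ℝ

theorem laplacian_eq_sum (F : E3 → ℂ) (x : E3) :
    Laplacian.laplacian F x = ∑ i, fderiv ℝ (fderiv ℝ F) x (stdB i) (stdB i) := by
  rw [InnerProductSpace.laplacian_eq_iteratedFDeriv_orthonormalBasis F stdB]
  simp [iteratedFDeriv_two_apply]

namespace C2OnSphere

variable {φ ψ : S2 → ℂ}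

theorem contDiffAt (h : C2OnSphere φ) {x : E3} (hx : x ∈ ({0}ᶜ : Set E3)) :
    ContDiffAt ℝ 2 (radialExt φ) x :=
  ContDiffOn.contDiffAt h (isOpen_compl_singleton.mem_nhds hx)

theorem differentiableAt (h : C2OnSphere φ) {x : E3} (hx : x ∈ ({0}ᶜ : Set E3)) :
    DifferentiableAt ℝ (radialExt φ) x :=
  (h.contDiffAt hx).differentiableAt two_ne_zero

theorem differentiableAt_fderiv (h : C2OnSphere φ) {x : E3} (hx : x ∈ ({0}ᶜ : Set E3)) :
    DifferentiableAt ℝ (fderiv ℝ (radialExt φ)) x :=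
  ((h.contDiffAt hx).fderiv_right (m := 1) (by norm_num)).differentiableAt one_ne_zero

theorem continuousOn_fderiv (h : C2OnSphere φ) :
    ContinuousOn (fderiv ℝ (radialExt φ)) {0}ᶜ := fun _ hx =>
  (h.differentiableAt_fderiv hx).continuousAt.continuousWithinAt

theorem continuousOn_fderiv_fderiv (h : C2OnSphere φ) :
    ContinuousOn (fderiv ℝ (fderiv ℝ (radialExt φ))) {0}ᶜ := fun _ hx =>
  (((h.contDiffAt hx).fderiv_right (m := 1) (by norm_num)).fderiv_right (m := 0)
    (by norm_num)).continuousAt.continuousWithinAt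

theorem continuousOn_laplacian (h : C2OnSphere φ) :
    ContinuousOn (Laplacian.laplacian (radialExt φ)) {0}ᶜ := by
  have : Laplacian.laplacian (radialExt φ) =
      fun x => ∑ i, fderiv ℝ (fderiv ℝ (radialExt φ)) x (stdB i) (stdB i) :=
    funext fun x => laplacian_eq_sum _ x
  rw [this]
  exact continuousOn_finsetSum _ fun i _ =>
    (h.continuousOn_fderiv_fderiv.clm_apply continuousOn_const).clm_apply continuousOn_const

theorem continuous (h : C2OnSphere φ) : Continuous φ := by
  have h1 : Continuous fun θ : S2 => radialExt φ (θ : E3) :=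
    ContinuousOn.comp_continuous (g := radialExt φ) (ContDiffOn.continuousOn h)
      continuous_subtype_val coe_ne_zero
  simpa [radialExt, dir_coe] using h1

theorem continuous_sphLap (h : C2OnSphere φ) : Continuous (sphLap φ) :=
  (h.continuousOn_laplacian.comp_continuous continuous_subtype_val coe_ne_zero).neg

theorem mul (h : C2OnSphere φ) (h' : C2OnSphere ψ) : C2OnSphere (φ * ψ) :=
  ContDiffOn.mul (f := radialExt φ) (g := radialExt ψ) h h'

theorem star (h : C2OnSphere φ) : C2OnSphere fun θ => starRingEnd ℂ (φ θ) :=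
  (Complex.conjCLE.contDiff (n := 2)).comp_contDiffOn h

end C2OnSphere

/-- The pointwise (bilinear) product of the gradients of two functions on the sphere. -/
noncomputable def gradMul (φ ψ : S2 → ℂ) (θ : S2) : ℂ :=
  ∑ i, fderiv ℝ (radialExt φ) θ (stdB i) * fderiv ℝ (radialExt ψ) θ (stdB i)

/-- The product rule for the Laplace-Beltrami operator. -/
theorem sphLap_mul {φ ψ : S2 → ℂ} (h : C2OnSphere φ) (h' : C2OnSphere ψ) (θ : S2) :
    sphLap (φ * ψ) θ = φ θ * sphLap ψ θ + ψ θ * sphLap φ θ - 2 * gradMul φ ψ θ := by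
  have hθ := coe_ne_zero θ
  have e1 : radialExt (φ * ψ) = radialExt φ * radialExt ψ := rfl
  have e2 : fderiv ℝ (radialExt (φ * ψ)) =ᶠ[𝓝 (θ : E3)] fun x =>
      radialExt φ x • fderiv ℝ (radialExt ψ) x + radialExt ψ x • fderiv ℝ (radialExt φ) x := by
    filter_upwards [isOpen_compl_singleton.mem_nhds hθ] with x hx
    rw [e1, fderiv_mul (h.differentiableAt hx) (h'.differentiableAt hx)]
  have e3 : ∀ v, fderiv ℝ (fderiv ℝ (radialExt (φ * ψ))) θ v v =
      φ θ * fderiv ℝ (fderiv ℝ (radialExt ψ)) θ v v +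
      ψ θ * fderiv ℝ (fderiv ℝ (radialExt φ)) θ v v +
      2 * (fderiv ℝ (radialExt φ) θ v * fderiv ℝ (radialExt ψ) θ v) := by
    intro v
    have d1 : DifferentiableAt ℝ (fun x => radialExt φ x • fderiv ℝ (radialExt ψ) x) θ :=
      (h.differentiableAt hθ).smul (h'.differentiableAt_fderiv hθ)
    have d2 : DifferentiableAt ℝ (fun x => radialExt ψ x • fderiv ℝ (radialExt φ) x) θ :=
      (h'.differentiableAt hθ).smul (h.differentiableAt_fderiv hθ)
    rw [e2.fderiv_eq, fderiv_fun_add d1 d2,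
      fderiv_fun_smul (h.differentiableAt hθ) (h'.differentiableAt_fderiv hθ),
      fderiv_fun_smul (h'.differentiableAt hθ) (h.differentiableAt_fderiv hθ)]
    have r1 : radialExt φ θ = φ θ := by rw [radialExt, dir_coe]
    have r2 : radialExt ψ θ = ψ θ := by rw [radialExt, dir_coe]
    simp [r1, r2]
    ring
  unfold sphLap
  rw [laplacian_eq_sum, laplacian_eq_sum, laplacian_eq_sum, gradMul]
  simp only [e3, Finset.sum_add_distrib, ← Finset.mul_sum]
  ring

theorem radialExt_smul {F : Type*} (φ : S2 → F) {r : ℝ} (hr : 0 < r) (x : E3) :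
    radialExt φ (r • x) = radialExt φ x := by
  have : dir (r • x) = dir x := by
    by_cases hx : x = 0
    · simp [hx]
    · have hrx : r • x ≠ 0 := smul_ne_zero hr.ne' hx
      ext1
      simp only [dir, hx, hrx, dite_false]
      rw [norm_smul, Real.norm_of_nonneg hr.le, smul_smul, mul_inv, mul_comm r⁻¹, mul_assoc,
        inv_mul_cancel₀ hr.ne', mul_one]
  simp only [radialExt, this]

/-- The radial derivative of the radial extension vanishes. -/
theorem fderiv_radialExt_self {φ : S2 → ℂ} {x : E3} (h : DifferentiableAt ℝ (radialExt φ) x) :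
    fderiv ℝ (radialExt φ) x x = 0 := by
  have h1 : HasDerivAt (fun t : ℝ => x + t • x) x 0 := by
    simpa using ((hasDerivAt_id (0 : ℝ)).smul_const x).const_add x
  have h2 : HasDerivAt (fun t : ℝ => radialExt φ (x + t • x)) (fderiv ℝ (radialExt φ) x x) 0 := by
    have h3 : HasFDerivAt (radialExt φ) (fderiv ℝ (radialExt φ) x) (x + (0 : ℝ) • x) := by
      simpa using h.hasFDerivAt
    exact h3.comp_hasDerivAt 0 h1
  have h4 : (fun t : ℝ => radialExt φ (x + t • x)) =ᶠ[𝓝 0] fun _ => radialExt φ x := by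
    filter_upwards [Ioi_mem_nhds (show (-1 : ℝ) < 0 by norm_num)] with t ht
    have : x + t • x = (1 + t) • x := by rw [add_smul, one_smul]
    rw [this, radialExt_smul φ (by have : -1 < t := ht; linarith)]
  exact h2.unique ((hasDerivAt_const _ _).congr_of_eventuallyEq h4)

/-- The Laplacian of the radial extension is homogeneous of degree `-2`. -/
theorem laplacian_radialExt {φ : S2 → ℂ} (hφ : C2OnSphere φ) {x : E3} (hx : x ∈ ({0}ᶜ : Set E3)) :
    Laplacian.laplacian (radialExt φ) x = ((‖x‖ ^ 2)⁻¹ : ℝ) * -sphLap φ (dir x) := by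
  have hx0 : x ≠ 0 := hx
  have hn : 0 < ‖x‖⁻¹ := inv_pos.2 (norm_pos_iff.2 hx0)
  set r := ‖x‖⁻¹ with hr
  have hdir : ((dir x : S2) : E3) = r • x := by simp [dir, hx0, hr]
  have e1 : fderiv ℝ (radialExt φ) = fun y => r • fderiv ℝ (radialExt φ) (r • y) := by
    ext1 y
    rw [← fderiv_comp_smul]
    congr 1
    ext z
    rw [radialExt_smul φ hn]
  have e2 : fderiv ℝ (fderiv ℝ (radialExt φ)) x =
      r • r • fderiv ℝ (fderiv ℝ (radialExt φ)) (r • x) := by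
    nth_rewrite 1 [e1]
    have hrx : r • x ∈ ({0}ᶜ : Set E3) := smul_ne_zero hn.ne' hx0
    have hd : DifferentiableAt ℝ (fun y => fderiv ℝ (radialExt φ) (r • y)) x :=
      (hφ.differentiableAt_fderiv hrx).comp x (differentiableAt_id.const_smul r)
    rw [fderiv_fun_const_smul hd, fderiv_comp_smul]
  unfold sphLap
  rw [neg_neg, laplacian_eq_sum, laplacian_eq_sum, hdir, e2, Finset.mul_sum]
  refine Finset.sum_congr rfl fun i _ => ?_
  simp only [smul_apply, Complex.real_smul, hr]
  push_cast
  rw [sq, mul_inv]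
  ring

/-- Integration in polar coordinates of a function of separated variables. -/
theorem integral_polar (c : ℝ → ℂ) (u : S2 → ℂ) :
    ∫ x : E3, c ‖x‖ * u (dir x) =
      (∫ r : Ioi (0 : ℝ), c r ∂Measure.volumeIoiPow 2) * ∫ θ, u θ ∂surf := by
  have hdim : Module.finrank ℝ E3 - 1 = 2 := by simp
  calc ∫ x : E3, c ‖x‖ * u (dir x) =
      ∫ x : ({(0)}ᶜ : Set E3), c ‖x.1‖ * u (dir x.1) ∂((volume : Measure E3).comap (↑)) := by
        rw [integral_subtype_comap (measurableSet_singleton _).compl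
          fun x => c ‖x‖ * u (dir x), restrict_compl_singleton]
    _ = ∫ z : S2 × Ioi (0 : ℝ), u z.1 * c z.2 ∂surf.prod (Measure.volumeIoiPow 2) := by
        have := (volume : Measure E3).measurePreserving_homeomorphUnitSphereProd.integral_comp
          (Homeomorph.measurableEmbedding _) (fun z : S2 × Ioi (0 : ℝ) => u z.1 * c z.2)
        rw [hdim] at this
        rw [← this]
        congr 1
        ext x
        have hd : dir x.1 = (homeomorphUnitSphereProd E3 x).1 := by
          ext1
          have : (x : E3) ≠ 0 := x.2
          simp [dir, this]
        rw [hd, mul_comm]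
        simp
    _ = _ := by
        rw [integral_prod_mul u (fun r : Ioi (0 : ℝ) => c r), mul_comm]

/-- A smooth cutoff supported in `(1/2, 3/2)`. -/
noncomputable def radialBump : ContDiffBump (1 : ℝ) := ⟨1 / 4, 1 / 2, by norm_num, by norm_num⟩

theorem radialBump_eq_zero {s : ℝ} (hs : s ≤ 1 / 2) : radialBump s = 0 := by
  apply radialBump.zero_of_le_dist
  rw [Real.dist_eq]
  have : |s - 1| = 1 - s := by rw [abs_of_nonpos (by linarith)]; ring
  rw [this]
  change (1 / 2 : ℝ) ≤ _
  linarith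

/-- The cutoff `|x|² η(|x|²)` of three-space.  The factor `|x|²` compensates the homogeneity of
degree `-2` of the Laplacian of a radial extension. -/
noncomputable def shellCutoff (x : E3) : ℝ := ‖x‖ ^ 2 * radialBump (‖x‖ ^ 2)

theorem contDiff_shellCutoff : ContDiff ℝ 1 shellCutoff :=
  (contDiff_norm_sq ℝ).mul (radialBump.contDiff.comp (contDiff_norm_sq ℝ))

theorem tsupport_shellCutoff :
    IsCompact (tsupport shellCutoff) ∧ tsupport shellCutoff ⊆ ({0}ᶜ : Set E3) := by
  have hsub : tsupport shellCutoff ⊆ {x : E3 | 1 / 2 ≤ ‖x‖ ^ 2 ∧ ‖x‖ ^ 2 ≤ 3 / 2} := by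
    refine closure_minimal (fun x hx => ?_) ?_
    · rw [Function.mem_support, shellCutoff] at hx
      have h1 : radialBump (‖x‖ ^ 2) ≠ 0 := fun h => hx (by rw [h, mul_zero])
      have h2 : ‖x‖ ^ 2 ∈ Function.support radialBump := h1
      rw [radialBump.support_eq, Real.ball_eq_Ioo] at h2
      have : radialBump.rOut = 1 / 2 := rfl
      rw [this] at h2
      exact ⟨by linarith [h2.1], by linarith [h2.2]⟩
    · have hc : Continuous fun x : E3 => ‖x‖ ^ 2 := by fun_prop
      exact (isClosed_le continuous_const hc).inter (isClosed_le hc continuous_const)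
  constructor
  · refine (isCompact_closedBall (0 : E3) 2).of_isClosed_subset (isClosed_tsupport _)
      (hsub.trans fun x hx => ?_)
    rw [mem_closedBall_zero_iff]
    have := hx.2
    nlinarith [norm_nonneg x]
  · intro x hx h0
    rw [mem_singleton_iff] at h0
    have := (hsub hx).1
    rw [h0] at this
    norm_num at this

theorem integrable_cutoff_smul {c : E3 → ℝ} (hc : Continuous c)
    (hs : tsupport c ⊆ tsupport shellCutoff) {F : E3 → ℂ} (hF : ContinuousOn F {0}ᶜ) :
    Integrable (fun x => c x • F x) := by
  have h1 : ContinuousOn (fun x => c x • F x) (tsupport shellCutoff) :=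
    hc.continuousOn.smul (hF.mono tsupport_shellCutoff.2)
  rw [← integrableOn_iff_integrable_of_support_subset (s := tsupport shellCutoff)]
  · exact h1.integrableOn_compact tsupport_shellCutoff.1
  · intro x hx
    refine hs (subset_tsupport _ fun h => hx ?_)
    simp [h]

/-- The radial factor in the separated integral, which may therefore be divided out. -/
theorem radialBump_integral_ne_zero : (∫ r : Ioi (0 : ℝ), (radialBump ((r : ℝ) ^ 2) : ℂ)
    ∂Measure.volumeIoiPow 2) ≠ 0 := by
  intro h0
  have h := integral_polar (fun r => (radialBump (r ^ 2) : ℂ)) (fun _ => 1)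
  rw [h0, zero_mul] at h
  simp only [mul_one] at h
  rw [integral_complex_ofReal] at h
  have hpos : 0 < ∫ x : E3, radialBump (‖x‖ ^ 2) := by
    refine Continuous.integral_pos_of_hasCompactSupport_nonneg_nonzero
      (x := EuclideanSpace.single 0 1) ?_ ?_ ?_ ?_
    · exact radialBump.continuous.comp (by fun_prop)
    · refine HasCompactSupport.of_support_subset_isCompact (isCompact_closedBall (0 : E3) 2) ?_
      intro x hx
      have h2 : ‖x‖ ^ 2 ∈ Function.support radialBump := hx
      rw [radialBump.support_eq, Real.ball_eq_Ioo] at h2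
      have : radialBump.rOut = 1 / 2 := rfl
      rw [this] at h2
      rw [mem_closedBall_zero_iff]
      nlinarith [norm_nonneg x, h2.2]
    · exact fun x => radialBump.nonneg
    · simp only [PiLp.norm_single, norm_one, one_pow]
      rw [radialBump.one_of_mem_closedBall (mem_closedBall_self radialBump.rIn_pos.le)]
      exact one_ne_zero
  exact hpos.ne' (by exact_mod_cast h)

/-- **Green's formula** on the sphere.  In polar coordinates the integral over the sphere is that of
`φ Δψ - ψ Δφ = div (φ ∇ψ - ψ ∇φ)` over a shell, against a radial cutoff whose gradient is radial
and hence orthogonal to the gradients of the radial extensions. -/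
theorem integral_mul_sphLap {φ ψ : S2 → ℂ} (hφ : C2OnSphere φ) (hψ : C2OnSphere ψ) :
    ∫ θ, φ θ * sphLap ψ θ ∂surf = ∫ θ, sphLap φ θ * ψ θ ∂surf := by
  set f := radialExt φ with hf
  set g := radialExt ψ with hg
  let V : Fin 3 → E3 → ℂ := fun i x =>
    f x * fderiv ℝ g x (stdB i) - g x * fderiv ℝ f x (stdB i)
  have hdiff : ∀ {u : S2 → ℂ}, C2OnSphere u → ∀ i : Fin 3, ∀ x ∈ ({0}ᶜ : Set E3),
      DifferentiableAt ℝ (fun x => fderiv ℝ (radialExt u) x (stdB i)) x := fun hu i x hx =>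
    (hu.differentiableAt_fderiv hx).clm_apply (differentiableAt_const _)
  have hVd : ∀ i, ∀ x ∈ ({0}ᶜ : Set E3), DifferentiableAt ℝ (V i) x := fun i x hx =>
    ((hφ.differentiableAt hx).mul (hdiff hψ i x hx)).sub
      ((hψ.differentiableAt hx).mul (hdiff hφ i x hx))
  have hVf : ∀ i, ∀ x ∈ ({0}ᶜ : Set E3), fderiv ℝ (V i) x (stdB i) =
      f x * fderiv ℝ (fderiv ℝ g) x (stdB i) (stdB i) -
      g x * fderiv ℝ (fderiv ℝ f) x (stdB i) (stdB i) := by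
    intro i x hx
    change fderiv ℝ (fun x => f x * fderiv ℝ g x (stdB i) - g x * fderiv ℝ f x (stdB i)) x _ = _
    have d1 : DifferentiableAt ℝ (fun x => f x * fderiv ℝ g x (stdB i)) x :=
      (hφ.differentiableAt hx).mul (hdiff hψ i x hx)
    have d2 : DifferentiableAt ℝ (fun x => g x * fderiv ℝ f x (stdB i)) x :=
      (hψ.differentiableAt hx).mul (hdiff hφ i x hx)
    rw [fderiv_fun_sub d1 d2,
      fderiv_fun_mul (hφ.differentiableAt hx) (hdiff hψ i x hx),
      fderiv_fun_mul (hψ.differentiableAt hx) (hdiff hφ i x hx),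
      fderiv_clm_apply (hψ.differentiableAt_fderiv hx) (differentiableAt_const _),
      fderiv_clm_apply (hφ.differentiableAt_fderiv hx) (differentiableAt_const _)]
    simp [hf, hg]
    ring
  have hVc : ∀ i, ContinuousOn (V i) {0}ᶜ := fun i x hx =>
    (hVd i x hx).continuousAt.continuousWithinAt
  have hVfc : ∀ i, ContinuousOn (fun x => fderiv ℝ (V i) x (stdB i)) {0}ᶜ := fun i =>
    (((ContDiffOn.continuousOn hφ).mul ((hψ.continuousOn_fderiv_fderiv.clm_apply
      continuousOn_const).clm_apply continuousOn_const)).sub ((ContDiffOn.continuousOn hψ).mul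
      ((hφ.continuousOn_fderiv_fderiv.clm_apply
      continuousOn_const).clm_apply continuousOn_const))).congr (hVf i)
  have hχd : ∀ i : Fin 3, Continuous fun x => fderiv ℝ shellCutoff x (stdB i) := fun i =>
    (contDiff_shellCutoff.continuous_fderiv one_ne_zero).clm_apply continuous_const
  -- integration by parts in each coordinate
  have hparts : ∀ i, ∫ x, shellCutoff x • fderiv ℝ (V i) x (stdB i) =
      -∫ x, fderiv ℝ shellCutoff x (stdB i) • V i x := by
    intro i
    have := integral_bilinear_fderiv_right_eq_neg_left_of_integrable (μ := (volume : Measure E3))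
      (f := shellCutoff) (g := V i) (v := stdB i) (B := ContinuousLinearMap.lsmul ℝ ℝ)
      (integrable_cutoff_smul (hχd i) ((tsupport_fderiv_apply_subset ℝ _)) (hVc i))
      (integrable_cutoff_smul contDiff_shellCutoff.continuous subset_rfl (hVfc i))
      (integrable_cutoff_smul contDiff_shellCutoff.continuous subset_rfl (hVc i))
      (fun x _ => contDiff_shellCutoff.differentiable one_ne_zero x)
      (fun x hx => hVd i x (tsupport_shellCutoff.2 hx))
    simpa using this
  have hχ : ∀ x v : E3, fderiv ℝ shellCutoff x v =
      (2 * (radialBump (‖x‖ ^ 2) + ‖x‖ ^ 2 * deriv radialBump (‖x‖ ^ 2))) * ⟪x, v⟫_ℝ := by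
    intro x v
    have h1 : HasFDerivAt (fun x : E3 => ‖x‖ ^ 2) (2 • innerSL ℝ x) x :=
      (hasStrictFDerivAt_norm_sq x).hasFDerivAt
    have key : ∀ r : ℝ → ℝ, ContDiff ℝ 1 r →
        fderiv ℝ (fun x : E3 => ‖x‖ ^ 2 * r (‖x‖ ^ 2)) x v =
        (2 * (r (‖x‖ ^ 2) + ‖x‖ ^ 2 * deriv r (‖x‖ ^ 2))) * ⟪x, v⟫_ℝ := by
      intro r hr
      have h2 : HasDerivAt r (deriv r (‖x‖ ^ 2)) (‖x‖ ^ 2) :=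
        (hr.differentiable one_ne_zero _).hasDerivAt
      have h3 := h1.mul (h2.comp_hasFDerivAt x h1)
      have h4 : fderiv ℝ (fun x : E3 => ‖x‖ ^ 2 * r (‖x‖ ^ 2)) x = _ := h3.fderiv
      rw [h4]
      simp
      ring
    exact key radialBump radialBump.contDiff
  -- the radial gradient of the cutoff is orthogonal to the tangential vector field
  have horth : ∀ x, ∑ i, fderiv ℝ shellCutoff x (stdB i) • V i x = 0 := by
    intro x
    by_cases hx : x ∈ ({0}ᶜ : Set E3)
    · have hsum : ∀ {u : S2 → ℂ}, C2OnSphere u →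
          ∑ i, (⟪x, stdB i⟫_ℝ : ℂ) * fderiv ℝ (radialExt u) x (stdB i) = 0 := by
        intro u hu
        have e : ∑ i, ⟪x, stdB i⟫_ℝ • stdB i = x := by
          have := stdB.sum_repr' x
          simpa only [real_inner_comm] using this
        have h0 := fderiv_radialExt_self (hu.differentiableAt hx)
        nth_rewrite 2 [← e] at h0
        rw [map_sum] at h0
        simpa only [map_smul, Complex.real_smul] using h0
      simp only [hχ, V, Complex.real_smul]
      have h1 := hsum hφ
      have h2 := hsum hψ
      rw [← hf] at h1
      rw [← hg] at h2
      push_cast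
      calc _ = (2 * (((radialBump (‖x‖ ^ 2) : ℝ) : ℂ) + (‖x‖ : ℂ) ^ 2 *
            ((deriv radialBump (‖x‖ ^ 2) : ℝ) : ℂ))) *
            (f x * (∑ i, (⟪x, stdB i⟫_ℝ : ℂ) * fderiv ℝ g x (stdB i)) -
             g x * (∑ i, (⟪x, stdB i⟫_ℝ : ℂ) * fderiv ℝ f x (stdB i))) := by
            rw [Finset.mul_sum, Finset.mul_sum, ← Finset.sum_sub_distrib, Finset.mul_sum]
            refine Finset.sum_congr rfl fun i _ => ?_
            ring
        _ = 0 := by rw [h1, h2]; ring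
    · have hx0 : x = 0 := by simpa using hx
      refine Finset.sum_eq_zero fun i _ => ?_
      rw [hχ, hx0]
      simp
  have hzero : ∫ x : E3, ∑ i, shellCutoff x • fderiv ℝ (V i) x (stdB i) = 0 := by
    rw [integral_finsetSum _ fun i _ =>
      integrable_cutoff_smul contDiff_shellCutoff.continuous subset_rfl (hVfc i)]
    simp only [hparts]
    rw [Finset.sum_neg_distrib, ← integral_finsetSum _ fun i _ =>
      integrable_cutoff_smul (hχd i) ((tsupport_fderiv_apply_subset ℝ _)) (hVc i)]
    simp only [horth, integral_zero, neg_zero]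
  -- the divergence separates the radial and the angular variable
  have hpt : ∀ x : E3, ∑ i, shellCutoff x • fderiv ℝ (V i) x (stdB i) =
      (radialBump (‖x‖ ^ 2) : ℂ) * ((fun θ => sphLap φ θ * ψ θ - φ θ * sphLap ψ θ) (dir x)) := by
    intro x
    by_cases hx : x ∈ ({0}ᶜ : Set E3)
    · have hn : (‖x‖ : ℂ) ≠ 0 := by
        have : x ≠ 0 := hx
        simpa using this
      have l1 := laplacian_radialExt hφ hx
      have l2 := laplacian_radialExt hψ hx
      rw [laplacian_eq_sum] at l1 l2
      rw [← Finset.smul_sum]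
      simp only [hVf _ x hx, Finset.sum_sub_distrib, ← Finset.mul_sum]
      rw [hf, hg, l1, l2]
      simp only [shellCutoff, radialExt, Complex.real_smul]
      push_cast
      field_simp
      ring
    · have hx0 : x = 0 := by simpa using hx
      have : shellCutoff x = 0 := by simp [shellCutoff, hx0]
      simp only [this, zero_smul, Finset.sum_const_zero]
      rw [radialBump_eq_zero (by simp [hx0])]
      simp
  simp only [hpt] at hzero
  have h1 := (mul_eq_zero.1 ((integral_polar (fun r => (radialBump (r ^ 2) : ℂ))
    (fun θ => sphLap φ θ * ψ θ - φ θ * sphLap ψ θ)).symm.trans hzero)).resolve_left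
    radialBump_integral_ne_zero
  have hi1 : Integrable (fun θ => sphLap φ θ * ψ θ) surf :=
    (hφ.continuous_sphLap.mul hψ.continuous).integrable_of_hasCompactSupport
      (HasCompactSupport.of_compactSpace _)
  have hi2 : Integrable (fun θ => φ θ * sphLap ψ θ) surf :=
    (hφ.continuous.mul hψ.continuous_sphLap).integrable_of_hasCompactSupport
      (HasCompactSupport.of_compactSpace _)
  rw [integral_sub hi1 hi2] at h1
  exact (sub_eq_zero.1 h1).symm

end SphereCalculus

/-! ### Ridge functions -/

section Ridge

/-- The restriction to the sphere of the linear form `x ↦ ⟪a, x⟫`. -/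
noncomputable def linForm (a : E3) (θ : S2) : ℂ := ((⟪a, (θ : E3)⟫_ℝ : ℝ) : ℂ)

theorem radialExt_linForm (a : E3) {x : E3} (hx : x ∈ ({0}ᶜ : Set E3)) :
    radialExt (linForm a) x = ((‖x‖⁻¹ * ⟪a, x⟫_ℝ : ℝ) : ℂ) := by
  have hx0 : x ≠ 0 := hx
  simp [radialExt, linForm, dir, hx0, inner_smul_right]

theorem smooth_linForm (a : E3) : SmoothOnSphere (linForm a) := by
  refine ContDiffOn.congr (f := fun x : E3 => ((‖x‖⁻¹ * ⟪a, x⟫_ℝ : ℝ) : ℂ)) ?_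
    fun x hx => radialExt_linForm a hx
  refine (Complex.ofRealCLM.contDiff (n := ∞)).comp_contDiffOn fun x hx => ?_
  have hx0 : x ≠ 0 := hx
  exact (((contDiffAt_norm ℝ hx0).inv (norm_ne_zero_iff.2 hx0)).mul
    (contDiff_const.inner ℝ contDiff_id).contDiffAt).contDiffWithinAt

theorem hasFDerivAt_inv_norm {x : E3} (hx : x ≠ 0) :
    HasFDerivAt (fun y : E3 => ‖y‖⁻¹) (-(‖x‖⁻¹ ^ 3) • innerSL ℝ x) x := by
  have hn : ‖x‖ ≠ 0 := norm_ne_zero_iff.2 hx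
  have h1 : HasFDerivAt (fun x : E3 => ‖x‖ ^ 2) (2 • innerSL ℝ x) x :=
    (hasStrictFDerivAt_norm_sq x).hasFDerivAt
  have h2 := h1.sqrt (pow_ne_zero 2 hn)
  simp only [Real.sqrt_sq (norm_nonneg _)] at h2
  have h3 := (hasDerivAt_inv hn).comp_hasFDerivAt x h2
  refine h3.congr_fderiv ?_
  ext v
  simp
  field_simp

theorem fderiv_linForm (a v : E3) {x : E3} (hx : x ∈ ({0}ᶜ : Set E3)) :
    fderiv ℝ (radialExt (linForm a)) x v =
      ((‖x‖⁻¹ * ⟪a, v⟫_ℝ - ⟪a, x⟫_ℝ * (‖x‖⁻¹ ^ 3 * ⟪x, v⟫_ℝ) : ℝ) : ℂ) := by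
  have h1 := (hasFDerivAt_inv_norm (x := x) hx).mul (innerSL ℝ a).hasFDerivAt
  have h2 := (Complex.ofRealCLM.hasFDerivAt (x := ‖x‖⁻¹ * ⟪a, x⟫_ℝ)).comp x h1
  have h3 : radialExt (linForm a) =ᶠ[𝓝 x]
      Complex.ofRealCLM ∘ ((fun y : E3 => ‖y‖⁻¹) * ⇑(innerSL ℝ a)) := by
    filter_upwards [isOpen_compl_singleton.mem_nhds hx] with y hy
    rw [radialExt_linForm a hy]
    simp
  rw [h3.fderiv_eq, h2.fderiv]
  simp
  ring

/-- Linear forms are eigenfunctions, for the eigenvalue `2`. -/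
theorem sphLap_linForm (a : E3) (θ : S2) : sphLap (linForm a) θ = 2 * linForm a θ := by
  have hθ := coe_ne_zero θ
  have hn : ‖(θ : E3)‖ = 1 := by simp
  have hd := ((smooth_linForm a).c2).differentiableAt_fderiv hθ
  have key : ∀ v : E3, fderiv ℝ (fderiv ℝ (radialExt (linForm a))) θ v v =
      ((-2 * (⟪a, v⟫_ℝ * ⟪(θ : E3), v⟫_ℝ) + 3 * ⟪a, θ⟫_ℝ * (⟪(θ : E3), v⟫_ℝ * ⟪(θ : E3), v⟫_ℝ) -
        ⟪a, θ⟫_ℝ * ⟪v, v⟫_ℝ : ℝ) : ℂ) := by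
    intro v
    have e1 : fderiv ℝ (fderiv ℝ (radialExt (linForm a))) θ v v =
        fderiv ℝ (fun x => fderiv ℝ (radialExt (linForm a)) x v) θ v := by
      rw [fderiv_clm_apply hd (differentiableAt_const _)]
      simp
    have h1 := hasFDerivAt_inv_norm (x := (θ : E3)) hθ
    have hv : HasFDerivAt (fun x : E3 => ⟪x, v⟫_ℝ) (innerSL ℝ v) θ := by
      have := (innerSL ℝ v).hasFDerivAt (x := (θ : E3))
      refine this.congr_of_eventuallyEq (Eventually.of_forall fun x => ?_)
      simp [real_inner_comm]
    have ha : HasFDerivAt (fun x : E3 => ⟪a, x⟫_ℝ) (innerSL ℝ a) θ :=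
      (innerSL ℝ a).hasFDerivAt (x := (θ : E3))
    have hp : HasFDerivAt (fun y : E3 => ‖y‖⁻¹ ^ 3) _ θ := h1.pow 3
    have h2 := (h1.mul_const ⟪a, v⟫_ℝ).fun_sub (ha.fun_mul (hp.fun_mul hv))
    have h3 := (Complex.ofRealCLM.hasFDerivAt).comp (θ : E3) h2
    have h4 : (fun x => fderiv ℝ (radialExt (linForm a)) x v) =ᶠ[𝓝 (θ : E3)]
        Complex.ofRealCLM ∘ fun x : E3 => ‖x‖⁻¹ * ⟪a, v⟫_ℝ - ⟪a, x⟫_ℝ * (‖x‖⁻¹ ^ 3 * ⟪x, v⟫_ℝ) := by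
      filter_upwards [isOpen_compl_singleton.mem_nhds hθ] with y hy
      rw [fderiv_linForm a v hy]
      simp
    rw [e1, h4.fderiv_eq, h3.fderiv]
    simp [hn]
    ring
  unfold sphLap
  rw [laplacian_eq_sum]
  simp only [key]
  rw [← Complex.ofReal_sum, Finset.sum_sub_distrib, Finset.sum_add_distrib, ← Finset.mul_sum,
    ← Finset.mul_sum, ← Finset.mul_sum]
  have s1 : ∀ x y : E3, ∑ i, ⟪x, stdB i⟫_ℝ * ⟪y, stdB i⟫_ℝ = ⟪x, y⟫_ℝ := fun x y => by
    rw [← stdB.sum_inner_mul_inner x y]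
    exact Finset.sum_congr rfl fun i _ => by rw [real_inner_comm y]
  have s2 : ∑ i, ⟪stdB i, stdB i⟫_ℝ = 3 := by simp
  rw [s1, s1, s2, real_inner_self_eq_norm_sq, hn, linForm]
  push_cast
  ring

theorem gradMul_linForm (a : E3) (θ : S2) :
    gradMul (linForm a) (linForm a) θ = ‖a‖ ^ 2 - linForm a θ ^ 2 := by
  have hn : ‖(θ : E3)‖ = 1 := by simp
  have s1 : ∀ x y : E3, ∑ i, ⟪x, stdB i⟫_ℝ * ⟪y, stdB i⟫_ℝ = ⟪x, y⟫_ℝ := fun x y => by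
    rw [← stdB.sum_inner_mul_inner x y]
    exact Finset.sum_congr rfl fun i _ => by rw [real_inner_comm y]
  have h : ∑ i, ((⟪a, stdB i⟫_ℝ - ⟪a, θ⟫_ℝ * ⟪(θ : E3), stdB i⟫_ℝ) *
      (⟪a, stdB i⟫_ℝ - ⟪a, θ⟫_ℝ * ⟪(θ : E3), stdB i⟫_ℝ)) = ‖a‖ ^ 2 - ⟪a, θ⟫_ℝ ^ 2 := by
    have e : ∀ i, ((⟪a, stdB i⟫_ℝ - ⟪a, θ⟫_ℝ * ⟪(θ : E3), stdB i⟫_ℝ) *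
      (⟪a, stdB i⟫_ℝ - ⟪a, θ⟫_ℝ * ⟪(θ : E3), stdB i⟫_ℝ)) = ⟪a, stdB i⟫_ℝ * ⟪a, stdB i⟫_ℝ -
        2 * ⟪a, θ⟫_ℝ * (⟪a, stdB i⟫_ℝ * ⟪(θ : E3), stdB i⟫_ℝ) +
        ⟪a, θ⟫_ℝ ^ 2 * (⟪(θ : E3), stdB i⟫_ℝ * ⟪(θ : E3), stdB i⟫_ℝ) := fun i => by ring
    simp only [e, Finset.sum_add_distrib, Finset.sum_sub_distrib, ← Finset.mul_sum, s1]
    rw [real_inner_self_eq_norm_sq, real_inner_self_eq_norm_sq, hn]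
    ring
  simp only [gradMul, fderiv_linForm a _ (coe_ne_zero θ), hn]
  simp only [inv_one, one_mul, one_pow]
  rw [linForm, ← Complex.ofReal_pow, ← Complex.ofReal_pow, ← Complex.ofReal_sub, ← h]
  push_cast
  rfl

theorem SmoothOnSphere.pow {φ : S2 → ℂ} (h : SmoothOnSphere φ) (n : ℕ) : SmoothOnSphere (φ ^ n) :=
  ContDiffOn.pow (f := radialExt φ) h n

theorem sphLap_const (c : ℂ) (θ : S2) : sphLap (fun _ => c) θ = 0 := by
  have : radialExt (fun _ : S2 => c) = fun _ => c := rfl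
  simp [sphLap, this, laplacian_eq_sum]

theorem gradMul_linForm_pow (a : E3) (n : ℕ) (θ : S2) :
    gradMul (linForm a ^ n) (linForm a) θ =
      n * linForm a θ ^ (n - 1) * (‖a‖ ^ 2 - linForm a θ ^ 2) := by
  rw [← gradMul_linForm, gradMul, gradMul, Finset.mul_sum]
  refine Finset.sum_congr rfl fun i _ => ?_
  have h := (((smooth_linForm a).c2).differentiableAt (coe_ne_zero θ))
  have e : radialExt (linForm a ^ n) = fun x => radialExt (linForm a) x ^ n := rfl
  rw [e, fderiv_fun_pow n h]
  have r1 : radialExt (linForm a) θ = linForm a θ := by rw [radialExt, dir_coe]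
  simp [r1]
  ring

/-- The action of the Laplace-Beltrami operator on the powers of a linear form. -/
theorem sphLap_linForm_pow (a : E3) (n : ℕ) (θ : S2) :
    sphLap (linForm a ^ n) θ = n * (n + 1) * linForm a θ ^ n -
      n * (n - 1) * ‖a‖ ^ 2 * linForm a θ ^ (n - 2) := by
  induction n with
  | zero =>
    have : linForm a ^ 0 = fun _ => (1 : ℂ) := rfl
    rw [this, sphLap_const]
    simp
  | succ n ih =>
    rw [pow_succ, sphLap_mul ((smooth_linForm a).pow n).c2 (smooth_linForm a).c2, ih,
      sphLap_linForm, gradMul_linForm_pow]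
    simp only [Pi.pow_apply]
    rcases n with - | - | n
    · simp
      left
      norm_num
    · simp
      ring
    · simp only [show n + 1 + 1 + 1 - 2 = n + 1 by omega, show n + 1 + 1 - 2 = n by omega,
        show n + 1 + 1 - 1 = n + 1 by omega]
      push_cast
      ring

end Ridge

/-! ### Density of smooth eigenfunctions -/

section Density

theorem SmoothOnSphere.add {φ ψ : S2 → ℂ} (h : SmoothOnSphere φ) (h' : SmoothOnSphere ψ) :
    SmoothOnSphere (φ + ψ) :=
  ContDiffOn.add (f := radialExt φ) (g := radialExt ψ) h h'

theorem SmoothOnSphere.const (c : ℂ) : SmoothOnSphere fun _ => c :=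
  contDiffOn_const (c := c)

theorem SmoothOnSphere.smul {φ : S2 → ℂ} (h : SmoothOnSphere φ) (c : ℂ) :
    SmoothOnSphere (c • φ) :=
  ContDiffOn.const_smul (f := radialExt φ) c h

theorem SmoothOnSphere.star {φ : S2 → ℂ} (h : SmoothOnSphere φ) :
    SmoothOnSphere fun θ => starRingEnd ℂ (φ θ) :=
  (Complex.conjCLE.contDiff (n := ∞)).comp_contDiffOn h

theorem sphLap_add {φ ψ : S2 → ℂ} (h : C2OnSphere φ) (h' : C2OnSphere ψ) (θ : S2) :
    sphLap (φ + ψ) θ = sphLap φ θ + sphLap ψ θ := by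
  have := (h.contDiffAt (coe_ne_zero θ)).laplacian_add (h'.contDiffAt (coe_ne_zero θ))
  have e : radialExt (φ + ψ) = radialExt φ + radialExt ψ := rfl
  rw [sphLap, e, this, neg_add]
  rfl

theorem sphLap_smul {φ : S2 → ℂ} (h : C2OnSphere φ) (c : ℂ) (θ : S2) :
    sphLap (c • φ) θ = c * sphLap φ θ := by
  have e : radialExt (c • φ) = c • radialExt φ := rfl
  have := InnerProductSpace.laplacian_smul c (h.contDiffAt (coe_ne_zero θ))
  rw [sphLap, e, this, sphLap, smul_eq_mul, mul_neg]

theorem sphLap_star (φ : S2 → ℂ) (θ : S2) :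
    sphLap (fun θ => starRingEnd ℂ (φ θ)) θ = starRingEnd ℂ (sphLap φ θ) := by
  have e : radialExt (fun θ => starRingEnd ℂ (φ θ)) = Complex.conjCLE ∘ radialExt φ := rfl
  rw [sphLap, e, InnerProductSpace.laplacian_CLE_comp_left, sphLap]
  simp

/-- The space of smooth functions on the sphere. -/
def smoothFun : Submodule ℂ (S2 → ℂ) where
  carrier := {φ | SmoothOnSphere φ}
  add_mem' := fun h h' => SmoothOnSphere.add h h'
  zero_mem' := SmoothOnSphere.const 0
  smul_mem' := fun c _ h => SmoothOnSphere.smul h c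

/-- The Laplace-Beltrami operator on smooth functions. -/
noncomputable def smoothLap : smoothFun →ₗ[ℂ] (S2 → ℂ) where
  toFun := fun φ => sphLap φ.1
  map_add' := fun φ ψ => funext fun θ => sphLap_add φ.2.c2 ψ.2.c2 θ
  map_smul' := fun c φ => funext fun θ => sphLap_smul φ.2.c2 c θ

/-- The ridge function `θ ↦ ⟪a, θ⟫ ^ n`, as a smooth function on the sphere. -/
noncomputable def ridge (a : E3) (n : ℕ) : smoothFun :=
  ⟨linForm a ^ n, (smooth_linForm a).pow n⟩

theorem smoothLap_ridge (a : E3) (n : ℕ) :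
    smoothLap (ridge a n) = ((n * (n + 1) : ℝ) : ℂ) • (ridge a n : S2 → ℂ) -
      (n * (n - 1) * ‖a‖ ^ 2 : ℂ) • (ridge a (n - 2) : S2 → ℂ) := by
  ext θ
  refine (sphLap_linForm_pow a n θ).trans ?_
  simp [ridge]

/-- The smooth spherical harmonics of degree less than `n`. -/
def harmonicsBelow (n : ℕ) : Set smoothFun :=
  {φ | ∃ m : ℕ, m < n ∧ smoothLap φ = ((m * (m + 1) : ℝ) : ℂ) • (φ : S2 → ℂ)}

theorem harmonicsBelow_mono {m n : ℕ} (h : m ≤ n) : harmonicsBelow m ⊆ harmonicsBelow n :=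
  fun _ ⟨j, hj, e⟩ => ⟨j, hj.trans_le h, e⟩

/-- On the span of the harmonics of degree less than `n` the operator `B - n (n + 1)` is onto, as
it is diagonal there with nonzero entries `m (m + 1) - n (n + 1)`. -/
theorem exists_smoothLap_sub {n : ℕ} {χ : smoothFun}
    (h : χ ∈ Submodule.span ℂ (harmonicsBelow n)) :
    ∃ η ∈ Submodule.span ℂ (harmonicsBelow n),
      smoothLap η - ((n * (n + 1) : ℝ) : ℂ) • (η : S2 → ℂ) = χ := by
  induction h using Submodule.span_induction with
  | mem χ hχ =>
    obtain ⟨m, hm, e⟩ := hχ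
    have hne : ((m * (m + 1) : ℝ) : ℂ) - ((n * (n + 1) : ℝ) : ℂ) ≠ 0 := by
      rw [← Complex.ofReal_sub, Complex.ofReal_ne_zero]
      have : (m : ℝ) < n := by exact_mod_cast hm
      have hm0 : (0 : ℝ) ≤ m := m.cast_nonneg
      nlinarith
    refine ⟨(((m * (m + 1) : ℝ) : ℂ) - ((n * (n + 1) : ℝ) : ℂ))⁻¹ • χ,
      Submodule.smul_mem _ _ (Submodule.subset_span ⟨m, hm, e⟩), ?_⟩
    rw [map_smul, e, Submodule.coe_smul, smul_comm _ _ (χ : S2 → ℂ), ← sub_smul, smul_smul,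
      mul_inv_cancel₀ hne, one_smul]
  | zero => exact ⟨0, Submodule.zero_mem _, by rw [map_zero]; simp⟩
  | add χ χ' _ _ h h' =>
    obtain ⟨η, hη, e⟩ := h
    obtain ⟨η', hη', e'⟩ := h'
    refine ⟨η + η', Submodule.add_mem _ hη hη', ?_⟩
    rw [Submodule.coe_add, Submodule.coe_add, ← e, ← e', map_add, smul_add]
    abel
  | smul c χ _ h =>
    obtain ⟨η, hη, e⟩ := h
    refine ⟨c • η, Submodule.smul_mem _ c hη, ?_⟩
    rw [Submodule.coe_smul, Submodule.coe_smul, ← e, map_smul, smul_comm _ c, smul_sub]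

/-- Powers of linear forms are combinations of smooth spherical harmonics: `B - n (n + 1)` maps the
`n`-th power to a multiple of the power `n - 2`, so a correction of lower degree makes it harmonic.
-/
theorem ridge_mem_span (a : E3) (n : ℕ) :
    ridge a n ∈ Submodule.span ℂ (harmonicsBelow (n + 1)) := by
  induction n using Nat.strong_induction_on with
  | _ n ih =>
    have hlow : (n * (n - 1) * ‖a‖ ^ 2 : ℂ) • ridge a (n - 2) ∈
        Submodule.span ℂ (harmonicsBelow n) := by
      rcases n with - | - | n
      · simp
      · simp
      · refine Submodule.smul_mem _ _ (Submodule.span_mono (harmonicsBelow_mono ?_)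
          (ih n (by omega)))
        omega
    obtain ⟨η, hη, e⟩ := exists_smoothLap_sub hlow
    have h1 : ridge a n + η ∈ harmonicsBelow (n + 1) := by
      refine ⟨n, n.lt_succ_self, ?_⟩
      rw [map_add, smoothLap_ridge, ← sub_eq_zero, Submodule.coe_add, smul_add]
      rw [Submodule.coe_smul] at e
      rw [← e]
      abel
    have h2 := Submodule.sub_mem _ (Submodule.subset_span h1)
      (Submodule.span_mono (harmonicsBelow_mono n.le_succ) hη)
    simpa using h2

/-- The smooth eigenfunctions of the Laplace-Beltrami operator. -/
noncomputable def smoothEigen (l : ℝ) : Submodule ℂ smoothFun :=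
  LinearMap.ker (smoothLap - (l : ℂ) • smoothFun.subtype)

theorem mem_smoothEigen {l : ℝ} {φ : smoothFun} :
    φ ∈ smoothEigen l ↔ smoothLap φ = (l : ℂ) • (φ : S2 → ℂ) := by
  rw [smoothEigen, LinearMap.mem_ker, LinearMap.sub_apply, sub_eq_zero]
  rfl

/-- The exponential of a linear form. -/
noncomputable def expForm (a : E3) : C(S2, ℂ) :=
  ⟨fun θ => Complex.exp (linForm a θ), (smooth_linForm a).continuous.cexp⟩

/-- A power of a linear form, as a continuous function on the sphere. -/
noncomputable def ridgeC (a : E3) (n : ℕ) : C(S2, ℂ) :=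
  ⟨linForm a ^ n, ((smooth_linForm a).pow n).continuous⟩

/-- The linear combinations of smooth eigenfunctions, as a subspace of the continuous functions. -/
noncomputable def eigenCombs : Submodule ℂ C(S2, ℂ) :=
  ((⨆ l, smoothEigen l).map smoothFun.subtype).comap (ContinuousMap.coeFnLinearMap ℂ)

theorem hasSum_expForm (a : E3) :
    HasSum (fun n : ℕ => ((n.factorial : ℂ)⁻¹) • ridgeC a n) (expForm a) := by
  let u : C(S2, ℂ) := ⟨linForm a, (smooth_linForm a).continuous⟩
  have h := NormedSpace.exp_series_hasSum_exp' (𝕂 := ℂ) u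
  have e : NormedSpace.exp u = expForm a := by
    ext θ
    have h1 := ((ContinuousMap.evalCLM ℂ θ).hasSum h)
    have h2 := NormedSpace.exp_series_hasSum_exp' (𝕂 := ℂ) (u θ)
    rw [← Complex.exp_eq_exp_ℂ] at h2
    refine h1.unique (h2.congr_fun ?_)
    intro n
    simp [u]
  rw [← e]
  exact h

theorem expForm_mem_closure (a : E3) :
    expForm a ∈ eigenCombs.topologicalClosure := by
  refine (Submodule.isClosed_topologicalClosure _).mem_of_tendsto (hasSum_expForm a)
    (Eventually.of_forall fun s => Submodule.sum_mem _ fun n _ => Submodule.smul_mem _ _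
      (Submodule.le_topologicalClosure _ ⟨ridge a n, ?_, rfl⟩))
  refine Submodule.span_le.2 ?_ (ridge_mem_span a n)
  rintro φ ⟨m, -, e⟩
  exact Submodule.mem_iSup_of_mem (m * (m + 1) : ℝ) (mem_smoothEigen.2 e)

/-- The star algebra spanned by the exponentials of linear forms. -/
noncomputable def expAlgebra : StarSubalgebra ℂ C(S2, ℂ) where
  toSubalgebra := Algebra.adjoin ℂ (range expForm)
  star_mem' := by
    intro x hx
    have h : star x ∈ Algebra.adjoin ℂ (star (range expForm)) := by
      rw [← Subalgebra.star_adjoin_comm]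
      simpa using hx
    refine Algebra.adjoin_mono ?_ h
    rintro y ⟨a, ha⟩
    refine ⟨a, ?_⟩
    rw [← star_star y, ← ha]
    ext θ
    simp [expForm, linForm, ← Complex.exp_conj]

/-- Products of exponentials of linear forms are such exponentials, so the algebra is their span. -/
theorem expAlgebra_le_closure {x : C(S2, ℂ)} (hx : x ∈ expAlgebra) :
    x ∈ eigenCombs.topologicalClosure := by
  have h1 : x ∈ Submodule.span ℂ (Submonoid.closure (range expForm) : Set C(S2, ℂ)) := by
    rw [← Algebra.adjoin_eq_span]
    exact hx
  refine Submodule.span_le.2 ?_ h1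
  intro y hy
  have : y ∈ range expForm := by
    induction hy using Submonoid.closure_induction with
    | mem y hy => exact hy
    | one => exact ⟨0, by ext θ; simp [expForm, linForm]⟩
    | mul y z _ _ hy hz =>
      obtain ⟨a, rfl⟩ := hy
      obtain ⟨b, rfl⟩ := hz
      refine ⟨a + b, ?_⟩
      ext θ
      simp [expForm, linForm, inner_add_left, Complex.exp_add]
  obtain ⟨a, rfl⟩ := this
  exact expForm_mem_closure a

/-- Smooth eigenfunctions span a uniformly dense space of functions, by the Stone-Weierstrass
theorem for the algebra of exponentials of linear forms. -/
theorem topologicalClosure_smoothEigen :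
    eigenCombs.topologicalClosure = ⊤ := by
  have hsep : expAlgebra.SeparatesPoints := by
    intro θ η hne
    refine ⟨_, ⟨expForm ((θ : E3) - η), Algebra.subset_adjoin ⟨_, rfl⟩, rfl⟩, ?_⟩
    intro h
    simp only [expForm, linForm, ContinuousMap.coe_mk] at h
    rw [← Complex.ofReal_exp, ← Complex.ofReal_exp] at h
    have h2 := Real.exp_injective (Complex.ofReal_injective h)
    have h3 : ⟪(θ : E3) - η, (θ : E3) - η⟫_ℝ = 0 := by rw [inner_sub_right, h2, sub_self]
    exact hne (Subtype.ext (sub_eq_zero.1 (inner_self_eq_zero.1 h3)))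
  have htop := ContinuousMap.starSubalgebra_topologicalClosure_eq_top_of_separatesPoints _ hsep
  rw [eq_top_iff]
  intro x _
  have hx : x ∈ expAlgebra.topologicalClosure := by rw [htop]; trivial
  have hx' : x ∈ closure (expAlgebra : Set C(S2, ℂ)) := hx
  exact closure_minimal (fun y hy => expAlgebra_le_closure hy)
    (Submodule.isClosed_topologicalClosure _) hx'

end Density

/-! ### The spectral theorem for the Laplace-Beltrami operator -/

section LaplaceSpectrum

theorem memLp_of_continuous {u : S2 → ℂ} (hu : Continuous u) : MemLp u 2 surf :=
  hu.memLp_of_hasCompactSupport (HasCompactSupport.of_compactSpace _)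

/-- The class in `L²(Σ)` of a continuous function. -/
noncomputable def contL2 (u : S2 → ℂ) (hu : Continuous u) : L2S := (memLp_of_continuous hu).toLp

theorem coeFn_contL2 {u : S2 → ℂ} (hu : Continuous u) : contL2 u hu =ᵐ[surf] u :=
  MemLp.coeFn_toLp _

theorem inner_contL2 {u : S2 → ℂ} (hu : Continuous u) (f : L2S) :
    ⟪contL2 u hu, f⟫_ℂ = ∫ θ, starRingEnd ℂ (u θ) * f θ ∂surf := by
  rw [L2.inner_def]
  refine integral_congr_ae ?_
  filter_upwards [coeFn_contL2 hu] with θ hθ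
  rw [hθ, RCLike.inner_apply, mul_comm]

theorem inner_contL2_contL2 {u v : S2 → ℂ} (hu : Continuous u) (hv : Continuous v) :
    ⟪contL2 u hu, contL2 v hv⟫_ℂ = ∫ θ, starRingEnd ℂ (u θ) * v θ ∂surf := by
  rw [inner_contL2]
  refine integral_congr_ae ?_
  filter_upwards [coeFn_contL2 hv] with θ hθ
  rw [hθ]

/-- Smooth functions as elements of `L²(Σ)`. -/
noncomputable def smoothL2 : smoothFun →ₗ[ℂ] L2S where
  toFun := fun φ => contL2 φ φ.2.continuous
  map_add' := fun φ ψ => MemLp.toLp_add (memLp_of_continuous φ.2.continuous)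
    (memLp_of_continuous ψ.2.continuous)
  map_smul' := fun c φ => MemLp.toLp_const_smul c (memLp_of_continuous φ.2.continuous)

/-- The Laplace-Beltrami operator from smooth functions to `L²(Σ)`. -/
noncomputable def lapL2 : smoothFun →ₗ[ℂ] L2S where
  toFun := fun φ => contL2 (smoothLap φ) φ.2.continuous_sphLap
  map_add' := fun φ ψ => by
    simp only [map_add]
    exact MemLp.toLp_add (memLp_of_continuous φ.2.continuous_sphLap)
      (memLp_of_continuous ψ.2.continuous_sphLap)
  map_smul' := fun c φ => by
    simp only [map_smul]
    exact MemLp.toLp_const_smul c (memLp_of_continuous φ.2.continuous_sphLap)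

theorem isB_iff_inner {f g : L2S} :
    IsB f g ↔ ∀ φ : smoothFun, ⟪smoothL2 φ, g⟫_ℂ = ⟪lapL2 φ, f⟫_ℂ := by
  have e1 : ∀ φ : smoothFun, ⟪smoothL2 φ, g⟫_ℂ = ∫ θ, starRingEnd ℂ (φ.1 θ) * g θ ∂surf :=
    fun φ => inner_contL2 φ.2.continuous g
  have e2 : ∀ φ : smoothFun, ⟪lapL2 φ, f⟫_ℂ = ∫ θ, starRingEnd ℂ (sphLap φ.1 θ) * f θ ∂surf :=
    fun φ => inner_contL2 φ.2.continuous_sphLap f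
  simp only [e1, e2]
  constructor
  · intro h φ
    have := h _ φ.2.star
    simpa only [sphLap_star] using this
  · intro h φ hφ
    have := h ⟨_, hφ.star⟩
    simpa only [sphLap_star, Complex.conj_conj] using this

/-- Green's formula for functions of class `C²`: the pointwise Laplacian is the weak one. -/
theorem C2OnSphere.isB {u : S2 → ℂ} (hu : C2OnSphere u) :
    IsB (contL2 u hu.continuous) (contL2 (sphLap u) hu.continuous_sphLap) := by
  intro φ hφ
  have e1 : ∫ θ, φ θ * contL2 (sphLap u) hu.continuous_sphLap θ ∂surf =
      ∫ θ, φ θ * sphLap u θ ∂surf := by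
    refine integral_congr_ae ?_
    filter_upwards [coeFn_contL2 hu.continuous_sphLap] with θ hθ
    rw [hθ]
  have e2 : ∫ θ, sphLap φ θ * contL2 u hu.continuous θ ∂surf = ∫ θ, sphLap φ θ * u θ ∂surf := by
    refine integral_congr_ae ?_
    filter_upwards [coeFn_contL2 hu.continuous] with θ hθ
    rw [hθ]
  rw [e1, e2, integral_mul_sphLap hφ.c2 hu]

theorem isB_smoothL2 (φ : smoothFun) : IsB (smoothL2 φ) (lapL2 φ) := φ.2.c2.isB

theorem lapL2_of_mem_smoothEigen {l : ℝ} {φ : smoothFun} (h : φ ∈ smoothEigen l) :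
    lapL2 φ = (l : ℂ) • smoothL2 φ := by
  rw [← map_smul]
  have h1 := mem_smoothEigen.1 h
  refine Lp.ext ((coeFn_contL2 φ.2.continuous_sphLap).trans ?_)
  refine EventuallyEq.trans ?_ (coeFn_contL2 ((l : ℂ) • φ).2.continuous).symm
  rw [Submodule.coe_smul, ← h1]
  rfl

/-- The classes of smooth eigenfunctions are dense in `L²(Σ)`. -/
theorem topologicalClosure_smoothL2 :
    ⊤ ≤ (⨆ l, (smoothEigen l).map smoothL2).topologicalClosure := by
  rw [← Submodule.map_iSup]
  set F := ((⨆ l, smoothEigen l).map smoothL2).topologicalClosure with hF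
  have h1 : ∀ u : C(S2, ℂ), u ∈ eigenCombs → ContinuousMap.toLp 2 surf ℂ u ∈ F := by
    rintro u ⟨ψ, hψ, e⟩
    refine Submodule.le_topologicalClosure _ ⟨ψ, hψ, ?_⟩
    refine Lp.ext ?_
    refine (coeFn_contL2 ψ.2.continuous).trans ?_
    refine EventuallyEq.trans ?_ (ContinuousMap.coeFn_toLp surf u).symm
    have : (ψ : S2 → ℂ) = u := e
    rw [this]
  have h2 : ∀ u : C(S2, ℂ), ContinuousMap.toLp 2 surf ℂ u ∈ F := by
    intro u
    have hu : u ∈ closure (eigenCombs : Set C(S2, ℂ)) := by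
      have : u ∈ eigenCombs.topologicalClosure := by rw [topologicalClosure_smoothEigen]; trivial
      exact this
    have hcl : IsClosed (ContinuousMap.toLp 2 surf ℂ ⁻¹' (F : Set L2S)) :=
      (Submodule.isClosed_topologicalClosure _).preimage
        (ContinuousMap.toLp (E := ℂ) 2 surf ℂ).continuous
    exact closure_minimal (fun v hv => h1 v hv) hcl hu
  intro x _
  have hd := ContinuousMap.toLp_denseRange ℂ surf ℂ (p := 2) (by norm_num)
  refine closure_minimal ?_ (Submodule.isClosed_topologicalClosure _) (hd x)
  rintro _ ⟨u, rfl⟩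
  exact h2 u

/-- The closure in `L²(Σ)` of the space of smooth eigenfunctions. -/
noncomputable def smoothEigenspace (l : ℝ) : Submodule ℂ L2S :=
  ((smoothEigen l).map smoothL2).topologicalClosure

/-- An element with a weak Laplacian pairs with smooth eigenfunctions as expected. -/
theorem IsB.inner_smoothL2 {f g : L2S} (h : IsB f g) {l : ℝ} {φ : smoothFun}
    (hφ : φ ∈ smoothEigen l) : ⟪smoothL2 φ, g - (l : ℂ) • f⟫_ℂ = 0 := by
  rw [inner_sub_right, isB_iff_inner.1 h, lapL2_of_mem_smoothEigen hφ, inner_smul_left,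
    inner_smul_right, Complex.conj_ofReal, sub_self]

theorem IsB.sub_mem_orthogonal {f g : L2S} (h : IsB f g) (l : ℝ) :
    g - (l : ℂ) • f ∈ (smoothEigenspace l)ᗮ := by
  rw [smoothEigenspace, Submodule.orthogonal_closure]
  rintro _ ⟨φ, hφ, rfl⟩
  exact h.inner_smoothL2 hφ

/-- The weak Laplace-Beltrami operator is closed. -/
theorem IsB.of_tendsto {ι : Type*} {F : Filter ι} [F.NeBot] {f g : ι → L2S} {f₀ g₀ : L2S}
    (h : ∀ᶠ i in F, IsB (f i) (g i)) (hf : Tendsto f F (𝓝 f₀)) (hg : Tendsto g F (𝓝 g₀)) :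
    IsB f₀ g₀ := by
  rw [isB_iff_inner]
  intro φ
  have h1 : Tendsto (fun i => ⟪smoothL2 φ, g i⟫_ℂ) F (𝓝 ⟪smoothL2 φ, g₀⟫_ℂ) :=
    tendsto_const_nhds.inner hg
  have h2 : Tendsto (fun i => ⟪lapL2 φ, f i⟫_ℂ) F (𝓝 ⟪lapL2 φ, f₀⟫_ℂ) :=
    tendsto_const_nhds.inner hf
  refine tendsto_nhds_unique h1 (h2.congr' ?_)
  filter_upwards [h] with i hi
  exact (isB_iff_inner.1 hi φ).symm

theorem smoothEigenspace_le (l : ℝ) : smoothEigenspace l ≤ eigenB l := by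
  intro f hf
  obtain ⟨u, hu, hlim⟩ := mem_closure_iff_seq_limit.1 hf
  refine IsB.of_tendsto (Eventually.of_forall fun n => ?_) hlim (hlim.const_smul (l : ℂ))
  obtain ⟨φ, hφ, e⟩ := hu n
  rw [← e, ← lapL2_of_mem_smoothEigen hφ]
  exact isB_smoothL2 φ

theorem smoothEigenspace_orthogonal {l m : ℝ} (hlm : l ≠ m) {f : L2S} (hf : f ∈ eigenB m) :
    f ∈ (smoothEigenspace l)ᗮ := by
  have h : IsB f ((m : ℂ) • f) := hf
  have h1 := h.sub_mem_orthogonal l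
  rw [← sub_smul] at h1
  have hne : (m : ℂ) - l ≠ 0 := by
    rw [← Complex.ofReal_sub, Complex.ofReal_ne_zero]
    exact sub_ne_zero.2 hlm.symm
  have h2 := Submodule.smul_mem _ ((m : ℂ) - l)⁻¹ h1
  rwa [smul_smul, inv_mul_cancel₀ hne, one_smul] at h2

theorem isSpectralFamily_smoothEigenspace : IsSpectralFamily smoothEigenspace where
  isClosed := fun _ => Submodule.isClosed_topologicalClosure _
  orthogonal := fun _ m hlm x y =>
    smoothEigenspace_orthogonal hlm (smoothEigenspace_le m y.2) x x.2
  total := topologicalClosure_smoothL2.trans (Submodule.topologicalClosure_mono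
    (iSup_mono fun _ => Submodule.le_topologicalClosure _))

instance (l : ℝ) : (smoothEigenspace l).HasOrthogonalProjection := by
  unfold smoothEigenspace
  infer_instance

/-- A weak eigenfunction is orthogonal to all smooth eigenfunctions with other eigenvalues, and
these together with those of its own eigenvalue are total. -/
theorem eigenB_eq_smoothEigenspace (l : ℝ) : eigenB l = smoothEigenspace l := by
  refine le_antisymm (fun f hf => ?_) (smoothEigenspace_le l)
  have h : (smoothEigenspace l).starProjection f = f := by
    refine isSpectralFamily_smoothEigenspace.ext fun m => ?_
    by_cases hlm : m = l
    · subst hlm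
      exact Submodule.starProjection_eq_self_iff.2 (Submodule.starProjection_apply_mem _ _)
    · have h1 := smoothEigenspace_orthogonal hlm hf
      have h2 := smoothEigenspace_orthogonal hlm (smoothEigenspace_le l
        ((smoothEigenspace l).starProjection_apply_mem f))
      rw [(Submodule.starProjection_apply_eq_zero_iff _).2 h1,
        (Submodule.starProjection_apply_eq_zero_iff _).2 h2]
  rw [← h]
  exact Submodule.starProjection_apply_mem _ _

/-- The closed eigenspaces of the Laplace-Beltrami operator. -/
noncomputable abbrev eigB (l : ℝ) : Submodule ℂ L2S := (eigenB l).topologicalClosure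

theorem eigB_eq_smoothEigenspace : eigB = smoothEigenspace := by
  ext1 l
  rw [eigB, eigenB_eq_smoothEigenspace]
  exact (isSpectralFamily_smoothEigenspace.isClosed l).submodule_topologicalClosure_eq

/-- The Laplace-Beltrami operator on the sphere has pure point spectrum. -/
theorem isSpectralFamily_eigB : IsSpectralFamily eigB := by
  rw [eigB_eq_smoothEigenspace]
  exact isSpectralFamily_smoothEigenspace

/-- `B f = g` in the weak sense if and only if it holds on every eigenspace.  Thus the weak
operator is the self-adjoint one given by the spectral resolution. -/
theorem isB_iff {f g : L2S} : IsB f g ↔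
    ∀ l : ℝ, (eigB l).starProjection g = (l : ℂ) • (eigB l).starProjection f := by
  constructor
  · intro h l
    have h1 := h.sub_mem_orthogonal l
    rw [← eigB_eq_smoothEigenspace] at h1
    have h2 := (Submodule.starProjection_apply_eq_zero_iff _).2 h1
    rwa [map_sub, map_smul, sub_eq_zero] at h2
  · intro h
    have hS := isSpectralFamily_eigB
    have hf := hS.hasSum_starProjection f
    have hg := hS.hasSum_starProjection g
    refine IsB.of_tendsto (Eventually.of_forall fun s : Finset ℝ => ?_) hf hg
    induction s using Finset.cons_induction with
    | empty =>
      have h0 : IsB 0 (((0 : ℝ) : ℂ) • 0) := (eigenB 0).zero_mem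
      simpa using h0
    | cons l s hl ih =>
      rw [Finset.sum_cons, Finset.sum_cons]
      refine IsB.add ?_ ih
      rw [h l]
      have h1 : eigB l ≤ eigenB l := by
        rw [eigB_eq_smoothEigenspace]
        exact smoothEigenspace_le l
      exact h1 (Submodule.starProjection_apply_mem _ _)

end LaplaceSpectrum

/-! ### The Laplace-Beltrami operator as an unbounded operator -/

section Operator

theorem IsB.unique {f g g' : L2S} (h : IsB f g) (h' : IsB f g') : g = g' :=
  isSpectralFamily_eigB.ext fun l => (isB_iff.1 h l).trans (isB_iff.1 h' l).symm

theorem IsB.lapB_eq {f g : L2S} (h : IsB f g) : lapB f = g := by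
  have hex : ∃ g, IsB f g := ⟨g, h⟩
  rw [lapB, dif_pos hex]
  exact hex.choose_spec.unique h

theorem IsB.neg {f g : L2S} (h : IsB f g) : IsB (-f) (-g) := by
  simpa using h.smul (-1)

theorem IsB.sub {f g f' g' : L2S} (h : IsB f g) (h' : IsB f' g') : IsB (f - f') (g - g') := by
  simpa only [sub_eq_add_neg] using h.add h'.neg

theorem IsB.real_smul {f g : L2S} (c : ℝ) (h : IsB f g) : IsB (c • f) (c • g) := by
  simpa only [IsSpectralFamily.ofReal_smul] using h.smul (c : ℂ)

/-- The weak Laplace-Beltrami operator, being closed, may be differentiated along a curve. -/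
theorem IsB.of_hasDerivAt {u v : ℝ → L2S} {u' v' : L2S} {t : ℝ}
    (h : ∀ᶠ r in 𝓝 t, IsB (u r) (v r)) (hu : HasDerivAt u u' t) (hv : HasDerivAt v v' t) :
    IsB u' v' := by
  refine IsB.of_tendsto ?_ (hasDerivAt_iff_tendsto_slope.1 hu) (hasDerivAt_iff_tendsto_slope.1 hv)
  filter_upwards [nhdsWithin_le_nhds h] with r hr
  rw [slope_def_module, slope_def_module]
  exact (hr.sub h.self_of_nhds).real_smul _

theorem hasSum_inner_eigB (f g : L2S) :
    HasSum (fun l : ℝ => ⟪(eigB l).starProjection f, (eigB l).starProjection g⟫_ℂ) ⟪f, g⟫_ℂ := by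
  have h := (innerSL ℂ f).hasSum (isSpectralFamily_eigB.hasSum_starProjection g)
  refine h.congr_fun fun l => ?_
  rw [innerSL_apply_apply, Submodule.inner_starProjection_left_eq_right,
    Submodule.starProjection_eq_self_iff.2 (Submodule.starProjection_apply_mem _ _)]

/-- The Laplace-Beltrami operator is symmetric: its quadratic form is real. -/
theorem IsB.inner_im_eq_zero {f g : L2S} (h : IsB f g) : (⟪f, g⟫_ℂ).im = 0 := by
  have h1 := Complex.imCLM.hasSum (hasSum_inner_eigB f g)
  refine h1.unique ?_
  refine hasSum_zero.congr_fun fun l => ?_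
  rw [isB_iff.1 h l, inner_smul_right, inner_self_eq_norm_sq_to_K, Complex.imCLM_apply]
  norm_cast
  rw [← Complex.coe_algebraMap, ← map_mul]
  exact Complex.ofReal_im _

/-- Smooth functions form a core of the Laplace-Beltrami operator. -/
theorem IsB.exists_seq_smooth {f g : L2S} (h : IsB f g) : ∃ φ : ℕ → smoothFun,
    Tendsto (fun n => smoothL2 (φ n)) atTop (𝓝 f) ∧
    Tendsto (fun n => lapL2 (φ n)) atTop (𝓝 g) := by
  let S : Submodule ℂ (L2S × L2S) := (LinearMap.range (smoothL2.prod lapL2)).topologicalClosure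
  have h1 : ∀ l : ℝ, ∀ x ∈ eigB l, (x, (l : ℂ) • x) ∈ S := by
    intro l x hx
    rw [eigB_eq_smoothEigenspace] at hx
    obtain ⟨u, hu, hlim⟩ := mem_closure_iff_seq_limit.1 hx
    refine (Submodule.isClosed_topologicalClosure _).mem_of_tendsto
      (hlim.prodMk_nhds (hlim.const_smul (l : ℂ))) (Eventually.of_forall fun n => ?_)
    obtain ⟨φ, hφ, e⟩ := hu n
    refine Submodule.le_topologicalClosure _ ⟨φ, ?_⟩
    rw [← e, ← lapL2_of_mem_smoothEigen hφ]
    rfl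
  have hf := isSpectralFamily_eigB.hasSum_starProjection f
  have hg := isSpectralFamily_eigB.hasSum_starProjection g
  have hfg : (f, g) ∈ S := by
    refine (Submodule.isClosed_topologicalClosure _).mem_of_tendsto (hf.prodMk hg)
      (Eventually.of_forall fun s => Submodule.sum_mem _ fun l _ => ?_)
    rw [isB_iff.1 h l]
    exact h1 l _ (Submodule.starProjection_apply_mem _ _)
  obtain ⟨u, hu, hlim⟩ := mem_closure_iff_seq_limit.1 hfg
  choose φ hφ using hu
  have e : u = fun n => (smoothL2 (φ n), lapL2 (φ n)) := funext fun n => (hφ n).symm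
  rw [e] at hlim
  exact ⟨φ, (continuous_fst.tendsto _).comp hlim, (continuous_snd.tendsto _).comp hlim⟩

theorem norm_contL2_le {u w : S2 → ℂ} (hu : Continuous u) (hw : Continuous w) {M : ℝ}
    (h : ∀ θ, ‖u θ‖ ≤ M * ‖w θ‖) : ‖contL2 u hu‖ ≤ M * ‖contL2 w hw‖ := by
  refine Lp.norm_le_mul_norm_of_ae_le_mul ?_
  filter_upwards [coeFn_contL2 hu, coeFn_contL2 hw] with θ h1 h2
  rw [h1, h2]
  exact h θ

/-- The derivative of the radial extension in a coordinate direction. -/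
noncomputable def pderiv (φ : S2 → ℂ) (i : Fin 3) (θ : S2) : ℂ := fderiv ℝ (radialExt φ) θ (stdB i)

theorem C2OnSphere.continuous_pderiv {φ : S2 → ℂ} (h : C2OnSphere φ) (i : Fin 3) :
    Continuous (pderiv φ i) :=
  (h.continuousOn_fderiv.comp_continuous continuous_subtype_val coe_ne_zero).clm_apply
    continuous_const

theorem pderiv_star {φ : S2 → ℂ} (i : Fin 3) (θ : S2) :
    pderiv (fun θ => starRingEnd ℂ (φ θ)) i θ = starRingEnd ℂ (pderiv φ i θ) := by
  have e : radialExt (fun θ => starRingEnd ℂ (φ θ)) = Complex.conjCLE ∘ radialExt φ := rfl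
  rw [pderiv, e, ContinuousLinearEquiv.comp_fderiv]
  rfl

/-- The Dirichlet form: by the product rule `B |φ|² = 2 Re (conj φ Bφ) - 2 |∇φ|²`, and the integral
of `B |φ|²` over the sphere vanishes. -/
theorem sum_norm_pderiv_sq (φ : smoothFun) :
    ∑ i, ‖contL2 (pderiv φ i) (φ.2.c2.continuous_pderiv i)‖ ^ 2 = (⟪smoothL2 φ, lapL2 φ⟫_ℂ).re := by
  have h := φ.2.c2
  have hs := h.star
  have hint : ∀ {u : S2 → ℂ}, Continuous u → Integrable u surf := fun hu =>
    hu.integrable_of_hasCompactSupport (HasCompactSupport.of_compactSpace _)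
  have e1 : ∫ θ, sphLap (φ.1 * fun θ => starRingEnd ℂ (φ.1 θ)) θ ∂surf = 0 := by
    have := integral_mul_sphLap (φ := fun _ => 1) (SmoothOnSphere.const 1).c2 (h.mul hs)
    simpa [sphLap_const] using this
  have e2 : ∀ θ, sphLap (φ.1 * fun θ => starRingEnd ℂ (φ.1 θ)) θ =
      (φ.1 θ * starRingEnd ℂ (sphLap φ.1 θ) + starRingEnd ℂ (φ.1 θ) * sphLap φ.1 θ) -
      2 * ∑ i, pderiv φ i θ * starRingEnd ℂ (pderiv φ i θ) := by
    intro θ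
    rw [sphLap_mul h hs, sphLap_star]
    congr 2
    refine Finset.sum_congr rfl fun i _ => ?_
    rw [← pderiv_star]
    rfl
  have c1 : Integrable (fun θ => φ.1 θ * starRingEnd ℂ (sphLap φ.1 θ)) surf :=
    hint (h.continuous.mul (Complex.continuous_conj.comp h.continuous_sphLap))
  have c2 : Integrable (fun θ => starRingEnd ℂ (φ.1 θ) * sphLap φ.1 θ) surf :=
    hint ((Complex.continuous_conj.comp h.continuous).mul h.continuous_sphLap)
  have c3 : ∀ i, Integrable (fun θ => pderiv φ i θ * starRingEnd ℂ (pderiv φ i θ)) surf := fun i =>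
    hint ((h.continuous_pderiv i).mul (Complex.continuous_conj.comp (h.continuous_pderiv i)))
  have i1 : ⟪smoothL2 φ, lapL2 φ⟫_ℂ = ∫ θ, starRingEnd ℂ (φ.1 θ) * sphLap φ.1 θ ∂surf :=
    inner_contL2_contL2 h.continuous h.continuous_sphLap
  have i2 : ⟪lapL2 φ, smoothL2 φ⟫_ℂ = ∫ θ, φ.1 θ * starRingEnd ℂ (sphLap φ.1 θ) ∂surf := by
    simp only [mul_comm (φ.1 _)]
    exact inner_contL2_contL2 h.continuous_sphLap h.continuous
  have i3 : ∀ i, ((‖contL2 (pderiv φ i) (φ.2.c2.continuous_pderiv i)‖ ^ 2 : ℝ) : ℂ) =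
      ∫ θ, pderiv φ i θ * starRingEnd ℂ (pderiv φ i θ) ∂surf := by
    intro i
    have := inner_self_eq_norm_sq_to_K (𝕜 := ℂ) (contL2 (pderiv φ i) (φ.2.c2.continuous_pderiv i))
    rw [inner_contL2_contL2] at this
    simp only [mul_comm (pderiv _ _ _)]
    rw [this]
    norm_cast
  simp only [e2] at e1
  have c12 : Integrable (fun θ => φ.1 θ * starRingEnd ℂ (sphLap φ.1 θ) +
    starRingEnd ℂ (φ.1 θ) * sphLap φ.1 θ) surf := c1.add c2
  have c4 := (integrable_finsetSum Finset.univ fun i _ => c3 i).const_mul 2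
  rw [integral_sub c12 c4,
    integral_add c1 c2, integral_const_mul, integral_finsetSum _ fun i _ => c3 i, ← i1, ← i2] at e1
  simp only [← i3] at e1
  rw [← inner_conj_symm, ← Complex.ofReal_sum, add_comm, Complex.add_conj] at e1
  have e3 : (2 * (⟪smoothL2 φ, lapL2 φ⟫_ℂ).re - 2 *
      ∑ i, ‖contL2 (pderiv φ i) (φ.2.c2.continuous_pderiv i)‖ ^ 2) = 0 := by exact_mod_cast e1
  linarith

/-- The Laplace-Beltrami operator is nonnegative. -/
theorem IsB.inner_re_nonneg {f g : L2S} (h : IsB f g) : 0 ≤ (⟪f, g⟫_ℂ).re := by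
  obtain ⟨φ, hf, hg⟩ := h.exists_seq_smooth
  have h1 := (Complex.continuous_re.tendsto _).comp (hf.inner hg (𝕜 := ℂ))
  refine ge_of_tendsto' h1 fun n => ?_
  simp only [Function.comp_apply]
  rw [← sum_norm_pderiv_sq]
  positivity

theorem nonneg_of_starProjection_ne_zero {l : ℝ} {f : L2S}
    (h : (eigB l).starProjection f ≠ 0) : 0 ≤ l := by
  have h1 : (eigB l).starProjection f ∈ eigenB l := by
    have : eigB l ≤ eigenB l := by
      rw [eigB_eq_smoothEigenspace]
      exact smoothEigenspace_le l
    exact this (Submodule.starProjection_apply_mem _ _)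
  have h2 : IsB ((eigB l).starProjection f) ((l : ℂ) • (eigB l).starProjection f) := h1
  have h3 := h2.inner_re_nonneg
  rw [inner_smul_right, inner_self_eq_norm_sq_to_K] at h3
  have h4 : 0 ≤ l * ‖(eigB l).starProjection f‖ ^ 2 := by
    rw [← RCLike.ofReal_pow] at h3
    rw [Complex.re_ofReal_mul] at h3
    exact h3
  have h5 : 0 < ‖(eigB l).starProjection f‖ ^ 2 := by positivity
  nlinarith

theorem norm_le_of_starProjection {f g : L2S}
    (h : ∀ l, ‖(eigB l).starProjection f‖ ≤ ‖(eigB l).starProjection g‖) : ‖f‖ ≤ ‖g‖ := by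
  have hS := isSpectralFamily_eigB
  have h1 := hS.hasSum_norm_sq (fun l => Submodule.starProjection_apply_mem _ _)
    (hS.hasSum_starProjection f)
  have h2 := hS.hasSum_norm_sq (fun l => Submodule.starProjection_apply_mem _ _)
    (hS.hasSum_starProjection g)
  exact le_of_sq_le_sq (hasSum_le (fun l => by gcongr; exact h l) h1 h2) (norm_nonneg _)

/-- The norm of `H⁴(Σ)` controls `f`, `B f` and `B² f`: on each eigenspace `1`, `l` and `l²` are at
most `(1 + l)²`, since `l ≥ 0`. -/
theorem norm_le_normH4 {f g h : L2S} (hf : IsB f g) (hg : IsB g h) :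
    ‖f‖ ≤ normH4 f ∧ ‖g‖ ≤ normH4 f ∧ ‖h‖ ≤ normH4 f := by
  rw [normH4, hf.lapB_eq, hg.lapB_eq]
  have e : ∀ l : ℝ, (eigB l).starProjection (f + (2 : ℂ) • g + h) =
      (((1 + l) ^ 2 : ℝ) : ℂ) • (eigB l).starProjection f := by
    intro l
    rw [map_add, map_add, map_smul, isB_iff.1 hg, isB_iff.1 hf]
    push_cast
    module
  have key : ∀ c : ℝ → ℝ, (∀ l, 0 ≤ l → |c l| ≤ (1 + l) ^ 2) → ∀ u : L2S,
      (∀ l, (eigB l).starProjection u = (c l : ℂ) • (eigB l).starProjection f) →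
      ‖u‖ ≤ ‖f + (2 : ℂ) • g + h‖ := by
    intro c hc u hu
    refine norm_le_of_starProjection fun l => ?_
    rw [hu, e, norm_smul, norm_smul]
    by_cases h0 : (eigB l).starProjection f = 0
    · simp [h0]
    · refine mul_le_mul_of_nonneg_right ?_ (norm_nonneg _)
      rw [Complex.norm_real, Complex.norm_real, Real.norm_eq_abs, Real.norm_eq_abs]
      exact (hc l (nonneg_of_starProjection_ne_zero h0)).trans (le_abs_self _)
  refine ⟨key (fun _ => 1) (fun l hl => ?_) f (fun l => by simp),
    key (fun l => l) (fun l hl => ?_) g (isB_iff.1 hf),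
    key (fun l => l * l) (fun l hl => ?_) h (fun l => ?_)⟩
  · rw [abs_one]; nlinarith
  · rw [abs_of_nonneg hl]; nlinarith
  · rw [abs_of_nonneg (mul_nonneg hl hl)]; nlinarith
  · rw [isB_iff.1 hg, isB_iff.1 hf, smul_smul, Complex.ofReal_mul]

end Operator

/-! ### Multiplication by functions of class C² -/

section Multiplication

theorem memLp_mul {v : S2 → ℝ} (hv : Continuous v) (f : L2S) :
    MemLp (fun θ => (v θ : ℂ) * f θ) 2 surf := by
  obtain ⟨C, hC⟩ := (isCompact_univ (X := S2)).exists_bound_of_continuousOn hv.continuousOn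
  refine (Lp.memLp f).of_le_mul (c := C) ?_ (ae_of_all _ fun θ => ?_)
  · exact (Complex.continuous_ofReal.comp hv).aestronglyMeasurable.mul (Lp.aestronglyMeasurable f)
  · rw [norm_mul, Complex.norm_real]
    exact mul_le_mul_of_nonneg_right (hC θ (mem_univ θ)) (norm_nonneg _)

theorem coeFn_mulL2 {v : S2 → ℝ} (hv : Continuous v) (f : L2S) :
    mulL2 v f =ᵐ[surf] fun θ => (v θ : ℂ) * f θ := by
  rw [mulL2, dif_pos (memLp_mul hv f)]
  exact MemLp.coeFn_toLp _

theorem norm_mulL2_le {v : S2 → ℝ} (hv : Continuous v) {M : ℝ} (hM : ∀ θ, |v θ| ≤ M) (f : L2S) :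
    ‖mulL2 v f‖ ≤ M * ‖f‖ := by
  refine Lp.norm_le_mul_norm_of_ae_le_mul ?_
  filter_upwards [coeFn_mulL2 hv f] with θ h1
  rw [h1, norm_mul, Complex.norm_real]
  exact mul_le_mul_of_nonneg_right (hM θ) (norm_nonneg _)

theorem mulL2_contL2 {v : S2 → ℝ} (hv : Continuous v) {u w : S2 → ℂ} (hu : Continuous u)
    (hw : Continuous w) (h : ∀ θ, w θ = v θ * u θ) : mulL2 v (contL2 u hu) = contL2 w hw := by
  refine Lp.ext ?_
  filter_upwards [coeFn_mulL2 hv (contL2 u hu), coeFn_contL2 hu, coeFn_contL2 hw] with θ h1 h2 h3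
  rw [h1, h2, h3, h]

/-- Multiplication of elements of `L²(Σ)` by real continuous functions. -/
noncomputable def mulOp : C(S2, ℝ) →L[ℝ] L2S →L[ℝ] L2S :=
  LinearMap.mkContinuous₂
    (LinearMap.mk₂ ℝ (fun (v : C(S2, ℝ)) (f : L2S) => mulL2 v f)
      (fun v w f => by
        refine Lp.ext ?_
        filter_upwards [coeFn_mulL2 (v + w).continuous f, coeFn_mulL2 v.continuous f,
          coeFn_mulL2 w.continuous f, Lp.coeFn_add (mulL2 v f) (mulL2 w f)] with θ h1 h2 h3 h4
        rw [h1, h4, Pi.add_apply, h2, h3, ContinuousMap.add_apply, Complex.ofReal_add, add_mul])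
      (fun c v f => by
        refine Lp.ext ?_
        filter_upwards [coeFn_mulL2 (c • v).continuous f, coeFn_mulL2 v.continuous f,
          Lp.coeFn_smul c (mulL2 v f)] with θ h1 h2 h3
        rw [h1, h3, Pi.smul_apply, h2, ContinuousMap.smul_apply, smul_eq_mul, Complex.ofReal_mul,
          Complex.real_smul, mul_assoc])
      (fun v f g => by
        refine Lp.ext ?_
        filter_upwards [coeFn_mulL2 v.continuous (f + g), coeFn_mulL2 v.continuous f,
          coeFn_mulL2 v.continuous g, Lp.coeFn_add (mulL2 v f) (mulL2 v g),
          Lp.coeFn_add f g] with θ h1 h2 h3 h4 h5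
        rw [h1, h4, Pi.add_apply, h2, h3, h5, Pi.add_apply, mul_add])
      (fun c v f => by
        refine Lp.ext ?_
        filter_upwards [coeFn_mulL2 v.continuous (c • f), coeFn_mulL2 v.continuous f,
          Lp.coeFn_smul c (mulL2 v f), Lp.coeFn_smul c f] with θ h1 h2 h3 h4
        rw [h1, h3, Pi.smul_apply, h2, h4, Pi.smul_apply, mul_smul_comm]))
    1 fun v f => by
      rw [one_mul]
      exact norm_mulL2_le v.continuous (fun θ => v.norm_coe_le_norm θ) f

theorem mulOp_apply (v : C(S2, ℝ)) (f : L2S) : mulOp v f = mulL2 v f := rfl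

theorem norm_mulOp_le (v : C(S2, ℝ)) {M : ℝ} (hM : ∀ θ, |v θ| ≤ M) (f : L2S) :
    ‖mulOp v f‖ ≤ M * ‖f‖ := norm_mulL2_le v.continuous hM f

theorem inner_mulOp_im (v : C(S2, ℝ)) (f : L2S) : (⟪f, mulOp v f⟫_ℂ).im = 0 := by
  have h : ⟪f, mulOp v f⟫_ℂ = ⟪mulOp v f, f⟫_ℂ := by
    rw [L2.inner_def, L2.inner_def]
    refine integral_congr_ae ?_
    filter_upwards [coeFn_mulL2 v.continuous f] with θ h1
    rw [mulOp_apply, h1, RCLike.inner_apply, RCLike.inner_apply, map_mul, Complex.conj_ofReal]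
    ring
  rw [← inner_conj_symm] at h
  have := congrArg Complex.im h
  rw [Complex.conj_im] at this
  rw [← inner_conj_symm, Complex.conj_im]
  linarith

end Multiplication

section Product

variable {v : S2 → ℝ}

theorem C2OnSphere.ofReal (hv : ContDiffOn ℝ 2 (radialExt v) {0}ᶜ) :
    C2OnSphere fun θ => (v θ : ℂ) :=
  (Complex.ofRealCLM.contDiff (n := 2)).comp_contDiffOn hv

theorem C2Bound.norm_iteratedFDeriv {M : ℝ} (hv : ContDiffOn ℝ 2 (radialExt v) {0}ᶜ)
    (hM : C2Bound M v) {j : ℕ} (hj : j ≤ 2) (θ : S2) :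
    ‖iteratedFDeriv ℝ j (radialExt fun θ => (v θ : ℂ)) (θ : E3)‖ ≤ M := by
  have h := hM j hj θ
  have hc : ContDiffAt ℝ 2 (radialExt v) θ :=
    hv.contDiffAt (isOpen_compl_singleton.mem_nhds (coe_ne_zero θ))
  rwa [← Complex.ofRealLI.norm_iteratedFDeriv_comp_left hc (by exact_mod_cast hj)] at h

theorem C2Bound.abs_le {M : ℝ} (hM : C2Bound M v) (θ : S2) : |v θ| ≤ M := by
  have := hM 0 (by norm_num) θ
  rwa [norm_iteratedFDeriv_zero, radialExt, dir_coe] at this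

theorem C2Bound.norm_pderiv_le {M : ℝ} (hv : ContDiffOn ℝ 2 (radialExt v) {0}ᶜ)
    (hM : C2Bound M v) (i : Fin 3) (θ : S2) : ‖pderiv (fun θ => (v θ : ℂ)) i θ‖ ≤ M := by
  have h := hM.norm_iteratedFDeriv hv (j := 1) (by norm_num) θ
  rw [norm_iteratedFDeriv_one] at h
  refine (ContinuousLinearMap.le_opNorm _ _).trans ?_
  rw [stdB.norm_eq_one, mul_one]
  exact h

theorem C2Bound.norm_sphLap_le {M : ℝ} (hv : ContDiffOn ℝ 2 (radialExt v) {0}ᶜ)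
    (hM : C2Bound M v) (θ : S2) : ‖sphLap (fun θ => (v θ : ℂ)) θ‖ ≤ 3 * M := by
  have h := hM.norm_iteratedFDeriv hv (j := 2) le_rfl θ
  rw [sphLap, norm_neg, InnerProductSpace.laplacian_eq_iteratedFDeriv_orthonormalBasis _ stdB]
  refine (norm_sum_le_of_le (n := fun _ => M) _ fun i _ => ?_).trans (by simp)
  refine (ContinuousMultilinearMap.le_opNorm _ _).trans ?_
  rw [Fin.prod_univ_two]
  simpa using h

/-- Multiplication by a function of class `C²` is bounded in the graph norm of `B`, on the core: the
product rule has terms of order zero, one and two in `φ`, and the Dirichlet form bounds the one of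
order one. -/
theorem norm_sphLap_mul_le {M : ℝ} (hv : ContDiffOn ℝ 2 (radialExt v) {0}ᶜ) (hM : C2Bound M v)
    (φ : smoothFun) : ‖contL2 (sphLap ((fun θ => (v θ : ℂ)) * φ.1))
      ((C2OnSphere.ofReal hv).mul φ.2.c2).continuous_sphLap‖ ≤
      10 * M * (‖smoothL2 φ‖ + ‖lapL2 φ‖) := by
  set w : S2 → ℂ := fun θ => (v θ : ℂ) with hw
  have hwc : C2OnSphere w := C2OnSphere.ofReal hv
  have hφ := φ.2.c2
  have hM0 : 0 ≤ M := (abs_nonneg _).trans (hM.abs_le ⟨EuclideanSpace.single 0 1, by simp⟩)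
  have c1 : Continuous (w * sphLap φ.1) := hwc.continuous.mul hφ.continuous_sphLap
  have c2 : Continuous (φ.1 * sphLap w) := hφ.continuous.mul hwc.continuous_sphLap
  have c3 : ∀ i, Continuous (pderiv w i * pderiv φ.1 i) := fun i =>
    (hwc.continuous_pderiv i).mul (hφ.continuous_pderiv i)
  have e : contL2 (sphLap (w * φ.1)) (hwc.mul hφ).continuous_sphLap =
      contL2 _ c1 + contL2 _ c2 - (2 : ℂ) • ∑ i, contL2 _ (c3 i) := by
    refine Lp.ext ?_
    rw [Fin.sum_univ_three]
    filter_upwards [coeFn_contL2 (hwc.mul hφ).continuous_sphLap, coeFn_contL2 c1, coeFn_contL2 c2,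
      coeFn_contL2 (c3 0), coeFn_contL2 (c3 1), coeFn_contL2 (c3 2),
      Lp.coeFn_sub (contL2 _ c1 + contL2 _ c2)
        ((2 : ℂ) • (contL2 _ (c3 0) + contL2 _ (c3 1) + contL2 _ (c3 2))),
      Lp.coeFn_add (contL2 _ c1) (contL2 _ c2),
      Lp.coeFn_smul (2 : ℂ) (contL2 _ (c3 0) + contL2 _ (c3 1) + contL2 _ (c3 2)),
      Lp.coeFn_add (contL2 _ (c3 0) + contL2 _ (c3 1)) (contL2 _ (c3 2)),
      Lp.coeFn_add (contL2 _ (c3 0)) (contL2 _ (c3 1))] with θ h1 h2 h3 h4 h5 h6 h7 h8 h9 h10 h11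
    rw [h1, h7, Pi.sub_apply, h8, h9, Pi.add_apply, Pi.smul_apply, h10, Pi.add_apply, h11,
      Pi.add_apply, h2, h3, h4, h5, h6, sphLap_mul hwc hφ, gradMul, Fin.sum_univ_three]
    rfl
  have b1 : ‖contL2 _ c1‖ ≤ M * ‖lapL2 φ‖ := norm_contL2_le c1 φ.2.continuous_sphLap fun θ => by
    rw [Pi.mul_apply, norm_mul, hw, Complex.norm_real]
    exact mul_le_mul_of_nonneg_right (hM.abs_le θ) (norm_nonneg _)
  have b2 : ‖contL2 _ c2‖ ≤ 3 * M * ‖smoothL2 φ‖ := norm_contL2_le c2 φ.2.continuous fun θ => by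
    rw [Pi.mul_apply, norm_mul, mul_comm]
    exact mul_le_mul_of_nonneg_right (hM.norm_sphLap_le hv θ) (norm_nonneg _)
  have b3 : ∀ i, ‖contL2 _ (c3 i)‖ ≤ M * (‖smoothL2 φ‖ + ‖lapL2 φ‖) := fun i => by
    refine (norm_contL2_le (c3 i) (hφ.continuous_pderiv i) fun θ => ?_).trans
      (mul_le_mul_of_nonneg_left ?_ hM0)
    · rw [Pi.mul_apply, norm_mul]
      exact mul_le_mul_of_nonneg_right (hM.norm_pderiv_le hv i θ) (norm_nonneg _)
    · have h1 := sum_norm_pderiv_sq φ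
      have h2 := Finset.single_le_sum (f := fun i => ‖contL2 (pderiv φ.1 i)
        (φ.2.c2.continuous_pderiv i)‖ ^ 2) (fun i _ => by positivity) (Finset.mem_univ i)
      have h3 : (⟪smoothL2 φ, lapL2 φ⟫_ℂ).re ≤ ‖smoothL2 φ‖ * ‖lapL2 φ‖ :=
        (Complex.re_le_norm _).trans (norm_inner_le_norm _ _)
      refine le_of_sq_le_sq ?_ (by positivity)
      nlinarith [norm_nonneg (smoothL2 φ), norm_nonneg (lapL2 φ)]
  rw [e]
  refine (norm_sub_le _ _).trans ?_
  have b4 := norm_add_le (contL2 _ c1) (contL2 _ c2)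
  have b5 : ‖(2 : ℂ) • ∑ i, contL2 _ (c3 i)‖ ≤ 2 * (3 * (M * (‖smoothL2 φ‖ + ‖lapL2 φ‖))) := by
    rw [norm_smul, Complex.norm_two]
    refine mul_le_mul_of_nonneg_left ?_ zero_le_two
    exact (norm_sum_le_of_le (n := fun _ => M * (‖smoothL2 φ‖ + ‖lapL2 φ‖)) _
      fun i _ => b3 i).trans (by simp)
  have h6 := mul_nonneg hM0 (norm_nonneg (smoothL2 φ))
  have h7 := mul_nonneg hM0 (norm_nonneg (lapL2 φ))
  linarith

/-- Multiplication by a function of class `C²` preserves the domain of `B`: approximate by the core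
and use that `B` is closed. -/
theorem IsB.mulL2 {M : ℝ} (hv : ContDiffOn ℝ 2 (radialExt v) {0}ᶜ) (hM : C2Bound M v)
    {f g : L2S} (h : IsB f g) :
    ∃ g', IsB (mulL2 v f) g' ∧ ‖g'‖ ≤ 10 * M * (‖f‖ + ‖g‖) := by
  obtain ⟨φ, hf, hg⟩ := h.exists_seq_smooth
  set w : S2 → ℂ := fun θ => (v θ : ℂ) with hw
  have hwc : C2OnSphere w := C2OnSphere.ofReal hv
  have hvc : Continuous v := by
    have := Complex.continuous_re.comp hwc.continuous
    exact this
  let u : smoothFun → L2S := fun φ => contL2 (sphLap (w * φ.1))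
    (hwc.mul φ.2.c2).continuous_sphLap
  have hu : ∀ φ, ‖u φ‖ ≤ 10 * M * (‖smoothL2 φ‖ + ‖lapL2 φ‖) := norm_sphLap_mul_le hv hM
  have husub : ∀ φ ψ, u φ - u ψ = u (φ - ψ) := by
    intro φ ψ
    rw [sub_eq_iff_eq_add]
    refine Lp.ext ?_
    filter_upwards [coeFn_contL2 (hwc.mul φ.2.c2).continuous_sphLap,
      coeFn_contL2 (hwc.mul (φ - ψ).2.c2).continuous_sphLap,
      coeFn_contL2 (hwc.mul ψ.2.c2).continuous_sphLap,
      Lp.coeFn_add (u (φ - ψ)) (u ψ)] with θ h1 h2 h3 h4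
    rw [h1, h4, Pi.add_apply, h2, h3, ← sphLap_add (hwc.mul (φ - ψ).2.c2) (hwc.mul ψ.2.c2),
      ← mul_add, ← Submodule.coe_add, sub_add_cancel]
  have hc : CauchySeq fun n => u (φ n) := by
    have h1 : Tendsto (fun p : ℕ × ℕ => 10 * M * (‖smoothL2 (φ p.1) - smoothL2 (φ p.2)‖ +
        ‖lapL2 (φ p.1) - lapL2 (φ p.2)‖)) atTop (𝓝 0) := by
      have a1 := cauchySeq_iff_tendsto_dist_atTop_0.1 hf.cauchySeq
      have a2 := cauchySeq_iff_tendsto_dist_atTop_0.1 hg.cauchySeq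
      simp only [dist_eq_norm] at a1 a2
      simpa using (a1.add a2).const_mul (10 * M)
    rw [cauchySeq_iff_tendsto_dist_atTop_0]
    refine squeeze_zero (fun _ => dist_nonneg) (fun p => ?_) h1
    rw [dist_eq_norm, husub, ← map_sub, ← map_sub]
    exact hu _
  obtain ⟨g', hg'⟩ := cauchySeq_tendsto_of_complete hc
  refine ⟨g', ?_, ?_⟩
  · refine IsB.of_tendsto (f := fun n => SphereEvolution.mulL2 v (smoothL2 (φ n)))
      (Eventually.of_forall fun n => ?_) ?_ hg'
    · have := (hwc.mul (φ n).2.c2).isB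
      rwa [← mulL2_contL2 (w := w * (φ n).1) hvc (φ n).2.continuous _ fun θ => rfl] at this
    · exact ((mulOp ⟨v, hvc⟩).continuous.tendsto f).comp hf
  · exact le_of_tendsto_of_tendsto' hg'.norm ((hf.norm.add hg.norm).const_mul (10 * M))
      fun n => hu _

end Product

/-! ### The potential in the variable `t = 1 - 1 / τ` -/

section Potential

/-- The set `[1, ∞) × (ℝ³ \ {0})`. -/
abbrev timeDom : Set (ℝ × E3) := Ici 1 ×ˢ {0}ᶜ

theorem uniqueDiffOn_timeDom : UniqueDiffOn ℝ timeDom :=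
  (uniqueDiffOn_Ici 1).prod isOpen_compl_singleton.uniqueDiffOn

theorem hasDerivWithinAt_fst {G : ℝ × E3 → ℝ} (hG : DifferentiableOn ℝ G timeDom) {τ : ℝ}
    (hτ : 1 ≤ τ) (θ : S2) :
    HasDerivWithinAt (fun t => G (t, θ)) (fderivWithin ℝ G timeDom (τ, θ) (1, 0)) (Ici 1) τ := by
  have h1 : HasFDerivWithinAt G (fderivWithin ℝ G timeDom (τ, θ)) timeDom (τ, θ) :=
    (hG (τ, θ) ⟨hτ, coe_ne_zero θ⟩).hasFDerivWithinAt
  have h2 : HasDerivWithinAt (fun t : ℝ => (t, (θ : E3))) (1, 0) (Ici 1) τ :=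
    (hasDerivWithinAt_id _ _).prodMk (hasDerivWithinAt_const _ _ _)
  have h3 : MapsTo (fun t : ℝ => (t, (θ : E3))) (Ici 1) timeDom := fun t ht => ⟨ht, coe_ne_zero θ⟩
  exact h1.comp_hasDerivWithinAt τ h2 h3

/-- The time derivatives of a potential of class `C²`. -/
theorem CondA1.exists_deriv {γ A : ℝ} {V : ℝ → S2 → ℝ} (hV : CondA1 γ A V) :
    ∃ V₁ V₂ : ℝ → S2 → ℝ,
      (∀ τ, 1 ≤ τ → ∀ θ, HasDerivWithinAt (fun t => V t θ) (V₁ τ θ) (Ici 1) τ) ∧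
      (∀ τ, 1 ≤ τ → ∀ θ, HasDerivWithinAt (fun t => V₁ t θ) (V₂ τ θ) (Ici 1) τ) ∧
      ContinuousOn (fun p : ℝ × S2 => V p.1 p.2) (Ici 1 ×ˢ univ) ∧
      ContinuousOn (fun p : ℝ × S2 => V₁ p.1 p.2) (Ici 1 ×ˢ univ) ∧
      ContinuousOn (fun p : ℝ × S2 => V₂ p.1 p.2) (Ici 1 ×ˢ univ) ∧
      (∀ τ, 1 ≤ τ → ∀ θ, |V₁ τ θ| ≤ A * τ ^ (-1 - γ)) ∧
      (∀ τ, 1 ≤ τ → ∀ θ, |V₂ τ θ| ≤ A * τ ^ (-1 - 2 * γ)) := by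
  let F : ℝ × E3 → ℝ := fun p => radialExt (V p.1) p.2
  have hF : ContDiffOn ℝ 2 F timeDom := hV.contDiff
  let D : ℝ × E3 → ℝ := fun p => fderivWithin ℝ F timeDom p (1, 0)
  have hD : ContDiffOn ℝ 1 D timeDom :=
    (hF.fderivWithin uniqueDiffOn_timeDom (m := 1) (by norm_num)).clm_apply contDiffOn_const
  let D₂ : ℝ × E3 → ℝ := fun p => fderivWithin ℝ D timeDom p (1, 0)
  have hD₂ : ContDiffOn ℝ 0 D₂ timeDom :=
    (hD.fderivWithin uniqueDiffOn_timeDom (m := 0) (by norm_num)).clm_apply contDiffOn_const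
  have hFV : ∀ t θ, F (t, (θ : S2)) = V t θ := fun t θ => by simp only [F, radialExt, dir_coe]
  have d1 : ∀ τ, 1 ≤ τ → ∀ θ : S2, HasDerivWithinAt (fun t => V t θ) (D (τ, θ)) (Ici 1) τ := by
    intro τ hτ θ
    have := hasDerivWithinAt_fst (hF.differentiableOn two_ne_zero) hτ θ
    simpa only [hFV] using this
  have d2 : ∀ τ, 1 ≤ τ → ∀ θ : S2,
      HasDerivWithinAt (fun t => D (t, θ)) (D₂ (τ, θ)) (Ici 1) τ := fun τ hτ θ =>
    hasDerivWithinAt_fst (hD.differentiableOn one_ne_zero) hτ θ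
  have hincl : ContinuousOn (fun p : ℝ × S2 => (p.1, (p.2 : E3))) (Ici 1 ×ˢ univ) := by fun_prop
  have hmaps : MapsTo (fun p : ℝ × S2 => (p.1, (p.2 : E3))) (Ici 1 ×ˢ univ) timeDom :=
    fun p hp => ⟨hp.1, coe_ne_zero p.2⟩
  have hu : UniqueDiffOn ℝ (Ici (1 : ℝ)) := uniqueDiffOn_Ici 1
  refine ⟨fun t θ => D (t, θ), fun t θ => D₂ (t, θ), d1, d2, ?_, hD.continuousOn.comp hincl hmaps,
    hD₂.continuousOn.comp hincl hmaps, fun τ hτ θ => ?_, fun τ hτ θ => ?_⟩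
  · have := hF.continuousOn.comp hincl hmaps
    refine this.congr fun p _ => ?_
    exact (hFV _ _).symm
  · have := hV.bound_deriv τ hτ θ
    rw [(d1 τ hτ θ).derivWithin (hu τ hτ)] at this
    exact this.le
  · have := hV.bound_deriv2 τ hτ θ
    rw [iteratedDerivWithin_succ] at this
    have e : EqOn (iteratedDerivWithin 1 (fun t => V t θ) (Ici 1)) (fun t => D (t, θ)) (Ici 1) := by
      intro t ht
      rw [iteratedDerivWithin_one, (d1 t ht θ).derivWithin (hu t ht)]
    rw [derivWithin_congr e (e hτ), (d2 τ hτ θ).derivWithin (hu τ hτ)] at this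
    exact this.le

/-- A family of functions on the sphere that is of class `C²` in time on `[0, T]` extends to a
`C²` curve in the space of continuous functions: the second derivative is extended by constants
outside the interval and integrated twice. -/
theorem exists_extension {T : ℝ} (hT : 0 ≤ T) {q q₁ q₂ : ℝ → S2 → ℝ}
    (h0 : Continuous (q 0)) (h1 : Continuous (q₁ 0))
    (hd : ∀ t ∈ Icc 0 T, ∀ θ, HasDerivWithinAt (fun t => q t θ) (q₁ t θ) (Icc 0 T) t)
    (hd' : ∀ t ∈ Icc 0 T, ∀ θ, HasDerivWithinAt (fun t => q₁ t θ) (q₂ t θ) (Icc 0 T) t)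
    (hc : ContinuousOn (fun p : ℝ × S2 => q₂ p.1 p.2) (Icc 0 T ×ˢ univ)) :
    ∃ Q Q₁ Q₂ : ℝ → C(S2, ℝ), (∀ t, HasDerivAt Q (Q₁ t) t) ∧ (∀ t, HasDerivAt Q₁ (Q₂ t) t) ∧
      Continuous Q₂ ∧ ∀ t ∈ Icc 0 T, ∀ θ, Q t θ = q t θ ∧ Q₁ t θ = q₁ t θ ∧ Q₂ t θ = q₂ t θ := by
  have hcl : Continuous fun p : ℝ × S2 => q₂ (projIcc 0 T hT p.1) p.2 := by
    refine hc.comp_continuous (f := fun p : ℝ × S2 => ((projIcc 0 T hT p.1 : ℝ), p.2))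
      ?_ fun p => ⟨(projIcc 0 T hT p.1).2, mem_univ _⟩
    exact ((continuous_subtype_val.comp (continuous_projIcc.comp continuous_fst))).prodMk
      continuous_snd
  let Q₂ : C(ℝ, C(S2, ℝ)) := ContinuousMap.curry ⟨_, hcl⟩
  let Q₁ : ℝ → C(S2, ℝ) := fun t => ⟨_, h1⟩ + ∫ s in (0 : ℝ)..t, Q₂ s
  have hQ₁ : ∀ t, HasDerivAt Q₁ (Q₂ t) t := fun t =>
    (intervalIntegral.integral_hasDerivAt_right (Q₂.continuous.intervalIntegrable _ _)
      (Q₂.continuous.stronglyMeasurableAtFilter _ _) Q₂.continuous.continuousAt).const_add _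
  have hQ₁c : Continuous Q₁ := continuous_iff_continuousAt.2 fun t => (hQ₁ t).continuousAt
  let Q : ℝ → C(S2, ℝ) := fun t => ⟨_, h0⟩ + ∫ s in (0 : ℝ)..t, Q₁ s
  have hQ : ∀ t, HasDerivAt Q (Q₁ t) t := fun t =>
    (intervalIntegral.integral_hasDerivAt_right (hQ₁c.intervalIntegrable _ _)
      (hQ₁c.stronglyMeasurableAtFilter _ _) hQ₁c.continuousAt).const_add _
  have hev : ∀ (f : ℝ → C(S2, ℝ)), Continuous f → ∀ t θ,
      (∫ s in (0 : ℝ)..t, f s) θ = ∫ s in (0 : ℝ)..t, f s θ := fun f hf t θ =>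
    ((ContinuousMap.evalCLM ℝ θ).intervalIntegral_comp_comm (hf.intervalIntegrable _ _)).symm
  -- on the interval the iterated integrals reproduce the given family
  have key : ∀ (p p' : ℝ → S2 → ℝ) (f : ℝ → C(S2, ℝ)), Continuous f →
      (∀ t ∈ Icc 0 T, ∀ θ, HasDerivWithinAt (fun t => p t θ) (p' t θ) (Icc 0 T) t) →
      (∀ t ∈ Icc 0 T, ∀ θ, f t θ = p' t θ) → ∀ t ∈ Icc 0 T, ∀ θ,
      p 0 θ + ∫ s in (0 : ℝ)..t, f s θ = p t θ := by
    intro p p' f hf hp hfp t ht θ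
    rw [intervalIntegral.integral_eq_sub_of_hasDerivAt_of_le ht.1 (f := fun t => p t θ)]
    · ring
    · exact fun s hs => ((hp s ⟨hs.1, hs.2.trans ht.2⟩ θ).continuousWithinAt).mono
        (Icc_subset_Icc_right ht.2)
    · intro s hs
      have hs' : s ∈ Icc 0 T := ⟨hs.1.le, hs.2.le.trans ht.2⟩
      rw [hfp s hs' θ]
      exact (hp s hs' θ).hasDerivAt (Icc_mem_nhds hs.1 (hs.2.trans_le ht.2))
    · exact ((ContinuousMap.evalCLM ℝ θ).continuous.comp hf).intervalIntegrable _ _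
  have e2 : ∀ t ∈ Icc 0 T, ∀ θ, Q₂ t θ = q₂ t θ := by
    intro t ht θ
    change q₂ (projIcc 0 T hT t) θ = _
    rw [projIcc_of_mem hT ht]
  have e1 : ∀ t ∈ Icc 0 T, ∀ θ, Q₁ t θ = q₁ t θ := by
    intro t ht θ
    simp only [Q₁, ContinuousMap.add_apply, ContinuousMap.coe_mk]
    rw [hev _ Q₂.continuous]
    exact key q₁ q₂ Q₂ Q₂.continuous hd' e2 t ht θ
  refine ⟨Q, Q₁, Q₂, hQ, hQ₁, Q₂.continuous, fun t ht θ => ⟨?_, e1 t ht θ, e2 t ht θ⟩⟩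
  simp only [Q, ContinuousMap.add_apply, ContinuousMap.coe_mk]
  rw [hev _ hQ₁c]
  exact key q q₁ Q₁ hQ₁c hd e1 t ht θ

theorem hasDerivWithinAt_inv_one_sub {s : Set ℝ} {t : ℝ} (ht : t < 1) :
    HasDerivWithinAt (fun t : ℝ => (1 - t)⁻¹) ((1 - t)⁻¹ ^ 2) s t := by
  have h : HasDerivAt (fun t : ℝ => 1 - t) (-1) t := by
    simpa using (hasDerivAt_id t).const_sub 1
  have h2 := h.inv (sub_pos.2 ht).ne'
  refine h2.hasDerivWithinAt.congr_deriv ?_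
  rw [neg_neg, one_div, inv_pow]

theorem one_le_inv_one_sub {t : ℝ} (h0 : 0 ≤ t) (h1 : t < 1) : 1 ≤ (1 - t)⁻¹ :=
  (one_le_inv₀ (sub_pos.2 h1)).2 (by linarith)

/-- The potential `q(t) = τ² V(τ, ·)` in the time variable `t = 1 - 1/τ`, restricted to `[0, T]` and
extended to a curve of class `C²`, with the bounds that follow from those on `V`. -/
theorem CondA1.exists_potential {γ A : ℝ} {V : ℝ → S2 → ℝ} (hV : CondA1 γ A V) {T : ℝ}
    (hT0 : 0 ≤ T) (hT1 : T < 1) :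
    ∃ Q Q₁ Q₂ : ℝ → C(S2, ℝ), (∀ t, HasDerivAt Q (Q₁ t) t) ∧ (∀ t, HasDerivAt Q₁ (Q₂ t) t) ∧
      Continuous Q₂ ∧ ∀ t ∈ Icc 0 T, ∀ θ, Q t θ = (1 - t)⁻¹ ^ 2 * V (1 - t)⁻¹ θ ∧
        |Q t θ| ≤ A * (1 - t)⁻¹ ^ (2 - γ) ∧
        |Q₁ t θ| ≤ 3 * A * (1 - t)⁻¹ ^ (3 - γ) ∧
        |Q₂ t θ| ≤ 13 * A * (1 - t)⁻¹ ^ (5 - 2 * γ) := by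
  obtain ⟨V₁, V₂, d1, d2, c0, c1, c2, b1, b2⟩ := hV.exists_deriv
  let τ : ℝ → ℝ := fun t => (1 - t)⁻¹
  have hτ1 : ∀ t ∈ Icc 0 T, 1 ≤ τ t := fun t ht => one_le_inv_one_sub ht.1 (ht.2.trans_lt hT1)
  have hτd : ∀ t ∈ Icc 0 T, HasDerivWithinAt τ (τ t ^ 2) (Icc 0 T) t := fun t ht =>
    hasDerivWithinAt_inv_one_sub (ht.2.trans_lt hT1)
  have hτc : ContinuousOn (fun p : ℝ × S2 => (τ p.1, p.2)) (Icc 0 T ×ˢ univ) := by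
    have : ContinuousOn τ (Icc 0 T) := fun t ht => (hτd t ht).continuousWithinAt
    exact (this.comp continuousOn_fst fun p hp => hp.1).prodMk continuousOn_snd
  have hmaps : MapsTo (fun p : ℝ × S2 => (τ p.1, p.2)) (Icc 0 T ×ˢ univ) (Ici 1 ×ˢ univ) :=
    fun p hp => ⟨hτ1 _ hp.1, mem_univ _⟩
  have k0 : ContinuousOn (fun p : ℝ × S2 => V (τ p.1) p.2) (Icc 0 T ×ˢ univ) := c0.comp hτc hmaps
  have k1 : ContinuousOn (fun p : ℝ × S2 => V₁ (τ p.1) p.2) (Icc 0 T ×ˢ univ) := c1.comp hτc hmaps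
  have k2 : ContinuousOn (fun p : ℝ × S2 => V₂ (τ p.1) p.2) (Icc 0 T ×ˢ univ) := c2.comp hτc hmaps
  have kτ : ContinuousOn (fun p : ℝ × S2 => τ p.1) (Icc 0 T ×ˢ univ) :=
    continuous_fst.comp_continuousOn hτc
  have h0mem : (0 : ℝ) ∈ Icc 0 T := ⟨le_rfl, hT0⟩
  have hslice : ∀ {p : ℝ × S2 → ℝ}, ContinuousOn p (Icc 0 T ×ˢ univ) →
      Continuous fun θ => p (0, θ) := fun hp =>
    hp.comp_continuous (by fun_prop) fun θ => ⟨h0mem, mem_univ _⟩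
  have v1 : ∀ t ∈ Icc 0 T, ∀ θ, HasDerivWithinAt (fun t => V (τ t) θ) (V₁ (τ t) θ * τ t ^ 2)
      (Icc 0 T) t := fun t ht θ =>
    (d1 (τ t) (hτ1 t ht) θ).comp t (hτd t ht) hτ1
  have v2 : ∀ t ∈ Icc 0 T, ∀ θ, HasDerivWithinAt (fun t => V₁ (τ t) θ) (V₂ (τ t) θ * τ t ^ 2)
      (Icc 0 T) t := fun t ht θ =>
    (d2 (τ t) (hτ1 t ht) θ).comp t (hτd t ht) hτ1
  obtain ⟨Q, Q₁, Q₂, hQ, hQ₁, hQ₂, e⟩ := exists_extension hT0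
    (q := fun t θ => τ t ^ 2 * V (τ t) θ)
    (q₁ := fun t θ => 2 * τ t ^ 3 * V (τ t) θ + τ t ^ 4 * V₁ (τ t) θ)
    (q₂ := fun t θ => 6 * τ t ^ 4 * V (τ t) θ + 6 * τ t ^ 5 * V₁ (τ t) θ + τ t ^ 6 * V₂ (τ t) θ)
    (hslice ((kτ.pow 2).mul k0))
    (hslice (((continuousOn_const.mul (kτ.pow 3)).mul k0).add ((kτ.pow 4).mul k1)))
    (fun t ht θ => by
      refine (((hτd t ht).fun_pow 2).fun_mul (v1 t ht θ)).congr_deriv ?_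
      push_cast
      ring)
    (fun t ht θ => by
      refine (((((hτd t ht).fun_pow 3).const_mul 2).fun_mul (v1 t ht θ)).fun_add
        (((hτd t ht).fun_pow 4).fun_mul (v2 t ht θ))).congr_deriv ?_
      push_cast
      ring)
    ((((continuousOn_const.mul (kτ.pow 4)).mul k0).add
      ((continuousOn_const.mul (kτ.pow 5)).mul k1)).add ((kτ.pow 6).mul k2))
  refine ⟨Q, Q₁, Q₂, hQ, hQ₁, hQ₂, fun t ht θ => ?_⟩
  obtain ⟨e0, e1, e2⟩ := e t ht θ
  have h1 := hτ1 t ht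
  change _ ∧ _ ≤ _ * τ t ^ _ ∧ _ ≤ _ * τ t ^ _ ∧ _ ≤ _ * τ t ^ _
  rw [e0, e1, e2]
  set x := τ t
  have hx : 0 < x := one_pos.trans_le h1
  have hp : ∀ (n : ℕ) (a : ℝ), x ^ n * x ^ a = x ^ (n + a) := fun n a => by
    rw [Real.rpow_add hx, Real.rpow_natCast]
  have B0 : |V x θ| ≤ A * x ^ (-γ) := (hV.bound x h1 θ).le
  have B1 := b1 x h1 θ
  have B2 := b2 x h1 θ
  have hA : 0 ≤ A := by
    by_contra hA
    have := mul_neg_of_neg_of_pos (not_le.1 hA) (Real.rpow_pos_of_pos hx (-γ))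
    linarith [abs_nonneg (V x θ)]
  have n0 : ∀ (n : ℕ) {w a : ℝ}, |w| ≤ A * x ^ a → |x ^ n * w| ≤ A * x ^ (n + a) := by
    intro n w a hw
    rw [abs_mul, abs_of_pos (pow_pos hx n), ← hp]
    nlinarith [mul_le_mul_of_nonneg_left hw (pow_pos hx n).le]
  refine ⟨rfl, ?_, ?_, ?_⟩
  · refine (n0 2 B0).trans_eq ?_
    norm_num [sub_eq_add_neg]
  · have a1 := n0 3 B0
    have a2 := n0 4 B1
    rw [show ((3 : ℕ) : ℝ) + -γ = 3 - γ by push_cast; ring] at a1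
    rw [show ((4 : ℕ) : ℝ) + (-1 - γ) = 3 - γ by push_cast; ring] at a2
    calc |2 * x ^ 3 * V x θ + x ^ 4 * V₁ x θ| ≤ 2 * |x ^ 3 * V x θ| + |x ^ 4 * V₁ x θ| := by
          refine (abs_add_le _ _).trans ?_
          rw [mul_assoc, abs_mul, abs_two]
      _ ≤ 3 * A * x ^ (3 - γ) := by linarith
  · have a1 := n0 4 B0
    have a2 := n0 5 B1
    have a3 := n0 6 B2
    rw [show ((4 : ℕ) : ℝ) + -γ = 4 - γ by push_cast; ring] at a1
    rw [show ((5 : ℕ) : ℝ) + (-1 - γ) = 4 - γ by push_cast; ring] at a2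
    rw [show ((6 : ℕ) : ℝ) + (-1 - 2 * γ) = 5 - 2 * γ by push_cast; ring] at a3
    -- the second derivative of `V` decays only like `τ ^ (-1 - 2 γ)`, so its term dominates
    have hle : A * x ^ (4 - γ) ≤ A * x ^ (5 - 2 * γ) :=
      mul_le_mul_of_nonneg_left (Real.rpow_le_rpow_of_exponent_le h1 (by linarith [hV.lt_one])) hA
    calc |6 * x ^ 4 * V x θ + 6 * x ^ 5 * V₁ x θ + x ^ 6 * V₂ x θ| ≤
        6 * |x ^ 4 * V x θ| + 6 * |x ^ 5 * V₁ x θ| + |x ^ 6 * V₂ x θ| := by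
          refine (abs_add_three _ _ _).trans ?_
          rw [mul_assoc, mul_assoc, abs_mul 6, abs_mul 6, abs_of_pos (by norm_num : (0 : ℝ) < 6)]
      _ ≤ 13 * A * x ^ (5 - 2 * γ) := by linarith

end Potential

/-! ### The Duhamel expansion as a Volterra series -/

section Volterra

variable {E : Type*} [NormedAddCommGroup E] [NormedSpace ℝ E] [CompleteSpace E]
  {G : ℝ → E →L[ℝ] E}

/-- The convolution with the group has derivative `g 0` at time zero, although `g 0` need not be in
the domain of the generator. -/
theorem hasDerivAt_convolution_zero (hG : IsContractionGroup G) {g : ℝ → E} (hg : Continuous g) :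
    HasDerivAt (fun r => ∫ s in (0 : ℝ)..r, G (r - s) (g s)) (g 0) 0 := by
  have hc : Continuous fun s => G (-s) (g s) := hG.continuous_comp (by fun_prop) hg
  let v : ℝ → E := fun r => ∫ s in (0 : ℝ)..r, G (-s) (g s)
  have hv : HasDerivAt v (g 0) 0 := by
    have := intervalIntegral.integral_hasDerivAt_right (hc.intervalIntegrable 0 0)
      (hc.stronglyMeasurableAtFilter _ _) hc.continuousAt
    simpa [hG.zero] using this
  have hv0 : v 0 = 0 := intervalIntegral.integral_same
  have e : (fun r => ∫ s in (0 : ℝ)..r, G (r - s) (g s)) = fun r => G r (v r) := by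
    ext r
    rw [← ContinuousLinearMap.intervalIntegral_comp_comm _ (hc.intervalIntegrable _ _)]
    congr 1
    ext s
    rw [sub_eq_add_neg, hG.add]
    rfl
  rw [e, hasDerivAt_iff_tendsto_slope_zero]
  rw [hasDerivAt_iff_tendsto_slope_zero] at hv
  have h0 : Tendsto (fun t : ℝ => t) (𝓝[≠] 0) (𝓝 0) := tendsto_id.mono_left nhdsWithin_le_nhds
  have h1 := (hG.continuous_uncurry.tendsto (0, g 0)).comp (h0.prodMk_nhds hv)
  simp only [hG.zero, one_apply_eq_self] at h1
  refine h1.congr fun t => ?_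
  simp [hv0]

/-- The solution of the Volterra equation solves the differential equation: its value at each time
is in the domain of the generator as soon as it is differentiable there. -/
theorem hasDerivAt_group_duhamelSum (hG : IsContractionGroup G) {p : ℝ → E →L[ℝ] E}
    (hp : Continuous p) (f : E) {σ : ℝ} {y' : E} (hy : HasDerivAt (duhamelSum G p f) y' σ) :
    HasDerivAt (fun r => G r (duhamelSum G p f σ)) (y' - p σ (duhamelSum G p f σ)) 0 := by
  have hyc := continuous_duhamelSum_slice hG hp f
  have e : (fun r => G r (duhamelSum G p f σ)) = fun r => duhamelSum G p f (r + σ) -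
      ∫ s in (0 : ℝ)..r, G (r - s) (p (s + σ) (duhamelSum G p f (s + σ))) :=
    funext fun r => (sub_volterra_shift hG hp f σ r).symm
  rw [e]
  have h1 : HasDerivAt (fun r => duhamelSum G p f (r + σ)) y' 0 := by
    have : HasDerivAt (duhamelSum G p f) y' (0 + σ) := by rwa [zero_add]
    exact this.comp_add_const 0 σ
  have hc : Continuous fun s => p (s + σ) (duhamelSum G p f (s + σ)) :=
    (hp.comp (by fun_prop)).clm_apply (hyc.comp (by fun_prop))
  have h2 := hasDerivAt_convolution_zero hG hc
  simp only [zero_add] at h2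
  exact h1.sub h2

end Volterra

section Solution

/-- The free evolution `exp(-i t B)`. -/
noncomputable abbrev freeGroup : ℝ → L2S →L[ℝ] L2S := isSpectralFamily_eigB.unitaryGroup

theorem isContractionGroup_freeGroup : IsContractionGroup freeGroup :=
  isSpectralFamily_eigB.isContractionGroup

/-- The free evolution depends on the times through `σ = (1 - 1/τ) / k` only. -/
theorem freeU_eq (k s τ : ℝ) (hk : k ≠ 0) (hs : s ≠ 0) (hτ : τ ≠ 0) (f : L2S) :
    freeU k s τ f = freeGroup ((1 - 1 / τ) / k - (1 - 1 / s) / k) f := by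
  rw [freeGroup, IsSpectralFamily.unitaryGroup_apply, freeU, expB]
  refine tsum_congr fun l => ?_
  congr 2
  have : (Complex.I : ℂ) ≠ 0 := Complex.I_ne_zero
  have h1 : (k : ℂ) ≠ 0 := by exact_mod_cast hk
  have h2 : (s : ℂ) ≠ 0 := by exact_mod_cast hs
  have h3 : (τ : ℂ) ≠ 0 := by exact_mod_cast hτ
  push_cast
  field_simp
  rw [Complex.I_sq]
  ring

/-- Multiplication by `-i`. -/
noncomputable def negIOp : L2S →L[ℝ] L2S :=
  ((-Complex.I) • ContinuousLinearMap.id ℂ L2S).restrictScalars ℝ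

/-- Multiplication by `-i v`. -/
noncomputable def potOp : C(S2, ℝ) →L[ℝ] L2S →L[ℝ] L2S :=
  (ContinuousLinearMap.compL ℝ L2S L2S L2S negIOp).comp mulOp

theorem potOp_apply (v : C(S2, ℝ)) (f : L2S) : potOp v f = -Complex.I • mulOp v f := rfl

/-- In the time `σ = (1 - 1/τ) / k` the Duhamel expansion becomes a Volterra series for the free
group. -/
theorem duhamel_eq_iterate {V : ℝ → S2 → ℝ} {Q : ℝ → C(S2, ℝ)} (hQ : Continuous Q) {T k : ℝ}
    (hk : 0 < k) (hVQ : ∀ t ∈ Icc 0 T, ∀ θ, Q t θ = (1 - t)⁻¹ ^ 2 * V (1 - t)⁻¹ θ) (f : L2S)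
    (n : ℕ) : ∀ τ, 1 ≤ τ → 1 - 1 / τ ≤ T → duhamel V k 1 f n τ =
      (volterra freeGroup fun r => potOp (Q (k * r)))^[n] (fun r => freeGroup r f)
        ((1 - 1 / τ) / k) := by
  have hG := isContractionGroup_freeGroup
  induction n with
  | zero =>
    intro τ hτ _
    have := freeU_eq k 1 τ hk.ne' one_ne_zero (by linarith) f
    simpa [duhamel] using this
  | succ n ih =>
    intro τ hτ hτT
    rw [Function.iterate_succ_apply', volterra]
    set u := (volterra freeGroup fun r => potOp (Q (k * r)))^[n] (fun r => freeGroup r f) with hu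
    set σ := (1 - 1 / τ) / k with hσ
    have hp : Continuous fun r => potOp (Q (k * r)) :=
      potOp.continuous.comp (hQ.comp (by fun_prop))
    have huc : Continuous u := continuous_iterate_volterra_slice hG hp (hG.continuous_apply f) n
    let Φ : ℝ → L2S := fun r => freeGroup (σ - r) (potOp (Q (k * r)) (u r))
    have hΦ : Continuous Φ := volterra_integrand_continuous hG hp huc σ
    let ρ : ℝ → ℝ := fun s => (1 - 1 / s) / k
    have hmem : ∀ s ∈ uIcc 1 τ, 1 ≤ s ∧ s ≤ τ := fun s hs => by
      rwa [uIcc_of_le hτ] at hs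
    have hρ : ∀ s ∈ uIcc 1 τ, HasDerivAt ρ (1 / s ^ 2 / k) s := by
      intro s hs
      have hs0 : s ≠ 0 := by linarith [(hmem s hs).1]
      have h1 := (((hasDerivAt_inv hs0).const_sub 1).div_const k)
      refine (h1.congr_deriv (by rw [neg_neg, one_div])).congr_of_eventuallyEq
        (Eventually.of_forall fun x => ?_)
      simp only [ρ, one_div]
    have hρ' : ContinuousOn (fun s : ℝ => 1 / s ^ 2 / k) (uIcc 1 τ) := by
      refine ContinuousOn.div_const (continuousOn_const.div (by fun_prop) fun s hs => ?_) _
      have := (hmem s hs).1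
      positivity
    -- the change of variables `r = (1 - 1/s) / k`
    have hcv := intervalIntegral.integral_deriv_smul_comp hρ hρ' hΦ
    have e0 : ρ 1 = 0 := by simp [ρ]
    rw [e0] at hcv
    change _ = ∫ r in (0 : ℝ)..ρ τ, Φ r
    rw [← hcv]
    change (1 / (Complex.I * k)) • _ = _
    rw [← intervalIntegral.integral_smul]
    refine intervalIntegral.integral_congr fun s hs => ?_
    obtain ⟨hs1, hs2⟩ := hmem s hs
    have hs0 : 0 < s := by linarith
    have hsT : 1 - 1 / s ∈ Icc 0 T := by
      refine ⟨?_, le_trans ?_ hτT⟩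
      · rw [sub_nonneg, div_le_one hs0]; exact hs1
      · have := one_div_le_one_div_of_le hs0 hs2
        linarith
    have hs3 : (1 - (1 - 1 / s))⁻¹ = s := by field_simp; ring
    have e1 : mulL2 (V s) (u (ρ s)) = (1 / s ^ 2) • mulOp (Q (k * ρ s)) (u (ρ s)) := by
      have e2 : V s = ((1 / s ^ 2) • Q (k * ρ s) : C(S2, ℝ)) := by
        ext θ
        rw [ContinuousMap.smul_apply, smul_eq_mul]
        have : k * ρ s = 1 - 1 / s := by
          simp only [ρ]
          field_simp
        rw [this, hVQ _ hsT, hs3]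
        field_simp
      rw [e2, ← mulOp_apply, map_smul]
      rfl
    simp only [Function.comp_apply]
    rw [ih s hs1 hsT.2, freeU_eq k s τ hk.ne' hs0.ne' (by linarith)]
    change (1 / (Complex.I * k)) • freeGroup (σ - ρ s) (mulL2 (V s) (u (ρ s))) = _ • Φ (ρ s)
    rw [e1, map_smul]
    simp only [Φ, potOp_apply]
    rw [IsSpectralFamily.unitaryGroup_smul, ← IsSpectralFamily.ofReal_smul (1 / s ^ 2),
      ← IsSpectralFamily.ofReal_smul (1 / s ^ 2 / k), smul_smul, smul_smul]
    congr 1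
    have hI : (Complex.I : ℂ) ≠ 0 := Complex.I_ne_zero
    have hkc : (k : ℂ) ≠ 0 := by exact_mod_cast hk.ne'
    push_cast
    field_simp
    rw [Complex.I_sq]
    ring

end Solution

/-! ### Partial derivatives and the rescaled solution -/

section PartialDerivatives

variable {E : Type*} [NormedAddCommGroup E] [NormedSpace ℝ E]

/-- The partial derivative in the first variable. -/
noncomputable def pd₁ (u : ℝ × ℝ → E) (x : ℝ × ℝ) : E := fderiv ℝ u x (1, 0)

/-- The partial derivative in the second variable. -/
noncomputable def pd₂ (u : ℝ × ℝ → E) (x : ℝ × ℝ) : E := fderiv ℝ u x (0, 1)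

theorem hasDerivAt_pd₁ {u : ℝ × ℝ → E} {t k : ℝ} (h : DifferentiableAt ℝ u (t, k)) :
    HasDerivAt (fun s => u (s, k)) (pd₁ u (t, k)) t :=
  h.hasFDerivAt.comp_hasDerivAt t ((hasDerivAt_id t).prodMk (hasDerivAt_const t k))

theorem hasDerivAt_pd₂ {u : ℝ × ℝ → E} {t k : ℝ} (h : DifferentiableAt ℝ u (t, k)) :
    HasDerivAt (fun κ => u (t, κ)) (pd₂ u (t, k)) k :=
  h.hasFDerivAt.comp_hasDerivAt k ((hasDerivAt_const k t).prodMk (hasDerivAt_id k))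

theorem differentiableAt_pd {u : ℝ × ℝ → E} {x : ℝ × ℝ} (h : ContDiffAt ℝ 2 u x) :
    DifferentiableAt ℝ (pd₁ u) x ∧ DifferentiableAt ℝ (pd₂ u) x := by
  have h1 := (h.fderiv_right (m := 1) (by norm_num)).differentiableAt one_ne_zero
  exact ⟨h1.clm_apply (differentiableAt_const _), h1.clm_apply (differentiableAt_const _)⟩

/-- The mixed second derivatives of a function of class `C²` coincide. -/
theorem pd₂_pd₁ {u : ℝ × ℝ → E} {x : ℝ × ℝ} (h : ContDiffAt ℝ 2 u x) :
    pd₂ (pd₁ u) x = pd₁ (pd₂ u) x := by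
  have h1 := (h.fderiv_right (m := 1) (by norm_num)).differentiableAt one_ne_zero
  have h2 := h.isSymmSndFDerivAt (by simp)
  have e : ∀ v w, fderiv ℝ (fun y => fderiv ℝ u y v) x w = fderiv ℝ (fderiv ℝ u) x w v := by
    intro v w
    rw [fderiv_clm_apply h1 (differentiableAt_const _)]
    simp
  unfold pd₁ pd₂
  rw [e, e]
  exact h2.eq _ _

end PartialDerivatives

section Solution

/-- The solution of `i k y_t = B y + q y`, `y(0) = f`, as a function of `(t, k)`.  In the time
`σ = t / k` the free group does not depend on `k`, which enters only through the potential
`q(k σ)`. -/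
noncomputable def solution (Q : ℝ → C(S2, ℝ)) (f : L2S) (x : ℝ × ℝ) : L2S :=
  duhamelSum freeGroup (fun r => potOp (Q (x.2 * r))) f (x.1 / x.2)

theorem W_eq_solution {V : ℝ → S2 → ℝ} {Q : ℝ → C(S2, ℝ)} (hQ : Continuous Q) {T k : ℝ}
    (hk : 0 < k) (hVQ : ∀ t ∈ Icc 0 T, ∀ θ, Q t θ = (1 - t)⁻¹ ^ 2 * V (1 - t)⁻¹ θ) (f : L2S)
    {τ : ℝ} (hτ : 1 ≤ τ) (hτT : 1 - 1 / τ ≤ T) : W V f k τ = solution Q f (1 - 1 / τ, k) :=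
  tsum_congr fun n => duhamel_eq_iterate hQ hk hVQ f n τ hτ hτT

theorem hasDerivAt_freeGroup {f g : L2S} (h : IsB f g) :
    HasDerivAt (fun t => freeGroup t f) (-Complex.I • g) 0 :=
  isSpectralFamily_eigB.hasDerivAt_unitaryGroup (isB_iff.1 h)

/-- A function of `(t, k)` that solves `i k y_t = B y + q y`, `y(0) = f`, and is of class `C²`;
`Q₁` is the derivative of the potential `Q`. -/
structure IsSolution (Q Q₁ : ℝ → C(S2, ℝ)) (f : L2S) (u : ℝ × ℝ → L2S) : Prop where
  contDiffAt : ∀ t k, 0 < k → ContDiffAt ℝ 2 u (t, k)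
  hasDerivAt : ∀ t, HasDerivAt Q (Q₁ t) t
  isB : ∀ t k, 0 < k → IsB (u (t, k)) ((Complex.I * k) • pd₁ u (t, k) - mulOp (Q t) (u (t, k)))
  initial : ∀ k, 0 < k → u (0, k) = f

/-- The Duhamel series is a solution of class `C²` as soon as `f` and `B f + q(0) f`, the initial
time derivative up to a factor, are in the domain of `B`. -/
theorem isSolution_solution {Q Q₁ Q₂ : ℝ → C(S2, ℝ)} (hQ : ∀ t, HasDerivAt Q (Q₁ t) t)
    (hQ₁ : ∀ t, HasDerivAt Q₁ (Q₂ t) t) (hQ₂ : Continuous Q₂) {f g g' : L2S} (hf : IsB f g)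
    (hg : IsB (g + mulOp (Q 0) f) g') : IsSolution Q Q₁ f (solution Q f) := by
  have hG := isContractionGroup_freeGroup
  have hQc : Continuous Q := continuous_iff_continuousAt.2 fun t => (hQ t).continuousAt
  have hC2 : ContDiff ℝ 2 Q := by
    have d1 : deriv Q = Q₁ := funext fun t => (hQ t).deriv
    have d2 : deriv Q₁ = Q₂ := funext fun t => (hQ₁ t).deriv
    have h1 : ContDiff ℝ 1 Q₁ := by
      rw [contDiff_one_iff_deriv, d2]
      exact ⟨fun t => (hQ₁ t).differentiableAt, hQ₂⟩
    have h2 := contDiff_succ_iff_deriv (𝕜 := ℝ) (n := 1) (f := Q)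
    rw [show (1 : WithTop ℕ∞) + 1 = 2 by norm_num] at h2
    rw [h2, d1]
    exact ⟨fun t => (hQ t).differentiableAt, by simp, h1⟩
  let P : ℝ × ℝ → L2S →L[ℝ] L2S := fun x => potOp (Q (x.2 * x.1))
  have hP : ContDiff ℝ 2 P :=
    potOp.contDiff.comp (hC2.comp (contDiff_snd.mul contDiff_fst))
  let y : ℝ × ℝ → L2S := fun x => duhamelSum freeGroup (fun r => P (r, x.2)) f x.1
  have hy : ContDiff ℝ 2 y := by
    refine contDiff_two_duhamelSum hG hP (p₀ := potOp (Q 0)) (fun k => by simp [P])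
      (hasDerivAt_freeGroup hf) (f'' := -Complex.I • (-Complex.I • g')) ?_
    refine hasDerivAt_freeGroup ?_
    rw [potOp_apply, ← smul_add]
    exact hg.smul _
  have e : solution Q f = fun x => y (x.1 / x.2, x.2) := rfl
  have hcd : ∀ t k : ℝ, 0 < k → ContDiffAt ℝ 2 (solution Q f) (t, k) := by
    intro t k hk
    rw [e]
    exact hy.contDiffAt.comp (t, k)
      ((contDiffAt_fst.div contDiffAt_snd hk.ne').prodMk contDiffAt_snd)
  refine ⟨hcd, hQ, fun t k hk => ?_, fun k hk => ?_⟩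
  · have h1 := hasDerivAt_pd₁ ((hcd t k hk).differentiableAt two_ne_zero)
    have h2 := hasDerivAt_pd₁ (t := t / k) (k := k) (hy.differentiable two_ne_zero (t / k, k))
    have h3 : HasDerivAt (fun s => solution Q f (s, k)) ((1 / k) • pd₁ y (t / k, k)) t :=
      HasDerivAt.scomp (g₁ := fun s => y (s, k)) t h2 ((hasDerivAt_id t).div_const k)
    have h4 : k • pd₁ (solution Q f) (t, k) = pd₁ y (t / k, k) := by
      rw [h1.unique h3, smul_smul, mul_one_div_cancel hk.ne', one_smul]
    have hp : Continuous fun r => P (r, k) := hP.continuous.comp (by fun_prop)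
    have h5 := hasDerivAt_group_duhamelSum hG hp f h2
    have h6 := isB_iff.2 (isSpectralFamily_eigB.starProjection_of_hasDerivAt_unitaryGroup h5)
    have h7 : P (t / k, k) = potOp (Q t) := by
      simp only [P]
      rw [mul_div_cancel₀ _ hk.ne']
    have h8 : Complex.I • (pd₁ y (t / k, k) - P (t / k, k) (solution Q f (t, k))) =
        (Complex.I * k) • pd₁ (solution Q f) (t, k) - mulOp (Q t) (solution Q f (t, k)) := by
      rw [h7, ← h4, smul_sub, potOp_apply, smul_smul, mul_neg, Complex.I_mul_I, neg_neg, one_smul,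
        mul_smul, IsSpectralFamily.ofReal_smul]
    rw [← h8]
    exact h6
  · have hp : Continuous fun r => P (r, k) := hP.continuous.comp (by fun_prop)
    rw [e]
    simp only [zero_div]
    exact duhamelSum_zero hG hp f

end Solution

/-! ### The energy estimate -/

section Energy

theorem hasDerivAt_rpow_inv_one_sub {t : ℝ} (ht : t < 1) (p : ℝ) :
    HasDerivAt (fun t : ℝ => (1 - t)⁻¹ ^ p) (p * (1 - t)⁻¹ ^ (p + 1)) t := by
  have hx : 0 < (1 - t)⁻¹ := inv_pos.2 (sub_pos.2 ht)
  have h1 : HasDerivAt (fun t : ℝ => (1 - t)⁻¹) ((1 - t)⁻¹ ^ 2) t :=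
    hasDerivWithinAt_univ.1 (hasDerivWithinAt_inv_one_sub ht)
  refine (h1.rpow_const (p := p) (Or.inl hx.ne')).congr_deriv ?_
  rw [show p + 1 = 2 + (p - 1) by ring, Real.rpow_add hx, Real.rpow_two]
  ring

/-- **Energy estimate** for `i k u' = B u + q u + g`: as `B` and `q` are symmetric, only the source
`g` contributes to the growth of the norm. -/
theorem norm_le_of_energy {u u' g : ℝ → L2S} {q : ℝ → C(S2, ℝ)} {k c C p t₀ : ℝ} (hc : 0 < c)
    (hk : c ≤ k) (hp : 0 < p) (hC : 0 ≤ C) (h0 : 0 ≤ t₀) (h1 : t₀ < 1)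
    (hu : ∀ t ∈ Icc 0 t₀, HasDerivAt u (u' t) t)
    (hB : ∀ t ∈ Icc 0 t₀, IsB (u t) ((Complex.I * k) • u' t - mulOp (q t) (u t) - g t))
    (hg : ∀ t ∈ Icc 0 t₀, ‖g t‖ ≤ C * (1 - t)⁻¹ ^ (p + 1)) :
    ‖u t₀‖ ≤ ‖u 0‖ + C / (c * p) * (1 - t₀)⁻¹ ^ p := by
  have hk0 : 0 < k := hc.trans_le hk
  -- `‖u t‖` need not be differentiable where `u` vanishes, so `√(‖u t‖² + ε²)` is estimated instead
  refine le_of_forall_pos_le_add fun ε hε => ?_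
  let N : ℝ → ℝ := fun t => √((⟪u t, u t⟫_ℂ).re + ε ^ 2)
  have hnorm : ∀ t, (⟪u t, u t⟫_ℂ).re = ‖u t‖ ^ 2 := fun t => inner_self_eq_norm_sq (𝕜 := ℂ) (u t)
  have hpos : ∀ t, 0 < (⟪u t, u t⟫_ℂ).re + ε ^ 2 := fun t => by
    rw [hnorm]
    positivity
  have hNpos : ∀ t, 0 < N t := fun t => Real.sqrt_pos.2 (hpos t)
  have hNd : ∀ t ∈ Icc 0 t₀, HasDerivAt N ((2 * (⟪u t, u' t⟫_ℂ).re) / (2 * N t)) t := by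
    intro t ht
    have a1 := (hu t ht).inner ℂ (hu t ht)
    have a2 := (Complex.reCLM.hasFDerivAt.comp_hasDerivAt t a1).add_const (ε ^ 2)
    refine (a2.sqrt (hpos t).ne').congr_deriv ?_
    congr 1
    rw [map_add, Complex.reCLM_apply, Complex.reCLM_apply, ← inner_conj_symm (u' t) (u t),
      Complex.conj_re, two_mul]
  -- pair the equation with `u` and take imaginary parts
  have hdiss : ∀ t ∈ Icc 0 t₀, k * (⟪u t, u' t⟫_ℂ).re ≤ ‖u t‖ * ‖g t‖ := by
    intro t ht
    have a1 := (hB t ht).inner_im_eq_zero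
    rw [inner_sub_right, inner_sub_right, inner_smul_right, Complex.sub_im, Complex.sub_im,
      inner_mulOp_im, sub_zero] at a1
    have a2 : (Complex.I * k * ⟪u t, u' t⟫_ℂ).im = k * (⟪u t, u' t⟫_ℂ).re := by
      rw [mul_assoc, Complex.I_mul_im, Complex.re_ofReal_mul]
    rw [a2, sub_eq_zero] at a1
    rw [a1]
    exact (Complex.im_le_norm _).trans (norm_inner_le_norm _ _)
  let Φ : ℝ → ℝ := fun t => N t - C / (c * p) * (1 - t)⁻¹ ^ p
  have hΦ : ∀ t ∈ Icc 0 t₀, HasDerivAt Φ ((2 * (⟪u t, u' t⟫_ℂ).re) / (2 * N t) -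
      C / (c * p) * (p * (1 - t)⁻¹ ^ (p + 1))) t := fun t ht =>
    (hNd t ht).sub ((hasDerivAt_rpow_inv_one_sub (ht.2.trans_lt h1) p).const_mul _)
  have hanti : AntitoneOn Φ (Icc 0 t₀) := by
    refine antitoneOn_of_deriv_nonpos (convex_Icc _ _)
      (fun t ht => (hΦ t ht).continuousAt.continuousWithinAt) (fun t ht => ?_) fun t ht => ?_
    · exact (hΦ t (interior_subset ht)).differentiableAt.differentiableWithinAt
    · have ht' := interior_subset ht
      rw [(hΦ t ht').deriv, sub_nonpos]
      have b0 : 0 ≤ (1 - t)⁻¹ ^ (p + 1) :=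
        Real.rpow_nonneg (inv_nonneg.2 (by linarith [ht'.2])) _
      have b1 : ‖u t‖ ≤ N t := by
        refine Real.le_sqrt_of_sq_le ?_
        rw [hnorm]
        nlinarith
      have b2 := hdiss t ht'
      have b3 : k * (⟪u t, u' t⟫_ℂ).re ≤ N t * (C * (1 - t)⁻¹ ^ (p + 1)) :=
        b2.trans (mul_le_mul b1 (hg t ht') (norm_nonneg _) (hNpos t).le)
      have b4 : (⟪u t, u' t⟫_ℂ).re ≤ N t * (C * (1 - t)⁻¹ ^ (p + 1)) / c := by
        have b5 : (⟪u t, u' t⟫_ℂ).re ≤ N t * (C * (1 - t)⁻¹ ^ (p + 1)) / k := by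
          rw [le_div_iff₀ hk0]
          linarith
        refine b5.trans (div_le_div_of_nonneg_left ?_ hc hk)
        exact mul_nonneg (hNpos t).le (mul_nonneg hC b0)
      rw [mul_div_mul_left _ _ two_ne_zero, div_le_iff₀ (hNpos t)]
      refine b4.trans_eq ?_
      field_simp
  have hend := hanti ⟨le_rfl, h0⟩ ⟨h0, le_rfl⟩ h0
  have e1 : ‖u t₀‖ ≤ N t₀ := by
    refine Real.le_sqrt_of_sq_le ?_
    rw [hnorm]
    nlinarith
  have e2 : N 0 ≤ ‖u 0‖ + ε := by
    refine Real.sqrt_le_iff.2 ⟨by positivity, ?_⟩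
    rw [hnorm]
    nlinarith [norm_nonneg (u 0)]
  have e3 : Φ 0 ≤ N 0 := by
    have : 0 ≤ C / (c * p) * (1 - 0)⁻¹ ^ p := by positivity
    simp only [Φ]
    linarith
  simp only [Φ] at hend e3
  linarith

/-- The energy estimate for difference quotients `d ε / ε`, in the limit.  It bounds a derivative
`z` of a solution without any equation for `z` itself, which would involve one more derivative. -/
theorem norm_le_of_energy_limit {d d' g : ℝ → ℝ → L2S} {q : ℝ → C(S2, ℝ)} {z z₀ : L2S}
    {k c C p t₀ : ℝ} (hc : 0 < c) (hk : c ≤ k) (hp : 0 < p) (hC : 0 ≤ C) (h0 : 0 ≤ t₀)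
    (h1 : t₀ < 1)
    (hd : ∀ᶠ ε in 𝓝[>] (0 : ℝ), ∀ t ∈ Icc 0 t₀, HasDerivAt (d ε) (d' ε t) t ∧
      IsB (d ε t) ((Complex.I * k) • d' ε t - mulOp (q t) (d ε t) - g ε t) ∧
      ‖g ε t‖ ≤ ε * C * (1 - t)⁻¹ ^ (p + 1))
    (hz : Tendsto (fun ε => ε⁻¹ • d ε t₀) (𝓝[>] 0) (𝓝 z))
    (hz₀ : Tendsto (fun ε => ε⁻¹ • d ε 0) (𝓝[>] 0) (𝓝 z₀)) :
    ‖z‖ ≤ ‖z₀‖ + C / (c * p) * (1 - t₀)⁻¹ ^ p := by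
  refine le_of_tendsto_of_tendsto hz.norm (hz₀.norm.add_const _) ?_
  filter_upwards [hd, self_mem_nhdsWithin] with ε h (hε : 0 < ε)
  have key := norm_le_of_energy hc hk hp (mul_nonneg hε.le hC) h0 h1 (fun t ht => (h t ht).1)
    (fun t ht => (h t ht).2.1) (fun t ht => (h t ht).2.2)
  rw [norm_smul, norm_smul, Real.norm_of_nonneg (inv_nonneg.2 hε.le)]
  calc ε⁻¹ * ‖d ε t₀‖ ≤ ε⁻¹ * (‖d ε 0‖ + ε * C / (c * p) * (1 - t₀)⁻¹ ^ p) := by gcongr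
    _ = _ := by field_simp

end Energy

namespace IsSolution

variable {Q Q₁ : ℝ → C(S2, ℝ)} {f : L2S} {u : ℝ × ℝ → L2S}

theorem differentiableAt (h : IsSolution Q Q₁ f u) {t k : ℝ} (hk : 0 < k) :
    DifferentiableAt ℝ u (t, k) := (h.contDiffAt t k hk).differentiableAt two_ne_zero

theorem hasDerivAt₁ (h : IsSolution Q Q₁ f u) {k : ℝ} (hk : 0 < k) (t : ℝ) :
    HasDerivAt (fun s => u (s, k)) (pd₁ u (t, k)) t := hasDerivAt_pd₁ (h.differentiableAt hk)

theorem hasDerivAt₂ (h : IsSolution Q Q₁ f u) {k : ℝ} (hk : 0 < k) (t : ℝ) :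
    HasDerivAt (fun κ => u (t, κ)) (pd₂ u (t, k)) k := hasDerivAt_pd₂ (h.differentiableAt hk)

theorem hasDerivAt₁₁ (h : IsSolution Q Q₁ f u) {k : ℝ} (hk : 0 < k) (t : ℝ) :
    HasDerivAt (fun s => pd₁ u (s, k)) (pd₁ (pd₁ u) (t, k)) t :=
  hasDerivAt_pd₁ (differentiableAt_pd (h.contDiffAt t k hk)).1

theorem hasDerivAt₂₁ (h : IsSolution Q Q₁ f u) {k : ℝ} (hk : 0 < k) (t : ℝ) :
    HasDerivAt (fun κ => pd₁ u (t, κ)) (pd₂ (pd₁ u) (t, k)) k :=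
  hasDerivAt_pd₂ (differentiableAt_pd (h.contDiffAt t k hk)).1

theorem hasDerivAt₁₂ (h : IsSolution Q Q₁ f u) {k : ℝ} (hk : 0 < k) (t : ℝ) :
    HasDerivAt (fun s => pd₂ u (s, k)) (pd₂ (pd₁ u) (t, k)) t := by
  rw [pd₂_pd₁ (h.contDiffAt t k hk)]
  exact hasDerivAt_pd₁ (differentiableAt_pd (h.contDiffAt t k hk)).2

theorem hasDerivAt₂₂ (h : IsSolution Q Q₁ f u) {k : ℝ} (hk : 0 < k) (t : ℝ) :
    HasDerivAt (fun κ => pd₂ u (t, κ)) (pd₂ (pd₂ u) (t, k)) k :=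
  hasDerivAt_pd₂ (differentiableAt_pd (h.contDiffAt t k hk)).2

theorem hasDerivAt_mulOp {Q : ℝ → C(S2, ℝ)} {Q' : C(S2, ℝ)} {v : ℝ → L2S} {v' : L2S} {t : ℝ}
    (hQ : HasDerivAt Q Q' t) (hv : HasDerivAt v v' t) :
    HasDerivAt (fun s => mulOp (Q s) (v s)) (mulOp Q' (v t) + mulOp (Q t) v') t :=
  (mulOp.hasFDerivAt.comp_hasDerivAt t hQ).clm_apply hv

/-- The equation for the time derivative. -/
theorem isB_pd₁ (h : IsSolution Q Q₁ f u) {k : ℝ} (hk : 0 < k) (t : ℝ) :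
    IsB (pd₁ u (t, k)) ((Complex.I * k) • pd₁ (pd₁ u) (t, k) - mulOp (Q t) (pd₁ u (t, k)) -
      mulOp (Q₁ t) (u (t, k))) := by
  have h1 := ((h.hasDerivAt₁₁ hk t).const_smul (Complex.I * (k : ℂ))).sub
    (hasDerivAt_mulOp (h.hasDerivAt t) (h.hasDerivAt₁ hk t))
  have h2 := IsB.of_hasDerivAt (Eventually.of_forall fun s => h.isB s k hk) (h.hasDerivAt₁ hk t) h1
  convert h2 using 1
  abel

/-- The equation for the derivative with respect to `k`. -/
theorem isB_pd₂ (h : IsSolution Q Q₁ f u) {k : ℝ} (hk : 0 < k) (t : ℝ) :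
    IsB (pd₂ u (t, k)) ((Complex.I * k) • pd₂ (pd₁ u) (t, k) + Complex.I • pd₁ u (t, k) -
      mulOp (Q t) (pd₂ u (t, k))) := by
  have hI : HasDerivAt (fun κ : ℝ => Complex.I * (κ : ℂ)) Complex.I k := by
    simpa using (Complex.ofRealCLM.hasDerivAt (x := k)).const_mul Complex.I
  have h1 := (hI.smul (h.hasDerivAt₂₁ hk t)).sub
    ((mulOp (Q t)).hasFDerivAt.comp_hasDerivAt k (h.hasDerivAt₂ hk t))
  refine IsB.of_hasDerivAt ?_ (h.hasDerivAt₂ hk t) h1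
  filter_upwards [Ioi_mem_nhds hk] with κ hκ
  exact h.isB t κ hκ

end IsSolution

/-! ### Bounds for the derivatives of a solution -/

section Estimates

theorem norm_mulOp_apply_le (v : C(S2, ℝ)) (f : L2S) : ‖mulOp v f‖ ≤ ‖v‖ * ‖f‖ :=
  norm_mulOp_le v (fun θ => v.norm_coe_le_norm θ) f

/-- A solution together with the quantitative assumptions on the potential and on the initial value:
`c` is the lower bound for the parameter `k` in the estimates, and `R` bounds the norms of `f` and
`g = B f`.  The bounds on the time derivatives `Q₁`, `Q₂` of the potential are those of
`CondA1.exists_potential`. -/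
structure BoundedSolution (γ A c R T : ℝ) (Q Q₁ Q₂ : ℝ → C(S2, ℝ)) (f g : L2S)
    (u : ℝ × ℝ → L2S) : Prop where
  isSolution : IsSolution Q Q₁ f u
  hasDerivAt_snd : ∀ t, HasDerivAt Q₁ (Q₂ t) t
  half_lt : 1 / 2 < γ
  lt_one : γ < 1
  nonneg : 0 ≤ A
  pos : 0 < c
  horizon : T < 1
  norm_potential_zero : ‖Q 0‖ ≤ A
  norm_fst : ∀ t ∈ Icc 0 T, ‖Q₁ t‖ ≤ 3 * A * (1 - t)⁻¹ ^ (3 - γ)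
  norm_snd : ∀ t ∈ Icc 0 T, ‖Q₂ t‖ ≤ 13 * A * (1 - t)⁻¹ ^ (5 - 2 * γ)
  isB : IsB f g
  norm_f : ‖f‖ ≤ R
  norm_g : ‖g‖ ≤ R

/-- The constant in the bound for `y_t`. -/
noncomputable def constT (γ A c R : ℝ) : ℝ := (R + A * R) / c + 3 * A * R / (c * (2 - γ))

/-- The constant in the bound for `y_k`. -/
noncomputable def constK (γ A c R : ℝ) : ℝ := constT γ A c R / (c * (1 - γ))

/-- The constant in the bound for `y_tt`, where `R'` bounds the norm of `B (B f + q(0) f)`. -/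
noncomputable def constTT (γ A c R R' : ℝ) : ℝ :=
  (R' / c + A * ((R + A * R) / c) + 3 * A * R) / c +
    32 * (6 * A * constT γ A c R + 13 * A * R) / (c * (4 - 2 * γ))

/-- The constant in the bound for `y_tk`. -/
noncomputable def constTK (γ A c R R' : ℝ) : ℝ :=
  (R + A * R) / c / c + (constTT γ A c R R' + 3 * A * constK γ A c R) / (c * (3 - 2 * γ))

/-- The constant in the bound for `y_kk`. -/
noncomputable def constKK (γ A c R R' : ℝ) : ℝ := 2 * constTK γ A c R R' / (c * (2 - 2 * γ))

namespace BoundedSolution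

variable {γ A c R T : ℝ} {Q Q₁ Q₂ : ℝ → C(S2, ℝ)} {f g : L2S} {u : ℝ × ℝ → L2S}

theorem norm_radius_nonneg (h : BoundedSolution γ A c R T Q Q₁ Q₂ f g u) : 0 ≤ R :=
  (norm_nonneg _).trans h.norm_f

theorem constT_nonneg (h : BoundedSolution γ A c R T Q Q₁ Q₂ f g u) : 0 ≤ constT γ A c R := by
  have := h.norm_radius_nonneg
  have := h.nonneg
  have := h.pos
  have : 0 < 2 - γ := by linarith [h.lt_one]
  unfold constT
  positivity

theorem constK_nonneg (h : BoundedSolution γ A c R T Q Q₁ Q₂ f g u) : 0 ≤ constK γ A c R := by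
  have := h.constT_nonneg
  have := h.pos
  have : 0 < 1 - γ := by linarith [h.lt_one]
  unfold constK
  positivity

theorem constTT_nonneg (h : BoundedSolution γ A c R T Q Q₁ Q₂ f g u) {R' : ℝ} (hR : 0 ≤ R') :
    0 ≤ constTT γ A c R R' := by
  have := h.constT_nonneg
  have := h.norm_radius_nonneg
  have := h.nonneg
  have := h.pos
  have : 0 < 4 - 2 * γ := by linarith [h.lt_one]
  unfold constTT
  positivity

theorem constTK_nonneg (h : BoundedSolution γ A c R T Q Q₁ Q₂ f g u) {R' : ℝ} (hR : 0 ≤ R') :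
    0 ≤ constTK γ A c R R' := by
  have := h.constK_nonneg
  have := h.constTT_nonneg hR
  have := h.norm_radius_nonneg
  have := h.nonneg
  have := h.pos
  have : 0 < 3 - 2 * γ := by linarith [h.lt_one]
  unfold constTK
  positivity

theorem norm_le (h : BoundedSolution γ A c R T Q Q₁ Q₂ f g u) {k t : ℝ} (hk : c ≤ k)
    (ht : t ∈ Icc 0 T) : ‖u (t, k)‖ ≤ R := by
  have hk0 := h.pos.trans_le hk
  have := norm_le_of_energy (u := fun s => u (s, k)) (u' := fun s => pd₁ u (s, k)) (g := fun _ => 0)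
    (q := Q) (p := 1) h.pos hk one_pos le_rfl ht.1 (ht.2.trans_lt h.horizon)
    (fun s _ => h.isSolution.hasDerivAt₁ hk0 s)
    (fun s _ => by rw [sub_zero]; exact h.isSolution.isB s k hk0) (fun s _ => by simp)
  rw [h.isSolution.initial k hk0] at this
  simpa using this.trans (by simpa using h.norm_f)

/-- The value of `y_t` at the initial time, from the equation. -/
theorem smul_pd₁_zero (h : BoundedSolution γ A c R T Q Q₁ Q₂ f g u) {k : ℝ} (hk : 0 < k) :
    (Complex.I * k) • pd₁ u (0, k) = g + mulOp (Q 0) f := by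
  have h1 := h.isSolution.isB 0 k hk
  rw [h.isSolution.initial k hk] at h1
  exact sub_eq_iff_eq_add.1 (h1.unique h.isB)

theorem norm_le_of_smul_eq {k : ℝ} (hc : 0 < c) (hk : c ≤ k) {x y : L2S} {D : ℝ}
    (e : (Complex.I * k) • x = y) (hy : ‖y‖ ≤ D) : ‖x‖ ≤ D / c := by
  have hk0 := hc.trans_le hk
  rw [le_div_iff₀ hc]
  have h1 : ‖y‖ = k * ‖x‖ := by
    rw [← e, norm_smul, norm_mul, Complex.norm_I, one_mul, Complex.norm_real,
      Real.norm_of_nonneg hk0.le]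
  nlinarith [norm_nonneg x]

theorem norm_pd₁_zero_le (h : BoundedSolution γ A c R T Q Q₁ Q₂ f g u) {k : ℝ} (hk : c ≤ k) :
    ‖pd₁ u (0, k)‖ ≤ (R + A * R) / c := by
  refine norm_le_of_smul_eq h.pos hk (h.smul_pd₁_zero (h.pos.trans_le hk)) ?_
  refine (norm_add_le _ _).trans (add_le_add h.norm_g ((norm_mulOp_apply_le _ _).trans ?_))
  exact mul_le_mul h.norm_potential_zero h.norm_f (norm_nonneg _) h.nonneg

theorem one_le (h : BoundedSolution γ A c R T Q Q₁ Q₂ f g u) {t : ℝ} (ht : t ∈ Icc 0 T) :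
    1 ≤ (1 - t)⁻¹ := one_le_inv_one_sub ht.1 (ht.2.trans_lt h.horizon)

theorem add_mul_rpow_le {x D E p : ℝ} (hx : 1 ≤ x) (hD : 0 ≤ D) (hp : 0 ≤ p) :
    D + E * x ^ p ≤ (D + E) * x ^ p := by
  have := Real.one_le_rpow hx hp
  nlinarith

/-- The time derivative: the source in its equation is `q_t y`. -/
theorem norm_pd₁_le (h : BoundedSolution γ A c R T Q Q₁ Q₂ f g u) {k t : ℝ} (hk : c ≤ k)
    (ht : t ∈ Icc 0 T) : ‖pd₁ u (t, k)‖ ≤ constT γ A c R * (1 - t)⁻¹ ^ (2 - γ) := by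
  have hk0 := h.pos.trans_le hk
  have hR := h.norm_radius_nonneg
  have hp : 0 < 2 - γ := by linarith [h.lt_one]
  have hA := h.nonneg
  have hc := h.pos
  have key := norm_le_of_energy (u := fun s => pd₁ u (s, k)) (u' := fun s => pd₁ (pd₁ u) (s, k))
    (g := fun s => mulOp (Q₁ s) (u (s, k))) (q := Q) (p := 2 - γ) (C := 3 * A * R) h.pos hk hp
    (by positivity) ht.1 (ht.2.trans_lt h.horizon)
    (fun s _ => h.isSolution.hasDerivAt₁₁ hk0 s) (fun s _ => h.isSolution.isB_pd₁ hk0 s)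
    (fun s hs => by
      have hs' : s ∈ Icc 0 T := ⟨hs.1, hs.2.trans ht.2⟩
      refine (norm_mulOp_apply_le _ _).trans ?_
      refine (mul_le_mul (h.norm_fst s hs') (h.norm_le hk hs') (norm_nonneg _) ?_).trans_eq ?_
      · exact (norm_nonneg _).trans (h.norm_fst s hs')
      · rw [show 2 - γ + 1 = 3 - γ by ring]
        ring)
  refine key.trans ((add_le_add_left (h.norm_pd₁_zero_le hk) _).trans ?_)
  exact add_mul_rpow_le (h.one_le ht) (by positivity) hp.le

theorem pd₂_zero (h : BoundedSolution γ A c R T Q Q₁ Q₂ f g u) {k : ℝ} (hk : 0 < k) :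
    pd₂ u (0, k) = 0 := by
  refine (h.isSolution.hasDerivAt₂ hk 0).unique ((hasDerivAt_const k f).congr_of_eventuallyEq ?_)
  filter_upwards [Ioi_mem_nhds hk] with κ hκ
  exact h.isSolution.initial κ hκ

/-- The derivative in `k`: it vanishes initially, and the source in its equation is `-i y_t`. -/
theorem norm_pd₂_le (h : BoundedSolution γ A c R T Q Q₁ Q₂ f g u) {k t : ℝ} (hk : c ≤ k)
    (ht : t ∈ Icc 0 T) : ‖pd₂ u (t, k)‖ ≤ constK γ A c R * (1 - t)⁻¹ ^ (1 - γ) := by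
  have hk0 := h.pos.trans_le hk
  have hp : 0 < 1 - γ := by linarith [h.lt_one]
  have key := norm_le_of_energy (u := fun s => pd₂ u (s, k)) (u' := fun s => pd₂ (pd₁ u) (s, k))
    (g := fun s => -(Complex.I • pd₁ u (s, k))) (q := Q) (p := 1 - γ) (C := constT γ A c R)
    h.pos hk hp h.constT_nonneg ht.1 (ht.2.trans_lt h.horizon)
    (fun s _ => h.isSolution.hasDerivAt₁₂ hk0 s)
    (fun s _ => by
      have := h.isSolution.isB_pd₂ hk0 s
      rwa [add_sub_right_comm, ← sub_neg_eq_add] at this)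
    (fun s hs => by
      rw [norm_neg, norm_smul, Complex.norm_I, one_mul, show 1 - γ + 1 = 2 - γ by ring]
      exact h.norm_pd₁_le hk ⟨hs.1, hs.2.trans ht.2⟩)
  rw [h.pd₂_zero hk0, norm_zero, zero_add] at key
  exact key

/-- At the initial time, `i k y_tt = B y_t + q y_t + q_t y`, and `i k y_t = B f + q(0) f` is in the
domain of `B`. -/
theorem norm_pd₁_pd₁_zero_le (h : BoundedSolution γ A c R T Q Q₁ Q₂ f g u) (hT : 0 ≤ T) {g' : L2S}
    {R' : ℝ} (hg : IsB (g + mulOp (Q 0) f) g') (hR' : ‖g'‖ ≤ R') {k : ℝ} (hk : c ≤ k) :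
    ‖pd₁ (pd₁ u) (0, k)‖ ≤ (R' / c + A * ((R + A * R) / c) + 3 * A * R) / c := by
  have hk0 := h.pos.trans_le hk
  have hkc : Complex.I * (k : ℂ) ≠ 0 :=
    mul_ne_zero Complex.I_ne_zero (by exact_mod_cast hk0.ne')
  have e1 : pd₁ u (0, k) = (Complex.I * (k : ℂ))⁻¹ • (g + mulOp (Q 0) f) := by
    rw [← h.smul_pd₁_zero hk0, smul_smul, inv_mul_cancel₀ hkc, one_smul]
  have h1 := h.isSolution.isB_pd₁ hk0 0
  have h2 := hg.smul (Complex.I * (k : ℂ))⁻¹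
  rw [← e1] at h2
  have e2 : (Complex.I * k) • pd₁ (pd₁ u) (0, k) = (Complex.I * (k : ℂ))⁻¹ • g' +
      mulOp (Q 0) (pd₁ u (0, k)) + mulOp (Q₁ 0) (u (0, k)) := by
    rw [← h1.unique h2]
    abel
  have h0 : (0 : ℝ) ∈ Icc 0 T := ⟨le_rfl, hT⟩
  refine norm_le_of_smul_eq h.pos hk e2 ((norm_add₃_le).trans (add_le_add (add_le_add ?_ ?_) ?_))
  · refine norm_le_of_smul_eq h.pos hk (y := g') ?_ hR'
    rw [smul_smul, mul_inv_cancel₀ hkc, one_smul]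
  · exact (norm_mulOp_apply_le _ _).trans
      (mul_le_mul h.norm_potential_zero (h.norm_pd₁_zero_le hk) (norm_nonneg _) h.nonneg)
  · have h3 := h.norm_fst 0 h0
    have h4 : ‖Q₁ 0‖ ≤ 3 * A := by simpa using h3
    exact (norm_mulOp_apply_le _ _).trans
      (mul_le_mul h4 (h.norm_le hk h0) (norm_nonneg _) (by linarith [h.nonneg]))

theorem rpow_le_two_pow_mul {x y p : ℝ} (hy : 0 ≤ y) (hx : 1 ≤ x) (hyx : y ≤ 2 * x) (hp : 0 ≤ p)
    (hp5 : p ≤ 5) : y ^ p ≤ 32 * x ^ p := by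
  calc y ^ p ≤ (2 * x) ^ p := Real.rpow_le_rpow hy hyx hp
    _ = 2 ^ p * x ^ p := Real.mul_rpow zero_le_two (by linarith)
    _ ≤ 2 ^ (5 : ℝ) * x ^ p := by
        have := Real.rpow_nonneg (zero_le_one.trans hx) p
        gcongr
        norm_num
    _ = 32 * x ^ p := by norm_num

/-- The second time derivative.  The differences `y_t(s + ε) - y_t(s)` solve the equation with the
source `(q(s + ε) - q(s)) y_t(s + ε) + (q_t y)(s + ε) - (q_t y)(s)`. -/
theorem norm_pd₁_pd₁_le (h : BoundedSolution γ A c R T Q Q₁ Q₂ f g u) {g' : L2S}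
    {R' : ℝ} (hg : IsB (g + mulOp (Q 0) f) g') (hR' : ‖g'‖ ≤ R') {k t : ℝ} (hk : c ≤ k)
    (ht : t ∈ Ico 0 T) :
    ‖pd₁ (pd₁ u) (t, k)‖ ≤ constTT γ A c R R' * (1 - t)⁻¹ ^ (4 - 2 * γ) := by
  have hk0 := h.pos.trans_le hk
  have hR := h.norm_radius_nonneg
  have hA := h.nonneg
  have hc := h.pos
  have hCT := h.constT_nonneg
  have hp : 0 < 4 - 2 * γ := by linarith [h.lt_one]
  have ht1 : t < 1 := ht.2.trans h.horizon
  have htT : t ∈ Icc 0 T := ⟨ht.1, ht.2.le⟩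
  set C := 32 * (6 * A * constT γ A c R + 13 * A * R) with hC
  have hC0 : 0 ≤ C := by positivity
  have key := norm_le_of_energy_limit (q := Q) (t₀ := t) (p := 4 - 2 * γ) (C := C)
    (d := fun ε s => pd₁ u (s + ε, k) - pd₁ u (s, k))
    (d' := fun ε s => pd₁ (pd₁ u) (s + ε, k) - pd₁ (pd₁ u) (s, k))
    (g := fun ε s => mulOp (Q (s + ε) - Q s) (pd₁ u (s + ε, k)) +
      (mulOp (Q₁ (s + ε)) (u (s + ε, k)) - mulOp (Q₁ s) (u (s, k))))
    (z := pd₁ (pd₁ u) (t, k)) (z₀ := pd₁ (pd₁ u) (0, k)) h.pos hk hp hC0 ht.1 ht1 ?_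
    (h.isSolution.hasDerivAt₁₁ hk0 t).tendsto_slope_zero_right
    (h.isSolution.hasDerivAt₁₁ hk0 0).tendsto_slope_zero_right
  · refine key.trans ((add_le_add_left
      (h.norm_pd₁_pd₁_zero_le (ht.1.trans ht.2.le) hg hR' hk) _).trans ?_)
    have hR'0 : 0 ≤ R' := (norm_nonneg _).trans hR'
    exact add_mul_rpow_le (h.one_le htT) (by positivity) hp.le
  · have hδ : 0 < min (T - t) ((1 - t) / 2) := lt_min (by linarith [ht.2]) (by linarith)
    filter_upwards [Ioo_mem_nhdsGT hδ] with ε hε s hs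
    have hε0 : 0 < ε := hε.1
    have hε1 : ε < T - t := hε.2.trans_le (min_le_left _ _)
    have hε2 : ε < (1 - t) / 2 := hε.2.trans_le (min_le_right _ _)
    have hs1 : s < 1 := hs.2.trans_lt ht1
    set x := (1 - s)⁻¹ with hx
    have hx1 : 1 ≤ x := one_le_inv_one_sub hs.1 hs1
    have hx0 : 0 < x := one_pos.trans_le hx1
    -- on the short interval the time variable changes at most by a factor of two
    have hmem : ∀ r ∈ Icc s (s + ε), r ∈ Icc 0 T ∧ 0 ≤ (1 - r)⁻¹ ∧ (1 - r)⁻¹ ≤ 2 * x := by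
      intro r hr
      have hr1 : r < 1 := by linarith [hr.2, hs.2, h.horizon]
      refine ⟨⟨hs.1.trans hr.1, by linarith [hr.2, hs.2]⟩, inv_nonneg.2 (by linarith), ?_⟩
      have e : 2 * x = ((1 - s) / 2)⁻¹ := by rw [hx]; field_simp
      rw [e]
      exact inv_anti₀ (by linarith) (by linarith [hr.2, hs.2])
    have hpow : ∀ {y p q : ℝ}, x ^ p * x ^ q = x ^ (p + q) := fun {_ p q} =>
      (Real.rpow_add hx0 p q).symm
    have htwo : ∀ r ∈ Icc s (s + ε), ∀ p q : ℝ, p + q = 5 - 2 * γ →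
        (1 - r)⁻¹ ^ p * (1 - r)⁻¹ ^ q ≤ 32 * x ^ (5 - 2 * γ) := by
      intro r hr p q hpq
      obtain ⟨hrT, hr0, hr2⟩ := hmem r hr
      have := h.one_le hrT
      rw [← Real.rpow_add (by linarith), hpq]
      exact rpow_le_two_pow_mul hr0 hx1 hr2 (by linarith [h.lt_one]) (by linarith [h.half_lt])
    refine ⟨?_, ?_, ?_⟩
    · have h1 := (h.isSolution.hasDerivAt₁₁ hk0 (s + ε)).comp_add_const s ε
      exact h1.sub (h.isSolution.hasDerivAt₁₁ hk0 s)
    · have h1 := (h.isSolution.isB_pd₁ hk0 (s + ε)).sub (h.isSolution.isB_pd₁ hk0 s)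
      convert h1 using 1
      simp only [map_sub, smul_sub, sub_apply]
      abel
    · have hend : s + ε ∈ Icc s (s + ε) := ⟨by linarith, le_rfl⟩
      -- the increment of the potential
      have b1 : ‖mulOp (Q (s + ε) - Q s) (pd₁ u (s + ε, k))‖ ≤
          ε * (3 * A * constT γ A c R * (32 * x ^ (5 - 2 * γ))) := by
        set y := (1 - (s + ε))⁻¹ with hy
        have hyT := (hmem _ hend).1
        have hQ : ‖Q (s + ε) - Q s‖ ≤ 3 * A * y ^ (3 - γ) * (s + ε - s) := by
          refine norm_image_sub_le_of_norm_deriv_le_segment' (f' := Q₁)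
            (fun r _ => (h.isSolution.hasDerivAt r).hasDerivWithinAt) (fun r hr => ?_) _ hend
          have hr' : r ∈ Icc s (s + ε) := ⟨hr.1, hr.2.le⟩
          refine (h.norm_fst r (hmem r hr').1).trans ?_
          have a1 : (1 - r)⁻¹ ≤ y := inv_anti₀ (by linarith [hyT.2, h.horizon]) (by linarith [hr.2])
          have a2 : (1 - r)⁻¹ ^ (3 - γ) ≤ y ^ (3 - γ) :=
            Real.rpow_le_rpow (hmem r hr').2.1 a1 (by linarith [h.lt_one])
          nlinarith
        have hY := h.norm_pd₁_le hk hyT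
        have hy32 := htwo _ hend (3 - γ) (2 - γ) (by ring)
        have hy0 : 0 ≤ y := (hmem _ hend).2.1
        calc ‖mulOp (Q (s + ε) - Q s) (pd₁ u (s + ε, k))‖ ≤
            (3 * A * y ^ (3 - γ) * (s + ε - s)) * (constT γ A c R * y ^ (2 - γ)) :=
              (norm_mulOp_apply_le _ _).trans
                (mul_le_mul hQ hY (norm_nonneg _) ((norm_nonneg _).trans hQ))
          _ = ε * (3 * A * constT γ A c R) * (y ^ (3 - γ) * y ^ (2 - γ)) := by ring
          _ ≤ ε * (3 * A * constT γ A c R) * (32 * x ^ (5 - 2 * γ)) := by gcongr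
          _ = _ := by ring
      -- the increment of the source
      have b2 : ‖mulOp (Q₁ (s + ε)) (u (s + ε, k)) - mulOp (Q₁ s) (u (s, k))‖ ≤
          (13 * A * R + 3 * A * constT γ A c R) * (32 * x ^ (5 - 2 * γ)) * (s + ε - s) := by
        refine norm_image_sub_le_of_norm_deriv_le_segment' (f := fun r => mulOp (Q₁ r) (u (r, k)))
          (fun r _ => (IsSolution.hasDerivAt_mulOp (h.hasDerivAt_snd r)
            (h.isSolution.hasDerivAt₁ hk0 r)).hasDerivWithinAt) (fun r hr => ?_) _ hend
        have hr' : r ∈ Icc s (s + ε) := ⟨hr.1, hr.2.le⟩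
        have hrT := (hmem r hr').1
        have hr0 := (hmem r hr').2.1
        have c1 := htwo r hr' (5 - 2 * γ) 0 (by ring)
        rw [Real.rpow_zero, mul_one] at c1
        have c2 := htwo r hr' (3 - γ) (2 - γ) (by ring)
        have c3 : ‖mulOp (Q₂ r) (u (r, k))‖ ≤ 13 * A * (1 - r)⁻¹ ^ (5 - 2 * γ) * R :=
          (norm_mulOp_apply_le _ _).trans (mul_le_mul (h.norm_snd r hrT) (h.norm_le hk hrT)
            (norm_nonneg _) ((norm_nonneg _).trans (h.norm_snd r hrT)))
        have c4 : ‖mulOp (Q₁ r) (pd₁ u (r, k))‖ ≤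
            3 * A * (1 - r)⁻¹ ^ (3 - γ) * (constT γ A c R * (1 - r)⁻¹ ^ (2 - γ)) :=
          (norm_mulOp_apply_le _ _).trans (mul_le_mul (h.norm_fst r hrT) (h.norm_pd₁_le hk hrT)
            (norm_nonneg _) ((norm_nonneg _).trans (h.norm_fst r hrT)))
        calc _ ≤ 13 * A * (1 - r)⁻¹ ^ (5 - 2 * γ) * R +
            3 * A * (1 - r)⁻¹ ^ (3 - γ) * (constT γ A c R * (1 - r)⁻¹ ^ (2 - γ)) :=
              (norm_add_le _ _).trans (add_le_add c3 c4)
          _ = 13 * A * R * (1 - r)⁻¹ ^ (5 - 2 * γ) +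
              3 * A * constT γ A c R * ((1 - r)⁻¹ ^ (3 - γ) * (1 - r)⁻¹ ^ (2 - γ)) := by ring
          _ ≤ 13 * A * R * (32 * x ^ (5 - 2 * γ)) +
              3 * A * constT γ A c R * (32 * x ^ (5 - 2 * γ)) := by gcongr
          _ = _ := by ring
      refine (norm_add_le _ _).trans ((add_le_add b1 b2).trans_eq ?_)
      rw [hC, show 4 - 2 * γ + 1 = 5 - 2 * γ by ring]
      ring

/-- At the initial time `i k y_t = B f + q(0) f` does not depend on `k`. -/
theorem norm_pd₂_pd₁_zero_le (h : BoundedSolution γ A c R T Q Q₁ Q₂ f g u) {k : ℝ} (hk : c ≤ k) :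
    ‖pd₂ (pd₁ u) (0, k)‖ ≤ (R + A * R) / c / c := by
  have hk0 := h.pos.trans_le hk
  have hI : HasDerivAt (fun κ : ℝ => Complex.I * (κ : ℂ)) Complex.I k := by
    simpa using (Complex.ofRealCLM.hasDerivAt (x := k)).const_mul Complex.I
  have h1 := hI.smul (h.isSolution.hasDerivAt₂₁ hk0 0)
  have h2 : HasDerivAt (fun κ : ℝ => (Complex.I * (κ : ℂ)) • pd₁ u (0, κ)) 0 k := by
    refine (hasDerivAt_const k (g + mulOp (Q 0) f)).congr_of_eventuallyEq ?_
    filter_upwards [Ioi_mem_nhds hk0] with κ hκ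
    exact h.smul_pd₁_zero hκ
  have h3 := eq_neg_of_add_eq_zero_left (h1.unique h2)
  refine norm_le_of_smul_eq h.pos hk h3 ?_
  rw [norm_neg, norm_smul, Complex.norm_I, one_mul]
  exact h.norm_pd₁_zero_le hk

/-- The mixed derivative.  The differences of `y_t` in `k` solve the equation with the source
`-i ε y_tt(k + ε) + q_t (y(k + ε) - y(k))`. -/
theorem norm_pd₂_pd₁_le (h : BoundedSolution γ A c R T Q Q₁ Q₂ f g u) {g' : L2S}
    {R' : ℝ} (hg : IsB (g + mulOp (Q 0) f) g') (hR' : ‖g'‖ ≤ R') {k t : ℝ} (hk : c ≤ k)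
    (ht : t ∈ Ico 0 T) :
    ‖pd₂ (pd₁ u) (t, k)‖ ≤ constTK γ A c R R' * (1 - t)⁻¹ ^ (3 - 2 * γ) := by
  have hk0 := h.pos.trans_le hk
  have hR := h.norm_radius_nonneg
  have hR'0 : 0 ≤ R' := (norm_nonneg _).trans hR'
  have hA := h.nonneg
  have hc := h.pos
  have hCK := h.constK_nonneg
  have hCTT := h.constTT_nonneg hR'0
  have hp : 0 < 3 - 2 * γ := by linarith [h.lt_one]
  have ht1 : t < 1 := ht.2.trans h.horizon
  have htT : t ∈ Icc 0 T := ⟨ht.1, ht.2.le⟩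
  have key := norm_le_of_energy_limit (q := Q) (t₀ := t) (p := 3 - 2 * γ)
    (C := constTT γ A c R R' + 3 * A * constK γ A c R)
    (d := fun ε s => pd₁ u (s, k + ε) - pd₁ u (s, k))
    (d' := fun ε s => pd₁ (pd₁ u) (s, k + ε) - pd₁ (pd₁ u) (s, k))
    (g := fun ε s => -((Complex.I * ε) • pd₁ (pd₁ u) (s, k + ε)) +
      mulOp (Q₁ s) (u (s, k + ε) - u (s, k)))
    (z := pd₂ (pd₁ u) (t, k)) (z₀ := pd₂ (pd₁ u) (0, k)) h.pos hk hp (by positivity) ht.1 ht1 ?_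
    (h.isSolution.hasDerivAt₂₁ hk0 t).tendsto_slope_zero_right
    (h.isSolution.hasDerivAt₂₁ hk0 0).tendsto_slope_zero_right
  · refine key.trans ((add_le_add_left (h.norm_pd₂_pd₁_zero_le hk) _).trans ?_)
    exact add_mul_rpow_le (h.one_le htT) (by positivity) hp.le
  · filter_upwards [self_mem_nhdsWithin] with ε (hε : 0 < ε) s hs
    have hkε : c ≤ k + ε := by linarith
    have hsT : s ∈ Ico 0 T := ⟨hs.1, hs.2.trans_lt ht.2⟩
    have hsT' : s ∈ Icc 0 T := ⟨hs.1, hsT.2.le⟩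
    have hx1 := h.one_le hsT'
    set x := (1 - s)⁻¹ with hx
    have hx0 : 0 < x := one_pos.trans_le hx1
    refine ⟨?_, ?_, ?_⟩
    · exact (h.isSolution.hasDerivAt₁₁ (by linarith) s).sub (h.isSolution.hasDerivAt₁₁ hk0 s)
    · have h1 := (h.isSolution.isB_pd₁ (k := k + ε) (by linarith) s).sub
        (h.isSolution.isB_pd₁ hk0 s)
      convert h1 using 1
      simp only [map_sub, smul_sub, Complex.ofReal_add, mul_add, add_smul]
      abel
    · have b1 : ‖(Complex.I * ε) • pd₁ (pd₁ u) (s, k + ε)‖ ≤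
          ε * (constTT γ A c R R' * x ^ (4 - 2 * γ)) := by
        rw [norm_smul, norm_mul, Complex.norm_I, one_mul, Complex.norm_real,
          Real.norm_of_nonneg hε.le]
        exact mul_le_mul_of_nonneg_left (h.norm_pd₁_pd₁_le hg hR' hkε hsT) hε.le
      have b2 : ‖u (s, k + ε) - u (s, k)‖ ≤ constK γ A c R * x ^ (1 - γ) * (k + ε - k) :=
        norm_image_sub_le_of_norm_deriv_le_segment' (f := fun κ => u (s, κ))
          (fun r hr => (h.isSolution.hasDerivAt₂ (by linarith [hr.1]) s).hasDerivWithinAt)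
          (fun r hr => h.norm_pd₂_le (hk.trans hr.1) hsT') _ ⟨by linarith, le_rfl⟩
      have b3 : ‖mulOp (Q₁ s) (u (s, k + ε) - u (s, k))‖ ≤
          ε * (3 * A * constK γ A c R * x ^ (4 - 2 * γ)) := by
        refine (norm_mulOp_apply_le _ _).trans ((mul_le_mul (h.norm_fst s hsT') b2 (norm_nonneg _)
          ((norm_nonneg _).trans (h.norm_fst s hsT'))).trans_eq ?_)
        rw [show 4 - 2 * γ = (3 - γ) + (1 - γ) by ring, Real.rpow_add hx0]
        ring
      refine (norm_add_le _ _).trans ?_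
      rw [norm_neg, show 3 - 2 * γ + 1 = 4 - 2 * γ by ring]
      exact (add_le_add b1 b3).trans_eq (by ring)

/-- The second derivative in `k`.  The differences of `y_k` in `k` solve the equation with the
source `-i ε y_tk(k + ε) - i (y_t(k + ε) - y_t(k))`. -/
theorem norm_pd₂_pd₂_le (h : BoundedSolution γ A c R T Q Q₁ Q₂ f g u) {g' : L2S}
    {R' : ℝ} (hg : IsB (g + mulOp (Q 0) f) g') (hR' : ‖g'‖ ≤ R') {k t : ℝ} (hk : c ≤ k)
    (ht : t ∈ Ico 0 T) :
    ‖pd₂ (pd₂ u) (t, k)‖ ≤ constKK γ A c R R' * (1 - t)⁻¹ ^ (2 - 2 * γ) := by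
  have hk0 := h.pos.trans_le hk
  have hR'0 : 0 ≤ R' := (norm_nonneg _).trans hR'
  have hCTK := h.constTK_nonneg hR'0
  have hp : 0 < 2 - 2 * γ := by linarith [h.lt_one]
  have ht1 : t < 1 := ht.2.trans h.horizon
  have hz₀ : Tendsto (fun ε : ℝ => ε⁻¹ • (pd₂ u (0, k + ε) - pd₂ u (0, k))) (𝓝[>] 0) (𝓝 0) := by
    refine tendsto_const_nhds.congr' ?_
    filter_upwards [self_mem_nhdsWithin] with ε (hε : 0 < ε)
    rw [h.pd₂_zero hk0, h.pd₂_zero (k := k + ε) (by linarith), sub_zero, smul_zero]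
  have key := norm_le_of_energy_limit (q := Q) (t₀ := t) (p := 2 - 2 * γ)
    (C := 2 * constTK γ A c R R')
    (d := fun ε s => pd₂ u (s, k + ε) - pd₂ u (s, k))
    (d' := fun ε s => pd₂ (pd₁ u) (s, k + ε) - pd₂ (pd₁ u) (s, k))
    (g := fun ε s => -((Complex.I * ε) • pd₂ (pd₁ u) (s, k + ε) +
      Complex.I • (pd₁ u (s, k + ε) - pd₁ u (s, k))))
    (z := pd₂ (pd₂ u) (t, k)) (z₀ := 0) h.pos hk hp (by positivity) ht.1 ht1 ?_
    (h.isSolution.hasDerivAt₂₂ hk0 t).tendsto_slope_zero_right hz₀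
  · rw [norm_zero, zero_add] at key
    exact key
  · filter_upwards [self_mem_nhdsWithin] with ε (hε : 0 < ε) s hs
    have hkε : c ≤ k + ε := by linarith
    have hsT : s ∈ Ico 0 T := ⟨hs.1, hs.2.trans_lt ht.2⟩
    refine ⟨?_, ?_, ?_⟩
    · exact (h.isSolution.hasDerivAt₁₂ (by linarith) s).sub (h.isSolution.hasDerivAt₁₂ hk0 s)
    · have h1 := (h.isSolution.isB_pd₂ (k := k + ε) (by linarith) s).sub
        (h.isSolution.isB_pd₂ hk0 s)
      convert h1 using 1
      simp only [map_sub, smul_sub, Complex.ofReal_add, mul_add, add_smul]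
      abel
    · have b1 : ‖(Complex.I * ε) • pd₂ (pd₁ u) (s, k + ε)‖ ≤
          ε * (constTK γ A c R R' * (1 - s)⁻¹ ^ (3 - 2 * γ)) := by
        rw [norm_smul, norm_mul, Complex.norm_I, one_mul, Complex.norm_real,
          Real.norm_of_nonneg hε.le]
        exact mul_le_mul_of_nonneg_left (h.norm_pd₂_pd₁_le hg hR' hkε hsT) hε.le
      have b2 : ‖pd₁ u (s, k + ε) - pd₁ u (s, k)‖ ≤
          constTK γ A c R R' * (1 - s)⁻¹ ^ (3 - 2 * γ) * (k + ε - k) :=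
        norm_image_sub_le_of_norm_deriv_le_segment' (f := fun κ => pd₁ u (s, κ))
          (fun r hr => (h.isSolution.hasDerivAt₂₁ (by linarith [hr.1]) s).hasDerivWithinAt)
          (fun r hr => h.norm_pd₂_pd₁_le hg hR' (hk.trans hr.1) hsT) _ ⟨by linarith, le_rfl⟩
      rw [norm_neg, show 2 - 2 * γ + 1 = 3 - 2 * γ by ring]
      refine (norm_add_le _ _).trans ?_
      rw [norm_smul Complex.I (pd₁ u (s, k + ε) - pd₁ u (s, k)), Complex.norm_I, one_mul]
      exact (add_le_add b1 b2).trans_eq (by ring)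

end BoundedSolution

end Estimates

/-! ### The propagator -/

section Propagator

theorem CondA1.contDiffOn_one {γ A : ℝ} {V : ℝ → S2 → ℝ} (hV : CondA1 γ A V) :
    ContDiffOn ℝ 2 (radialExt (V 1)) {0}ᶜ :=
  hV.contDiff.comp (contDiff_const.prodMk contDiff_id :
      ContDiff ℝ 2 fun x : E3 => ((1 : ℝ), x)).contDiffOn
    fun _ hx => ⟨self_mem_Ici, hx⟩

theorem exists_c2Bound {v : S2 → ℝ} (hv : ContDiffOn ℝ 2 (radialExt v) {0}ᶜ) :
    ∃ M, C2Bound M v := by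
  have ho : IsOpen ({0}ᶜ : Set E3) := isOpen_compl_singleton
  have key : ∀ j : Fin 3, ∃ M, ∀ θ : S2, ‖iteratedFDeriv ℝ j (radialExt v) (θ : E3)‖ ≤ M := by
    intro j
    have h1 : ContinuousOn (iteratedFDeriv ℝ j (radialExt v)) {0}ᶜ :=
      (hv.continuousOn_iteratedFDerivWithin (m := j) (by exact_mod_cast Nat.lt_succ_iff.1 j.2)
        ho.uniqueDiffOn).congr fun x hx => (iteratedFDerivWithin_of_isOpen j ho hx).symm
    have h2 : Continuous fun θ : S2 => iteratedFDeriv ℝ j (radialExt v) (θ : E3) :=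
      h1.comp_continuous continuous_subtype_val coe_ne_zero
    obtain ⟨M, hM⟩ := (isCompact_univ (X := S2)).exists_bound_of_continuousOn h2.continuousOn
    exact ⟨M, fun θ => hM θ (mem_univ θ)⟩
  choose M hM using key
  refine ⟨∑ j, |M j|, fun j hj θ => ?_⟩
  refine (hM ⟨j, Nat.lt_succ_iff.2 hj⟩ θ).trans ((le_abs_self _).trans ?_)
  exact Finset.single_le_sum (f := fun j => |M j|) (fun j _ => abs_nonneg _) (Finset.mem_univ _)

theorem CondA1.nonneg {γ A : ℝ} {V : ℝ → S2 → ℝ} (hV : CondA1 γ A V) : 0 ≤ A := by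
  have h := hV.bound 1 le_rfl ⟨EuclideanSpace.single 0 1, by simp⟩
  rw [Real.one_rpow, mul_one] at h
  exact (abs_nonneg _).trans h.le

/-- On `[1, 2 τ₀]` the propagator is given by a solution in the variables `(1 - 1/τ, k)`, with
bounds that do not depend on `τ₀`.  The end point `2 τ₀` leaves room to the right of `τ₀` for
derivatives. -/
theorem exists_boundedSolution {γ A R M a : ℝ} {V : ℝ → S2 → ℝ} (hV : CondA1 γ A V)
    (hM : C2Bound M (V 1)) {f : L2S} (hf : MemH4 f) (hR : normH4 f ≤ R) (ha : 0 < a) {τ₀ : ℝ}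
    (hτ₀ : 1 ≤ τ₀) : ∃ (Q Q₁ Q₂ : ℝ → C(S2, ℝ)) (g g' : L2S) (u : ℝ × ℝ → L2S),
      BoundedSolution γ A a R (1 - 1 / (2 * τ₀)) Q Q₁ Q₂ f g u ∧
      IsB (g + mulOp (Q 0) f) g' ∧ ‖g'‖ ≤ R + 20 * M * R ∧
      ∀ k, 0 < k → ∀ τ, 1 ≤ τ → τ ≤ 2 * τ₀ → W V f k τ = u (1 - 1 / τ, k) := by
  obtain ⟨g, hg, g₂, hg₂⟩ := hf
  obtain ⟨n0, n1, n2⟩ := norm_le_normH4 hg hg₂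
  have hτ0 : 0 < τ₀ := one_pos.trans_le hτ₀
  set T := 1 - 1 / (2 * τ₀) with hT
  have hT1 : T < 1 := by
    have : 0 < 1 / (2 * τ₀) := by positivity
    linarith
  have hT0 : 0 ≤ T := by
    rw [hT, sub_nonneg, div_le_one (by positivity)]
    linarith
  obtain ⟨Q, Q₁, Q₂, hQ, hQ₁, hQ₂, hb⟩ := hV.exists_potential hT0 hT1
  have h0 : (0 : ℝ) ∈ Icc 0 T := ⟨le_rfl, hT0⟩
  have hQ0 : ∀ θ, Q 0 θ = V 1 θ := fun θ => by simpa using (hb 0 h0 θ).1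
  have hQf : mulOp (Q 0) f = mulL2 (V 1) f := by
    rw [mulOp_apply]
    congr 1
    exact funext hQ0
  obtain ⟨g₃, hg₃, n3⟩ := hg.mulL2 hV.contDiffOn_one hM
  have hM0 : 0 ≤ M := (abs_nonneg _).trans (hM.abs_le ⟨EuclideanSpace.single 0 1, by simp⟩)
  have hA := hV.nonneg
  have hg' : IsB (g + mulOp (Q 0) f) (g₂ + g₃) := by
    rw [hQf]
    exact hg₂.add hg₃
  have hpos : ∀ {t}, t ∈ Icc 0 T → ∀ p : ℝ, 0 ≤ (1 - t)⁻¹ ^ p := fun ht p =>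
    Real.rpow_nonneg (inv_nonneg.2 (by linarith [ht.2])) p
  refine ⟨Q, Q₁, Q₂, g, g₂ + g₃, solution Q f, ?_, hg', ?_, ?_⟩
  · exact
      { isSolution := isSolution_solution hQ hQ₁ hQ₂ hg hg'
        hasDerivAt_snd := hQ₁
        half_lt := hV.half_lt
        lt_one := hV.lt_one
        nonneg := hA
        pos := ha
        horizon := hT1
        norm_potential_zero := (ContinuousMap.norm_le _ hA).2
          fun θ => by simpa using (hb 0 h0 θ).2.1
        norm_fst := fun t ht => (ContinuousMap.norm_le _ (by have := hpos ht (3 - γ); positivity)).2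
          fun θ => (hb t ht θ).2.2.1
        norm_snd := fun t ht =>
          (ContinuousMap.norm_le _ (by have := hpos ht (5 - 2 * γ); positivity)).2
            fun θ => (hb t ht θ).2.2.2
        isB := hg
        norm_f := n0.trans hR
        norm_g := n1.trans hR }
  · have h1 := norm_add_le g₂ g₃
    have h2 : 10 * M * (‖f‖ + ‖g‖) ≤ 10 * M * (R + R) := by
      have := n0.trans hR
      have := n1.trans hR
      gcongr
    linarith [n2.trans hR]
  · intro k hk τ hτ hτ2
    refine W_eq_solution (continuous_iff_continuousAt.2 fun t => (hQ t).continuousAt) hk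
      (fun t ht θ => (hb t ht θ).1) f hτ ?_
    have := one_div_le_one_div_of_le (by linarith) hτ2
    linarith

/-- The derivatives of the propagator in terms of those of the solution in the variables
`(1 - 1/τ, k)`. -/
theorem hasDeriv_W {Q Q₁ : ℝ → C(S2, ℝ)} {V : ℝ → S2 → ℝ} {f : L2S} {u : ℝ × ℝ → L2S}
    (h : IsSolution Q Q₁ f u) {τ₀ : ℝ}
    (hW : ∀ k, 0 < k → ∀ τ, 1 ≤ τ → τ ≤ 2 * τ₀ → W V f k τ = u (1 - 1 / τ, k))
    {k : ℝ} (hk : 0 < k) (hτ₀ : 1 ≤ τ₀) :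
    HasDerivWithinAt (fun τ => W V f k τ) ((1 / τ₀ ^ 2) • pd₁ u (1 - 1 / τ₀, k)) (Ici 1) τ₀ ∧
    HasDerivAt (fun κ => W V f κ τ₀) (pd₂ u (1 - 1 / τ₀, k)) k ∧
    HasDerivWithinAt (fun τ => dtau (W V f) k τ) ((-2 / τ₀ ^ 3) • pd₁ u (1 - 1 / τ₀, k) +
      (1 / τ₀ ^ 4) • pd₁ (pd₁ u) (1 - 1 / τ₀, k)) (Ici 1) τ₀ ∧
    HasDerivAt (fun κ => dtau (W V f) κ τ₀) ((1 / τ₀ ^ 2) • pd₂ (pd₁ u) (1 - 1 / τ₀, k)) k ∧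
    HasDerivWithinAt (fun τ => dk (W V f) k τ) ((1 / τ₀ ^ 2) • pd₂ (pd₁ u) (1 - 1 / τ₀, k))
      (Ici 1) τ₀ ∧
    HasDerivAt (fun κ => dk (W V f) κ τ₀) (pd₂ (pd₂ u) (1 - 1 / τ₀, k)) k := by
  have hρ : ∀ τ : ℝ, 1 ≤ τ → HasDerivAt (fun s : ℝ => 1 - 1 / s) (1 / τ ^ 2) τ := by
    intro τ hτ
    have h1 := (hasDerivAt_inv (show τ ≠ 0 by linarith)).const_sub 1
    refine (h1.congr_deriv (by rw [neg_neg, one_div])).congr_of_eventuallyEq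
      (Eventually.of_forall fun x => ?_)
    simp only [one_div]
  -- composition with `τ ↦ 1 - 1/τ`, for functions that agree with `W` only near `τ₀`
  have hcomp : ∀ {F : ℝ → L2S} {v : ℝ → L2S} {v' : L2S} {τ : ℝ}, 1 ≤ τ → τ < 2 * τ₀ →
      (∀ s, 1 ≤ s → s < 2 * τ₀ → F s = v s) → HasDerivWithinAt v v' (Ici 1) τ →
      HasDerivWithinAt F v' (Ici 1) τ := by
    intro F v v' τ hτ hτ2 e hv
    refine hv.congr_of_eventuallyEq ?_ (e τ hτ hτ2)
    filter_upwards [self_mem_nhdsWithin, nhdsWithin_le_nhds (Iio_mem_nhds hτ2)] with s h1 h2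
    exact e s h1 h2
  have hu1 : ∀ κ, 0 < κ → ∀ τ, 1 ≤ τ → HasDerivAt (fun s => u (1 - 1 / s, κ))
      ((1 / τ ^ 2) • pd₁ u (1 - 1 / τ, κ)) τ := fun κ hκ τ hτ =>
    HasDerivAt.scomp (g₁ := fun s => u (s, κ)) τ (h.hasDerivAt₁ hκ _) (hρ τ hτ)
  have d1 : ∀ κ, 0 < κ → ∀ τ, 1 ≤ τ → τ < 2 * τ₀ → HasDerivWithinAt (fun s => W V f κ s)
      ((1 / τ ^ 2) • pd₁ u (1 - 1 / τ, κ)) (Ici 1) τ := fun κ hκ τ hτ hτ2 =>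
    hcomp hτ hτ2 (fun s hs hs2 => hW κ hκ s hs hs2.le) (hu1 κ hκ τ hτ).hasDerivWithinAt
  have e1 : ∀ κ, 0 < κ → ∀ τ, 1 ≤ τ → τ < 2 * τ₀ →
      dtau (W V f) κ τ = (1 / τ ^ 2) • pd₁ u (1 - 1 / τ, κ) := fun κ hκ τ hτ hτ2 =>
    (d1 κ hκ τ hτ hτ2).derivWithin (uniqueDiffOn_Ici 1 τ hτ)
  have d2 : ∀ κ, 0 < κ → ∀ τ, 1 ≤ τ → τ < 2 * τ₀ → HasDerivAt (fun κ => W V f κ τ)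
      (pd₂ u (1 - 1 / τ, κ)) κ := by
    intro κ hκ τ hτ hτ2
    refine (h.hasDerivAt₂ hκ _).congr_of_eventuallyEq ?_
    filter_upwards [Ioi_mem_nhds hκ] with κ' hκ'
    exact hW κ' hκ' τ hτ hτ2.le
  have e2 : ∀ κ, 0 < κ → ∀ τ, 1 ≤ τ → τ < 2 * τ₀ →
      dk (W V f) κ τ = pd₂ u (1 - 1 / τ, κ) := fun κ hκ τ hτ hτ2 => (d2 κ hκ τ hτ hτ2).deriv
  have hτ2 : τ₀ < 2 * τ₀ := by linarith
  have hτ0 : τ₀ ≠ 0 := by linarith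
  refine ⟨d1 k hk τ₀ hτ₀ hτ2, d2 k hk τ₀ hτ₀ hτ2, ?_, ?_, ?_, ?_⟩
  · refine hcomp hτ₀ hτ2 (e1 k hk) (HasDerivAt.hasDerivWithinAt ?_)
    have a1 : HasDerivAt (fun s => pd₁ u (1 - 1 / s, k))
        ((1 / τ₀ ^ 2) • pd₁ (pd₁ u) (1 - 1 / τ₀, k)) τ₀ :=
      HasDerivAt.scomp (g₁ := fun s => pd₁ u (s, k)) τ₀ (h.hasDerivAt₁₁ hk _) (hρ τ₀ hτ₀)
    have a2 : HasDerivAt (fun s : ℝ => 1 / s ^ 2) (-2 / τ₀ ^ 3) τ₀ := by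
      have := ((hasDerivAt_id τ₀).fun_pow 2).fun_inv (pow_ne_zero 2 hτ0)
      refine (this.congr_deriv ?_).congr_of_eventuallyEq (Eventually.of_forall fun x => ?_)
      · simp
        field_simp
      · simp
    refine (a2.smul a1).congr_deriv ?_
    rw [smul_smul, add_comm]
    congr 2
    field_simp
  · refine ((h.hasDerivAt₂₁ hk (1 - 1 / τ₀)).const_smul (1 / τ₀ ^ 2)).congr_of_eventuallyEq ?_
    filter_upwards [Ioi_mem_nhds hk] with κ hκ
    exact e1 κ hκ τ₀ hτ₀ hτ2
  · refine hcomp hτ₀ hτ2 (e2 k hk) (HasDerivAt.hasDerivWithinAt ?_)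
    exact HasDerivAt.scomp (g₁ := fun s => pd₂ u (s, k)) τ₀ (h.hasDerivAt₁₂ hk _) (hρ τ₀ hτ₀)
  · refine (h.hasDerivAt₂₂ hk (1 - 1 / τ₀)).congr_of_eventuallyEq ?_
    filter_upwards [Ioi_mem_nhds hk] with κ hκ
    exact e2 κ hκ τ₀ hτ₀ hτ2

theorem mul_rpow_lt {C D τ p : ℝ} (hτ : 1 ≤ τ) (h : C < D) : C * τ ^ p < D * τ ^ p :=
  mul_lt_mul_of_pos_right h (Real.rpow_pos_of_pos (one_pos.trans_le hτ) p)

theorem norm_inv_pow_smul_le {v : L2S} {C τ p : ℝ} (hτ : 1 ≤ τ) (n : ℕ) (h : ‖v‖ ≤ C * τ ^ p) :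
    ‖(1 / τ ^ n) • v‖ ≤ C * τ ^ (p - n) := by
  have hτ0 : 0 < τ := one_pos.trans_le hτ
  rw [norm_smul, Real.norm_of_nonneg (by positivity), Real.rpow_sub hτ0, Real.rpow_natCast,
    one_div_mul_eq_div, ← mul_div_assoc]
  exact div_le_div_of_nonneg_right h (by positivity)

end Propagator

end SphereEvolution

theorem lemma2 (a b : ℝ) (ha : 0 < a) (hab : a ≤ b) (γ A R : ℝ) :
    (∃ C : ℝ, ∀ V : ℝ → S2 → ℝ, CondA1 γ A V →
      ∀ f : L2S, MemH4 f → normH4 f ≤ R →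
      ∀ k ∈ Set.Icc a b, ∀ τ : ℝ, 1 ≤ τ →
        (DiffTau (W V f) k τ ∧
          ‖dtau (W V f) k τ‖ < C * τ ^ (-γ)) ∧
        (DiffK (W V f) k τ ∧
          ‖dk (W V f) k τ‖ < C * τ ^ (1 - γ))) ∧
    (∀ M : ℝ, ∃ C : ℝ, ∀ V : ℝ → S2 → ℝ, CondA1 γ A V →
      C2Bound M (V 1) →
      ∀ f : L2S, MemH4 f → normH4 f ≤ R →
      ∀ k ∈ Set.Icc a b, ∀ τ : ℝ, 1 ≤ τ →
        (DiffTau (dtau (W V f)) k τ ∧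
          ‖dtau (dtau (W V f)) k τ‖
            < C * τ ^ (-2 * γ)) ∧
        (DiffK (dtau (W V f)) k τ ∧
          DiffTau (dk (W V f)) k τ ∧
          dk (dtau (W V f)) k τ
            = dtau (dk (W V f)) k τ ∧
          ‖dk (dtau (W V f)) k τ‖
            < C * τ ^ (1 - 2 * γ)) ∧
        (DiffK (dk (W V f)) k τ ∧
          ‖dk (dk (W V f)) k τ‖
            < C * τ ^ (2 - 2 * γ))) := by
  have ht : ∀ {τ : ℝ}, 1 ≤ τ → 1 - 1 / τ ∈ Set.Ico 0 (1 - 1 / (2 * τ)) ∧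
      (1 - (1 - 1 / τ))⁻¹ = τ := by
    intro τ hτ
    have hτ0 : 0 < τ := one_pos.trans_le hτ
    refine ⟨⟨?_, ?_⟩, by rw [sub_sub_cancel, one_div, inv_inv]⟩
    · rw [sub_nonneg, div_le_one hτ0]
      exact hτ
    · have := one_div_lt_one_div_of_lt hτ0 (show τ < 2 * τ by linarith)
      linarith
  constructor
  · refine ⟨max (constT γ A a R) (constK γ A a R) + 1, fun V hV f hf hR k hk τ hτ => ?_⟩
    -- a bound `M` for `V 1` serves to apply the regularity theorem; it does not enter the constant
    obtain ⟨M, hM⟩ := exists_c2Bound hV.contDiffOn_one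
    obtain ⟨Q, Q₁, Q₂, g, g', u, hu, -, -, hW⟩ := exists_boundedSolution hV hM hf hR ha hτ
    obtain ⟨d1, d2, -⟩ := hasDeriv_W hu.isSolution hW (ha.trans_le hk.1) hτ
    obtain ⟨htm, htτ⟩ := ht hτ
    have htm' := Set.Ico_subset_Icc_self htm
    have b1 := hu.norm_pd₁_le hk.1 htm'
    have b2 := hu.norm_pd₂_le hk.1 htm'
    rw [htτ] at b1 b2
    refine ⟨⟨d1.differentiableWithinAt, ?_⟩, d2.differentiableAt, ?_⟩
    · rw [dtau, d1.derivWithin (uniqueDiffOn_Ici 1 τ hτ)]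
      refine (norm_inv_pow_smul_le hτ 2 b1).trans_lt ?_
      rw [show 2 - γ - (2 : ℕ) = -γ by push_cast; ring]
      exact mul_rpow_lt hτ (lt_add_of_le_of_pos (le_max_left _ _) one_pos)
    · rw [dk, d2.deriv]
      exact b2.trans_lt (mul_rpow_lt hτ (lt_add_of_le_of_pos (le_max_right _ _) one_pos))
  · intro M
    refine ⟨max (2 * constT γ A a R + constTT γ A a R (R + 20 * M * R))
      (max (constTK γ A a R (R + 20 * M * R)) (constKK γ A a R (R + 20 * M * R))) + 1,
      fun V hV hM f hf hR k hk τ hτ => ?_⟩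
    obtain ⟨Q, Q₁, Q₂, g, g', u, hu, hg', hR', hW⟩ := exists_boundedSolution hV hM hf hR ha hτ
    obtain ⟨-, -, d11, d21, d12, d22⟩ := hasDeriv_W hu.isSolution hW (ha.trans_le hk.1) hτ
    obtain ⟨htm, htτ⟩ := ht hτ
    have b1 := hu.norm_pd₁_le hk.1 (Set.Ico_subset_Icc_self htm)
    have b11 := hu.norm_pd₁_pd₁_le hg' hR' hk.1 htm
    have b21 := hu.norm_pd₂_pd₁_le hg' hR' hk.1 htm
    have b22 := hu.norm_pd₂_pd₂_le hg' hR' hk.1 htm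
    rw [htτ] at b1 b11 b21 b22
    have hu' := uniqueDiffOn_Ici (1 : ℝ) τ hτ
    refine ⟨⟨d11.differentiableWithinAt, ?_⟩, ⟨d21.differentiableAt, d12.differentiableWithinAt,
      ?_, ?_⟩, d22.differentiableAt, ?_⟩
    · rw [dtau, d11.derivWithin hu']
      have c1 := norm_inv_pow_smul_le hτ 3 b1
      have c2 := norm_inv_pow_smul_le hτ 4 b11
      rw [show 2 - γ - (3 : ℕ) = -1 - γ by push_cast; ring] at c1
      rw [show 4 - 2 * γ - (4 : ℕ) = -2 * γ by push_cast; ring] at c2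
      have c3 : τ ^ (-1 - γ) ≤ τ ^ (-2 * γ) :=
        Real.rpow_le_rpow_of_exponent_le hτ (by linarith [hV.lt_one])
      have c4 : ‖(-2 / τ ^ 3) • pd₁ u (1 - 1 / τ, k)‖ ≤ 2 * constT γ A a R * τ ^ (-2 * γ) := by
        rw [show -2 / τ ^ 3 = -2 * (1 / τ ^ 3) by ring, mul_smul, norm_smul, norm_neg,
          Real.norm_two, mul_assoc]
        exact mul_le_mul_of_nonneg_left
          (c1.trans (mul_le_mul_of_nonneg_left c3 hu.constT_nonneg)) zero_le_two
      refine ((norm_add_le _ _).trans (add_le_add c4 c2)).trans_lt ?_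
      rw [← add_mul]
      exact mul_rpow_lt hτ (lt_add_of_le_of_pos (le_max_left _ _) one_pos)
    · rw [dk, d21.deriv, dtau, d12.derivWithin hu']
    · rw [dk, d21.deriv]
      refine (norm_inv_pow_smul_le hτ 2 b21).trans_lt ?_
      rw [show 3 - 2 * γ - (2 : ℕ) = 1 - 2 * γ by push_cast; ring]
      exact mul_rpow_lt hτ
        (lt_add_of_le_of_pos ((le_max_left _ _).trans (le_max_right _ _)) one_pos)
    · rw [dk, d22.deriv]
      exact b22.trans_lt (mul_rpow_lt hτ
        (lt_add_of_le_of_pos ((le_max_right _ _).trans (le_max_right _ _)) one_pos))
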